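/- Let $k$ be an algebraically closed field of characteristic $0$. Let $\mathcal D=(G,\chi,a)$ consist of a finite abelian group $G$, a character $\chi:G\to k^\times$ and an element $a\in G$ with $\chi(a)\neq 1$, and let $\ell=|\chi(a)|$ (the order of $\chi(a)$ in $k^\times$). Let $H_{\mathcal D}$ be the (finite-dimensional, rank one pointed) Hopf algebra generated as a $k$-algebra by the group $G$ and an element $x$, with the relations of $G$ and $$x^{\ell}=0,\qquad xg=\chi(g)\,gx\quad(g\in G),$$ and with $\Delta(g)=g\otimes g$, $\varepsilon(g)=1$ for $g\in G$, $\Delta(x)=x\otimes a+1\otimes x$, $\varepsilon(x)=0$. For a finite-dimensional Hopf algebra $H$ with antipode $S$, the Drinfel'd double $D(H)$ is $(H^*)^{\mathrm{cop}}\otimes H$ as a coalgebra, with multiplication $$(g\otimes h)(f\otimes b)=\sum g\,\bigl(h_1\rightharpoonup f\leftharpoonup S^{-1}(h_3)\bigr)\otimes h_2b,$$ where $\langle c\rightharpoonup f,b\rangle=\langle f,bc\rangle$ and $\langle f\leftharpoonup c,b\rangle=\langle f,cb\rangle$. Put $D=D(H_{\mathcal D})$, let $G_C(D)$ be the set of central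 group-like elements of $D$, and let $\overline D=D/D\,(kG_C(D))^{+}$, where $L^+=L\cap\ker\varepsilon$. Let $\mathcal S_D$ and $\mathcal S_{\overline D}$ be the sets of isomorphism classes of simple left modules over $D$ and over $\overline D$, and let $\mathcal S^1_D$ be the set of isomorphism classes of $D$-modules that are one-dimensional over $k$. Then $([U],[V])\mapsto[U\otimes_k V]$, where $U$ is viewed as a $D$-module through $D\to\overline D$ and $D$ acts on $U\otimes_k V$ through its comultiplication, defines a map $$\Phi:\ \mathcal S_{\overline D}\times\mathcal S^1_D\longrightarrow\mathcal S_D ,$$ and $\Phi$ is a bijection if and only if $\ell$ is odd and $\ell=|a|=|\chi|$, where $|a|$ and $|\chi|$ are the orders of $a$ in $G$ and of $\chi$ in $\Gamma=\mathrm{Hom}(G,k^\times)$. Moreover, let $K\subseteq G\times\Gamma$ be the kernel of the character $(g,\gamma)\mapsto\chi(g)^{-1}\gamma(a)$ of $G\times\Gamma$, and let $K^\perp$ be the group of characters of $G\times\Gamma$ that are trivial on $K$, viewed as a subgroup of $G\times\Gamma$ by letting $(g,\beta)\in G\times\Gamma$ correspond to the character $(f,\gamma)\mapsto\beta(f)\gamma(g)$.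 Then $\Phi$ is a bijection if and only if $K^\perp\cap K=1$. -/

import Mathlib

noncomputable section

open TensorProduct WithConv Coalgebra

set_option linter.unusedSectionVars false

namespace HopfDouble

section Convolution

variable {k H E : Type*} [Field k] [Ring H] [Bialgebra k H] [Semiring E] [Algebra k E]

theorem conv_apply (X Y : WithConv (H →ₗ[k] E)) (h : H) :
    (X * Y).ofConv h = ∑ i ∈ (ℛ k h).index,
      X.ofConv ((ℛ k h).left i) * Y.ofConv ((ℛ k h).right i) :=
  (ℛ k h).convMul_apply X Y

end Convolution

section Intertwine

variable {k H V W : Type*} [Field k] [Ring H] [Bialgebra k H]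
  [AddCommMonoid V] [Module k V] [AddCommMonoid W] [Module k W]

theorem conv_end_apply (X Y : WithConv (H →ₗ[k] Module.End k V)) (h : H) :
    (X * Y).ofConv h = ∑ i ∈ (ℛ k h).index,
      X.ofConv ((ℛ k h).left i) * Y.ofConv ((ℛ k h).right i) :=
  (ℛ k h).convMul_apply X Y

/-- If `X h ∘ T = T ∘ X' h` and `Y h ∘ T = T ∘ Y' h` for all `h`, the same holds for the
convolution products. -/
theorem conv_intertwine (T : V →ₗ[k] W) (X Y : WithConv (H →ₗ[k] Module.End k W))
    (X' Y' : WithConv (H →ₗ[k] Module.End k V))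
    (hX : ∀ h, X.ofConv h ∘ₗ T = T ∘ₗ X'.ofConv h)
    (hY : ∀ h, Y.ofConv h ∘ₗ T = T ∘ₗ Y'.ofConv h) (h : H) :
    (X * Y).ofConv h ∘ₗ T = T ∘ₗ (X' * Y').ofConv h := by
  ext v
  rw [LinearMap.comp_apply, LinearMap.comp_apply, conv_end_apply, conv_end_apply, LinearMap.sum_apply,
    LinearMap.sum_apply, map_sum]
  refine Finset.sum_congr rfl fun i _ => ?_
  have h1 := LinearMap.congr_fun (hY ((ℛ k h).right i)) v
  have h2 := LinearMap.congr_fun (hX ((ℛ k h).left i)) (Y'.ofConv ((ℛ k h).right i) v)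
  simp only [LinearMap.comp_apply] at h1 h2
  rw [Module.End.mul_apply, Module.End.mul_apply, h1, h2]

/-- If `X h ∘ Y h' ∘ T = ε(h) Y h' ∘ T` then `(X * Y) h ∘ T = Y h ∘ T`. -/
theorem conv_absorb (T : V →ₗ[k] W) (X Y : WithConv (H →ₗ[k] Module.End k W))
    (hX : ∀ h h', X.ofConv h ∘ₗ Y.ofConv h' ∘ₗ T = counit (R := k) h • Y.ofConv h' ∘ₗ T) (h : H) :
    (X * Y).ofConv h ∘ₗ T = Y.ofConv h ∘ₗ T := by
  ext v
  rw [LinearMap.comp_apply, LinearMap.comp_apply, conv_end_apply, LinearMap.sum_apply]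
  conv_rhs => rw [← sum_counit_smul (ℛ k h), map_sum, LinearMap.sum_apply]
  refine Finset.sum_congr rfl fun i _ => ?_
  have h1 := LinearMap.congr_fun (hX ((ℛ k h).left i) ((ℛ k h).right i)) v
  simp only [LinearMap.comp_apply, LinearMap.smul_apply] at h1
  rw [Module.End.mul_apply, h1, map_smul, LinearMap.smul_apply]

/-- The convolution of two multiplicative maps with commuting values is multiplicative. -/
theorem conv_mul (X Y : WithConv (H →ₗ[k] Module.End k V))
    (hX : ∀ a b, X.ofConv (a * b) = X.ofConv a * X.ofConv b)
    (hY : ∀ a b, Y.ofConv (a * b) = Y.ofConv a * Y.ofConv b)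
    (hXY : ∀ a b, Commute (X.ofConv a) (Y.ofConv b)) (a b : H) :
    (X * Y).ofConv (a * b) = (X * Y).ofConv a * (X * Y).ofConv b := by
  have h1 := ((ℛ k a).mul (ℛ k b)).convMul_apply X Y
  refine h1.trans ?_
  rw [conv_end_apply X Y a, conv_end_apply X Y b, Finset.sum_mul_sum, ← Finset.sum_product']
  refine Finset.sum_congr rfl fun p _ => ?_
  change X.ofConv ((ℛ k a).left p.1 * (ℛ k b).left p.2) *
    Y.ofConv ((ℛ k a).right p.1 * (ℛ k b).right p.2) = _
  rw [hX, hY]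
  have := (hXY ((ℛ k b).left p.2) ((ℛ k a).right p.1)).eq
  simp only [mul_assoc]
  congr 1
  simp only [← mul_assoc]
  rw [this]

theorem conv_commute (X Y : WithConv (H →ₗ[k] Module.End k V)) (e : Module.End k V)
    (hX : ∀ a, Commute (X.ofConv a) e) (hY : ∀ a, Commute (Y.ofConv a) e) (a : H) :
    Commute ((X * Y).ofConv a) e := by
  rw [conv_end_apply]
  exact Commute.sum_left _ _ _ fun i _ => (hX _).mul_left (hY _)

theorem conv_one (X Y : WithConv (H →ₗ[k] Module.End k V)) (hX : X.ofConv 1 = 1) (hY : Y.ofConv 1 = 1) :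
    (X * Y).ofConv 1 = 1 := by
  simp [LinearMap.convMul_def, Algebra.TensorProduct.one_def, hX, hY]

end Intertwine

section Antipode

variable (k H : Type*) [Field k] [Ring H] [HopfAlgebra k H]

/-- The antipode is bijective (this is automatic for finite-dimensional Hopf algebras). -/
class BijectiveAntipode : Prop where
  bijective : Function.Bijective (HopfAlgebra.antipode k (A := H))

variable [BijectiveAntipode k H]

/-- The composition inverse of the antipode. -/
def antipodeInv : H →ₗ[k] H :=
  ((LinearEquiv.ofBijective (HopfAlgebra.antipode k (A := H))
    BijectiveAntipode.bijective).symm : H →ₗ[k] H)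

variable {k H}

theorem antipode_antipodeInv (h : H) : HopfAlgebra.antipode k (antipodeInv k H h) = h :=
  (LinearEquiv.ofBijective (HopfAlgebra.antipode k (A := H))
    BijectiveAntipode.bijective).apply_symm_apply h

theorem antipode_inj {a b : H}
    (h : HopfAlgebra.antipode k a = HopfAlgebra.antipode k b) : a = b :=
  (BijectiveAntipode.bijective (k := k) (H := H)).1 h

theorem antipodeInv_mul (a b : H) :
    antipodeInv k H (a * b) = antipodeInv k H b * antipodeInv k H a := by
  apply antipode_inj (k := k)
  rw [HopfAlgebra.antipode_mul_antidistrib]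
  simp only [antipode_antipodeInv]

theorem antipodeInv_one : antipodeInv k H 1 = 1 := by
  apply antipode_inj (k := k)
  rw [antipode_antipodeInv, HopfAlgebra.antipode_one]

theorem counit_antipodeInv (h : H) : counit (R := k) (antipodeInv k H h) = counit h := by
  conv_rhs => rw [← antipode_antipodeInv (k := k) h, HopfAlgebra.counit_antipode]

theorem sum_antipodeInv_right_mul_left (h : H) :
    ∑ i ∈ (ℛ k h).index, antipodeInv k H ((ℛ k h).right i) * (ℛ k h).left i =
      algebraMap k H (counit h) := by
  apply antipode_inj (k := k)
  simp only [map_sum, HopfAlgebra.antipode_mul_antidistrib, antipode_antipodeInv]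
  rw [HopfAlgebra.sum_antipode_mul_eq_algebraMap_counit]
  simp [Algebra.algebraMap_eq_smul_one]

theorem sum_right_mul_antipodeInv_left (h : H) :
    ∑ i ∈ (ℛ k h).index, (ℛ k h).right i * antipodeInv k H ((ℛ k h).left i) =
      algebraMap k H (counit h) := by
  apply antipode_inj (k := k)
  simp only [map_sum, HopfAlgebra.antipode_mul_antidistrib, antipode_antipodeInv]
  rw [HopfAlgebra.sum_mul_antipode_eq_algebraMap_counit]
  simp [Algebra.algebraMap_eq_smul_one]

end Antipode

section AntipodeComul

variable {k H : Type*} [Field k] [Ring H] [HopfAlgebra k H]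

theorem comul_antipode (h : H) : comul (R := k) (HopfAlgebra.antipode k h) =
    ∑ i ∈ (ℛ k h).index, HopfAlgebra.antipode k ((ℛ k h).right i) ⊗ₜ[k]
      HopfAlgebra.antipode k ((ℛ k h).left i) := by
  set S : H →ₗ[k] H := HopfAlgebra.antipode k with hS
  let j1 : H →ₐ[k] H ⊗[k] H := Algebra.TensorProduct.includeLeft
  let j2 : H →ₐ[k] H ⊗[k] H := Algebra.TensorProduct.includeRight
  have e1 : toConv (comul (R := k) (A := H)) = toConv j1.toLinearMap * toConv j2.toLinearMap := by
    ext h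
    rw [LinearMap.convMul_def]
    conv_lhs => rw [← (ℛ k h).eq]
    conv_rhs => simp only [ofConv_toConv, LinearMap.comp_apply]
    rw [← (ℛ k h).eq]
    simp [j1, j2]
  have e2 : toConv (j1.toLinearMap ∘ₗ S) * toConv j1.toLinearMap = 1 := by
    have := LinearMap.algHom_comp_convMul_distrib j1 (toConv S) (toConv LinearMap.id)
    rw [hS, LinearMap.antipode_mul_id] at this
    rw [hS]
    refine Eq.trans (b := toConv (j1.toLinearMap ∘ₗ ofConv 1)) ?_ ?_
    · rw [this]; rfl
    · ext h; simp [LinearMap.convOne_def]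
  have e3 : toConv (j2.toLinearMap ∘ₗ S) * toConv j2.toLinearMap = 1 := by
    have := LinearMap.algHom_comp_convMul_distrib j2 (toConv S) (toConv LinearMap.id)
    rw [hS, LinearMap.antipode_mul_id] at this
    rw [hS]
    refine Eq.trans (b := toConv (j2.toLinearMap ∘ₗ ofConv 1)) ?_ ?_
    · rw [this]; rfl
    · ext h; simp [LinearMap.convOne_def]
  have e4 : (toConv (j2.toLinearMap ∘ₗ S) * toConv (j1.toLinearMap ∘ₗ S)) *
      toConv (comul (R := k) (A := H)) = 1 := by
    rw [e1, mul_assoc, ← mul_assoc (toConv (j1.toLinearMap ∘ₗ S)), e2, one_mul, e3]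
  have e5 := left_inv_eq_right_inv e4 (LinearMap.comul_right_inv (R := k) (C := H))
  have e6 := congrArg (fun z => z.ofConv h) e5
  simp only [LinearMap.comp_apply] at e6
  rw [← e6, conv_apply]
  simp [j1, j2]

variable [BijectiveAntipode k H]

theorem comul_antipodeInv (h : H) : comul (R := k) (antipodeInv k H h) =
    ∑ i ∈ (ℛ k h).index, antipodeInv k H ((ℛ k h).right i) ⊗ₜ[k]
      antipodeInv k H ((ℛ k h).left i) := by
  have h1 : TensorProduct.comm k H H (TensorProduct.map (HopfAlgebra.antipode k)
      (HopfAlgebra.antipode k) (comul (R := k) (antipodeInv k H h))) = comul (R := k) h := by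
    conv_rhs => rw [← antipode_antipodeInv (k := k) h, comul_antipode]
    conv_lhs => rw [← (ℛ k (antipodeInv k H h)).eq]
    simp
  have h2 : ∀ t : H ⊗[k] H, TensorProduct.map (antipodeInv k H) (antipodeInv k H)
      (TensorProduct.map (HopfAlgebra.antipode k) (HopfAlgebra.antipode k) t) = t := by
    intro t
    induction t with
    | zero => simp
    | add x y hx hy => simp only [map_add, hx, hy]
    | tmul x y =>
      simp only [TensorProduct.map_tmul]
      congr 1 <;> exact antipode_inj (k := k) (antipode_antipodeInv _)
  rw [← h2 (comul (R := k) (antipodeInv k H h)), (LinearEquiv.eq_symm_apply _).2 h1]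
  conv_lhs => rw [← (ℛ k h).eq]
  simp

end AntipodeComul

section Dual

variable (k H : Type*) [Field k] [Ring H] [HopfAlgebra k H]

/-- The linear dual `H^*` with the convolution product (an algebra by Mathlib's instances). -/
abbrev ConvDual := WithConv (Module.Dual k H)

variable {k H}

/-- `(h ⇀ f)(b) = f (b h)`. -/
def leftHit : H →ₗ[k] Module.End k (ConvDual k H) :=
  LinearMap.mk₂ k (fun h f => toConv (f.ofConv ∘ₗ LinearMap.mulRight k h))
    (fun a b f => by ext c; simp [mul_add]) (fun c a f => by ext; simp)
    (fun a f g => by ext; simp) (fun c a f => by ext; simp)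

/-- `(f ↼ h)(b) = f (h b)`. -/
def rightHit : H →ₗ[k] Module.End k (ConvDual k H) :=
  LinearMap.mk₂ k (fun h f => toConv (f.ofConv ∘ₗ LinearMap.mulLeft k h))
    (fun a b f => by ext c; simp [add_mul]) (fun c a f => by ext; simp)
    (fun a f g => by ext; simp) (fun c a f => by ext; simp)

theorem leftHit_apply (h : H) (f : ConvDual k H) (b : H) :
    (leftHit h f).ofConv b = f.ofConv (b * h) := rfl

theorem rightHit_apply (h : H) (f : ConvDual k H) (b : H) :
    (rightHit h f).ofConv b = f.ofConv (h * b) := rfl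

/-- Evaluation of elements of `H^* ⊗ H^*` on pairs. -/
def eval₂ (b c : H) : ConvDual k H ⊗[k] ConvDual k H →ₗ[k] k :=
  TensorProduct.lift ((LinearMap.mul k k).compl₁₂
    (Module.Dual.eval k H b ∘ₗ (WithConv.linearEquiv k (Module.Dual k H)).toLinearMap)
    (Module.Dual.eval k H c ∘ₗ (WithConv.linearEquiv k (Module.Dual k H)).toLinearMap))

@[simp]
theorem eval₂_tmul (b c : H) (f g : ConvDual k H) :
    eval₂ b c (f ⊗ₜ[k] g) = f.ofConv b * g.ofConv c := rfl

/-- Evaluation of elements of `H^* ⊗ (H^* ⊗ H^*)` on triples. -/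
def eval₃ (b c d : H) : ConvDual k H ⊗[k] (ConvDual k H ⊗[k] ConvDual k H) →ₗ[k] k :=
  TensorProduct.lift ((LinearMap.mul k k).compl₁₂
    (Module.Dual.eval k H b ∘ₗ (WithConv.linearEquiv k (Module.Dual k H)).toLinearMap)
    (eval₂ c d))

@[simp]
theorem eval₃_tmul (b c d : H) (f : ConvDual k H) (t : ConvDual k H ⊗[k] ConvDual k H) :
    eval₃ b c d (f ⊗ₜ[k] t) = f.ofConv b * eval₂ c d t := rfl

variable [Module.Finite k H]

variable (k H) in
/-- The identification `H^* ⊗ H^* = (H ⊗ H)^*`, `(f ⊗ g)(b ⊗ c) = f(b) g(c)`. -/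
def dualPair : ConvDual k H ⊗[k] ConvDual k H ≃ₗ[k] Module.Dual k (H ⊗[k] H) :=
  TensorProduct.congr (WithConv.linearEquiv k (Module.Dual k H))
    (WithConv.linearEquiv k (Module.Dual k H)) ≪≫ₗ TensorProduct.dualDistribEquiv k H H

/-- The coalgebra structure of `(H^*)^cop`: the comultiplication of `f` is the element
`∑ f₁ ⊗ f₂` with `∑ f₁ (b) f₂ (c) = f (c b)`, and `ε (f) = f 1`. -/
instance coopStruct : CoalgebraStruct k (ConvDual k H) where
  comul := (dualPair k H).symm.toLinearMap ∘ₗ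
    Module.Dual.transpose (R := k)
      (LinearMap.mul' k H ∘ₗ (TensorProduct.comm k H H).toLinearMap) ∘ₗ
    (WithConv.linearEquiv k (Module.Dual k H)).toLinearMap
  counit := Module.Dual.eval k H 1 ∘ₗ (WithConv.linearEquiv k (Module.Dual k H)).toLinearMap

theorem coop_counit (f : ConvDual k H) : counit (R := k) f = f.ofConv 1 := rfl

theorem eval₂_eq (b c : H) (t : ConvDual k H ⊗[k] ConvDual k H) :
    eval₂ b c t = (dualPair k H) t (b ⊗ₜ[k] c) := by
  induction t with
  | zero => simp
  | add x y hx hy => simp only [map_add, hx, hy, LinearMap.add_apply]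
  | tmul f g => rfl

theorem eval₂_ext {s t : ConvDual k H ⊗[k] ConvDual k H}
    (h : ∀ b c : H, eval₂ b c s = eval₂ b c t) : s = t := by
  apply (dualPair k H).injective
  ext b c
  simpa only [eval₂_eq] using! h b c

theorem eval₂_comul (b c : H) (f : ConvDual k H) :
    eval₂ b c (comul (R := k) f) = f.ofConv (c * b) := by
  rw [eval₂_eq]
  have h : dualPair k H (comul (R := k) f) = Module.Dual.transpose (R := k)
      (LinearMap.mul' k H ∘ₗ (TensorProduct.comm k H H).toLinearMap) f.ofConv :=
    LinearEquiv.apply_symm_apply _ _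
  rw [h]
  rfl

theorem eval₃_ext {s t : ConvDual k H ⊗[k] (ConvDual k H ⊗[k] ConvDual k H)}
    (h : ∀ b c d : H, eval₃ b c d s = eval₃ b c d t) : s = t := by
  let e := TensorProduct.congr (WithConv.linearEquiv k (Module.Dual k H)) (dualPair k H) ≪≫ₗ
      TensorProduct.dualDistribEquiv k H (H ⊗[k] H)
  have key : ∀ (b c d : H) (u : ConvDual k H ⊗[k] (ConvDual k H ⊗[k] ConvDual k H)),
      e u (b ⊗ₜ[k] (c ⊗ₜ[k] d)) = eval₃ b c d u := by
    intro b c d u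
    induction u with
    | zero => simp
    | add x y hx hy => simp only [map_add, hx, hy, LinearMap.add_apply]
    | tmul f v =>
      rw [eval₃_tmul, eval₂_eq]
      rfl
  apply e.injective
  refine TensorProduct.ext' fun b u => ?_
  induction u with
  | zero => simp
  | add x y hx hy => simp only [TensorProduct.tmul_add, map_add, hx, hy]
  | tmul c d => rw [key, key, h]

instance coop : Coalgebra k (ConvDual k H) where
  coassoc := by
    ext f : 1
    apply eval₃_ext
    intro b c d
    have h1 : ∀ t : ConvDual k H ⊗[k] ConvDual k H,
        eval₃ b c d (TensorProduct.assoc k _ _ _ (comul.rTensor _ t)) = eval₂ (c * b) d t := by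
      intro t
      induction t with
      | zero => simp
      | add x y hx hy => simp only [map_add, hx, hy]
      | tmul f g =>
        rw [LinearMap.rTensor_tmul, eval₂_tmul, ← eval₂_comul]
        generalize comul (R := k) f = u
        induction u with
        | zero => simp
        | add x y hx hy => simp only [map_add, hx, hy, TensorProduct.add_tmul, add_mul]
        | tmul p q => simp [mul_assoc]
    have h2 : ∀ t : ConvDual k H ⊗[k] ConvDual k H,
        eval₃ b c d (comul.lTensor _ t) = eval₂ b (d * c) t := by
      intro t
      induction t with
      | zero => simp
      | add x y hx hy => simp only [map_add, hx, hy]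
      | tmul f g => rw [LinearMap.lTensor_tmul, eval₂_tmul, eval₃_tmul, ← eval₂_comul]
    simp only [LinearMap.comp_apply, LinearEquiv.coe_coe]
    rw [h1, h2, eval₂_comul, eval₂_comul, mul_assoc]
  rTensor_counit_comp_comul := by
    ext f : 1
    have h1 : ∀ t : ConvDual k H ⊗[k] ConvDual k H, ∀ c : H,
        (TensorProduct.lid k (ConvDual k H) (counit.rTensor _ t)).ofConv c = eval₂ 1 c t := by
      intro t c
      induction t with
      | zero => simp
      | add x y hx hy =>
        simp only [map_add, ofConv_add, LinearMap.add_apply, hx, hy]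
      | tmul f g => simp [coop_counit]
    apply (TensorProduct.lid k (ConvDual k H)).injective
    ext c
    simp only [LinearMap.comp_apply]
    rw [h1, eval₂_comul]
    simp
  lTensor_counit_comp_comul := by
    ext f : 1
    have h1 : ∀ t : ConvDual k H ⊗[k] ConvDual k H, ∀ c : H,
        (TensorProduct.rid k (ConvDual k H) (counit.lTensor _ t)).ofConv c = eval₂ c 1 t := by
      intro t c
      induction t with
      | zero => simp
      | add x y hx hy =>
        simp only [map_add, ofConv_add, LinearMap.add_apply, hx, hy]
      | tmul f g => simp [coop_counit, mul_comm]
    apply (TensorProduct.rid k (ConvDual k H)).injective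
    ext c
    simp only [LinearMap.comp_apply]
    rw [h1, eval₂_comul]
    simp

end Dual

section Operators

variable {k H : Type*} [Field k] [Ring H] [HopfAlgebra k H] [BijectiveAntipode k H]

/-- `f ⊗ b ↦ (h ⇀ f) ⊗ b`. -/
def opL : H →ₗ[k] Module.End k (ConvDual k H ⊗[k] H) :=
  LinearMap.rTensorHom H ∘ₗ leftHit

/-- `f ⊗ b ↦ f ⊗ h b`. -/
def opM : H →ₗ[k] Module.End k (ConvDual k H ⊗[k] H) :=
  LinearMap.lTensorHom (ConvDual k H) ∘ₗ LinearMap.mul k H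

/-- `f ⊗ b ↦ (f ↼ S⁻¹ h) ⊗ b`. -/
def opR : H →ₗ[k] Module.End k (ConvDual k H ⊗[k] H) :=
  LinearMap.rTensorHom H ∘ₗ rightHit ∘ₗ antipodeInv k H

/-- `f ⊗ b ↦ (g f) ⊗ b`. -/
def opF : ConvDual k H →ₗ[k] Module.End k (ConvDual k H ⊗[k] H) :=
  LinearMap.rTensorHom H ∘ₗ LinearMap.mul k (ConvDual k H)

/-- `f ⊗ b ↦ ∑ (h₁ ⇀ f ↼ S⁻¹ h₃) ⊗ h₂ b`, written as the convolution product of the three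
actions of `h₁`, `h₂`, `h₃`. -/
def leftMul : H →ₗ[k] Module.End k (ConvDual k H ⊗[k] H) :=
  WithConv.ofConv ((toConv opL * toConv opM * toConv opR :
    WithConv (H →ₗ[k] Module.End k (ConvDual k H ⊗[k] H))))

/-- The product of the Drinfel'd double,
`(g ⊗ h)(f ⊗ b) = ∑ g (h₁ ⇀ f ↼ S⁻¹ h₃) ⊗ h₂ b`. -/
def doubleMul : ConvDual k H ⊗[k] H →ₗ[k] Module.End k (ConvDual k H ⊗[k] H) :=
  TensorProduct.lift ((LinearMap.mul k (Module.End k (ConvDual k H ⊗[k] H))).compl₁₂ opF leftMul)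

theorem opL_tmul (h : H) (f : ConvDual k H) (b : H) :
    opL h (f ⊗ₜ[k] b) = leftHit h f ⊗ₜ[k] b := rfl

theorem opM_tmul (h : H) (f : ConvDual k H) (b : H) :
    opM h (f ⊗ₜ[k] b) = f ⊗ₜ[k] (h * b) := rfl

theorem opR_tmul (h : H) (f : ConvDual k H) (b : H) :
    opR h (f ⊗ₜ[k] b) = rightHit (antipodeInv k H h) f ⊗ₜ[k] b := rfl

theorem opF_tmul (g : ConvDual k H) (f : ConvDual k H) (b : H) :
    opF g (f ⊗ₜ[k] b) = (g * f) ⊗ₜ[k] b := rfl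

theorem doubleMul_tmul (g : ConvDual k H) (h : H) (v : ConvDual k H ⊗[k] H) :
    doubleMul (g ⊗ₜ[k] h) v = opF g (leftMul h v) := rfl

/-- The explicit formula for the product of the double. -/
theorem doubleMul_tmul_tmul (g f : ConvDual k H) (h b : H) :
    doubleMul (g ⊗ₜ[k] h) (f ⊗ₜ[k] b) =
      ∑ i ∈ (ℛ k h).index, ∑ j ∈ (ℛ k ((ℛ k h).left i)).index,
        (g * leftHit ((ℛ k ((ℛ k h).left i)).left j)
          (rightHit (antipodeInv k H ((ℛ k h).right i)) f)) ⊗ₜ[k]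
          ((ℛ k ((ℛ k h).left i)).right j * b) := by
  rw [doubleMul_tmul, leftMul, conv_end_apply, LinearMap.sum_apply, map_sum]
  refine Finset.sum_congr rfl fun i _ => ?_
  rw [conv_end_apply, Module.End.mul_apply, LinearMap.sum_apply, map_sum]
  rfl

theorem end_ext {V W : Type*} [AddCommMonoid V] [Module k V] [AddCommMonoid W] [Module k W]
    {s t : V ⊗[k] W →ₗ[k] V ⊗[k] W} (h : ∀ a b, s (a ⊗ₜ[k] b) = t (a ⊗ₜ[k] b)) : s = t :=
  TensorProduct.ext' h

theorem opL_mul (a b : H) : (opL (a * b) : Module.End k (ConvDual k H ⊗[k] H)) = opL a * opL b :=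
  end_ext fun f c => by
    rw [Module.End.mul_apply, opL_tmul, opL_tmul, opL_tmul]
    congr 1
    ext d
    simp only [leftHit_apply, mul_assoc]

theorem opM_mul (a b : H) : (opM (a * b) : Module.End k (ConvDual k H ⊗[k] H)) = opM a * opM b :=
  end_ext fun f c => by
    rw [Module.End.mul_apply, opM_tmul, opM_tmul, opM_tmul, mul_assoc]

theorem opR_mul (a b : H) : (opR (a * b) : Module.End k (ConvDual k H ⊗[k] H)) = opR a * opR b :=
  end_ext fun f c => by
    rw [Module.End.mul_apply, opR_tmul, opR_tmul, opR_tmul]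
    congr 1
    ext d
    simp only [rightHit_apply, mul_assoc, antipodeInv_mul]

theorem opF_mul (a b : ConvDual k H) :
    (opF (a * b) : Module.End k (ConvDual k H ⊗[k] H)) = opF a * opF b :=
  end_ext fun f c => by
    rw [Module.End.mul_apply, opF_tmul, opF_tmul, opF_tmul, mul_assoc]

theorem opL_one : (opL 1 : Module.End k (ConvDual k H ⊗[k] H)) = 1 :=
  end_ext fun f c => by
    rw [opL_tmul]
    congr 1
    ext d
    simp only [leftHit_apply, mul_one]

theorem opM_one : (opM 1 : Module.End k (ConvDual k H ⊗[k] H)) = 1 :=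
  end_ext fun f c => by
    rw [opM_tmul, one_mul]
    rfl

theorem opR_one : (opR 1 : Module.End k (ConvDual k H ⊗[k] H)) = 1 :=
  end_ext fun f c => by
    rw [opR_tmul]
    congr 1
    ext d
    simp only [rightHit_apply, antipodeInv_one, one_mul]

theorem opF_one : (opF 1 : Module.End k (ConvDual k H ⊗[k] H)) = 1 :=
  end_ext fun f c => by
    rw [opF_tmul, one_mul]
    rfl

theorem opL_opM (a b : H) :
    Commute (opL a : Module.End k (ConvDual k H ⊗[k] H)) (opM b) :=
  end_ext fun _ _ => rfl

theorem opM_opR (a b : H) :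
    Commute (opM a : Module.End k (ConvDual k H ⊗[k] H)) (opR b) :=
  end_ext fun _ _ => rfl

theorem opL_opR (a b : H) :
    Commute (opL a : Module.End k (ConvDual k H ⊗[k] H)) (opR b) :=
  end_ext fun f c => by
    rw [Module.End.mul_apply, Module.End.mul_apply, opR_tmul, opL_tmul, opL_tmul, opR_tmul]
    congr 1
    ext d
    simp only [rightHit_apply, leftHit_apply, mul_assoc]

theorem leftMul_mul (a b : H) :
    (leftMul (a * b) : Module.End k (ConvDual k H ⊗[k] H)) = leftMul a * leftMul b :=
  conv_mul (toConv opL * toConv opM) (toConv opR)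
    (conv_mul (toConv opL) (toConv opM) opL_mul opM_mul opL_opM) opR_mul
    (fun a b => conv_commute (toConv opL) (toConv opM) _ (fun c => opL_opR c b) (fun c => opM_opR c b) a) a b

theorem leftMul_one : (leftMul 1 : Module.End k (ConvDual k H ⊗[k] H)) = 1 :=
  conv_one (toConv opL * toConv opM) (toConv opR)
    (conv_one (toConv opL) (toConv opM) opL_one opM_one) opR_one

/-- The pairing of a convolution product with a product. -/
theorem convDual_mul_apply (f g : ConvDual k H) (b : H) :
    (f * g).ofConv b = ∑ i ∈ (ℛ k b).index,
      f.ofConv ((ℛ k b).left i) * g.ofConv ((ℛ k b).right i) :=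
  (ℛ k b).convMul_apply f g

theorem convDual_eq (f g : ConvDual k H) (b : H) :
    (f * g).ofConv b = LinearMap.mul' k k (TensorProduct.map f.ofConv g.ofConv (comul b)) := rfl

theorem leftHit_mul (h : H) (f g : ConvDual k H) :
    leftHit h (f * g) = ∑ i ∈ (ℛ k h).index,
      leftHit ((ℛ k h).left i) f * leftHit ((ℛ k h).right i) g := by
  ext b
  rw [leftHit_apply, convDual_eq, Bialgebra.comul_mul]
  simp only [ofConv_sum, LinearMap.sum_apply, convDual_mul_apply, leftHit_apply]
  rw [← (ℛ k h).eq, ← (ℛ k b).eq]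
  simp [Finset.mul_sum, Finset.sum_mul]
  try rw [Finset.sum_comm]

theorem rightHit_mul (h : H) (f g : ConvDual k H) :
    rightHit (antipodeInv k H h) (f * g) = ∑ i ∈ (ℛ k h).index,
      rightHit (antipodeInv k H ((ℛ k h).right i)) f *
        rightHit (antipodeInv k H ((ℛ k h).left i)) g := by
  ext b
  rw [rightHit_apply, convDual_eq, Bialgebra.comul_mul, comul_antipodeInv]
  simp only [ofConv_sum, LinearMap.sum_apply, convDual_mul_apply, rightHit_apply]
  rw [← (ℛ k b).eq]
  simp [Finset.mul_sum, Finset.sum_mul]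
  try rw [Finset.sum_comm]

theorem leftHit_one (h : H) :
    leftHit h (1 : ConvDual k H) = counit (R := k) h • (1 : ConvDual k H) := by
  ext b
  simp [leftHit_apply, mul_comm]

theorem rightHit_one (h : H) :
    rightHit h (1 : ConvDual k H) = counit (R := k) h • (1 : ConvDual k H) := by
  ext b
  simp [rightHit_apply]

theorem toConv_algHom {E E' : Type*} [Semiring E] [Algebra k E] [Semiring E'] [Algebra k E']
    (F : E →ₐ[k] E') (X Y : WithConv (H →ₗ[k] E)) :
    toConv (F.toLinearMap ∘ₗ (X * Y).ofConv) =
      toConv (F.toLinearMap ∘ₗ X.ofConv) * toConv (F.toLinearMap ∘ₗ Y.ofConv) := by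
  rw [LinearMap.algHom_comp_convMul_distrib]

/-- `f ⊗ v ↦ f v`. -/
def act : ConvDual k H ⊗[k] (ConvDual k H ⊗[k] H) →ₗ[k] ConvDual k H ⊗[k] H :=
  TensorProduct.lift opF

theorem act_tmul (f : ConvDual k H) (v : ConvDual k H ⊗[k] H) : act (f ⊗ₜ[k] v) = opF f v := rfl

variable (k H) in
/-- Left translation on the first factor. -/
def actL : WithConv (H →ₗ[k] Module.End k (ConvDual k H ⊗[k] (ConvDual k H ⊗[k] H))) :=
  toConv (LinearMap.rTensorHom _ ∘ₗ leftHit)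

variable (k H) in
/-- Right translation on the first factor. -/
def actR : WithConv (H →ₗ[k] Module.End k (ConvDual k H ⊗[k] (ConvDual k H ⊗[k] H))) :=
  toConv (LinearMap.rTensorHom _ ∘ₗ rightHit ∘ₗ antipodeInv k H)

variable (k H) in
/-- Left multiplication on the second factor. -/
def actP : WithConv (H →ₗ[k] Module.End k (ConvDual k H ⊗[k] (ConvDual k H ⊗[k] H))) :=
  toConv (LinearMap.lTensorHom _ ∘ₗ leftMul)

theorem leftMul_act (h : H) :
    leftMul h ∘ₗ (act (k := k) (H := H)) = act ∘ₗ (actL k H * actP k H * actR k H).ofConv h := by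
  have e : actP k H =
      toConv (LinearMap.lTensorHom _ ∘ₗ opL) * toConv (LinearMap.lTensorHom _ ∘ₗ opM) *
        toConv (LinearMap.lTensorHom _ ∘ₗ opR) := by
    have h1 := toConv_algHom (Module.End.lTensorAlgHom k (ConvDual k H ⊗[k] H) (ConvDual k H))
      (toConv (opL : H →ₗ[k] Module.End k (ConvDual k H ⊗[k] H)) * toConv opM)
      (toConv (opR : H →ₗ[k] Module.End k (ConvDual k H ⊗[k] H)))
    refine h1.trans ?_
    rw [toConv_algHom]
    rfl
  rw [e]
  have e2 : ∀ a b c d f : WithConv (H →ₗ[k] Module.End k (ConvDual k H ⊗[k] (ConvDual k H ⊗[k] H))),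
      a * (b * c * d) * f = (a * b) * c * (d * f) := by intros; simp only [mul_assoc]
  rw [e2]
  refine conv_intertwine act (toConv opL * toConv opM) (toConv opR) _ _
    (fun h => conv_intertwine act (toConv opL) (toConv opM) _ _ ?_ ?_ h) ?_ h
  · intro h
    refine TensorProduct.ext' fun f v => ?_
    induction v with
    | zero => simp
    | add x y hx hy => simp only [TensorProduct.tmul_add, map_add, hx, hy]
    | tmul g b =>
      simp only [LinearMap.comp_apply]
      rw [act_tmul, opF_tmul, opL_tmul, leftHit_mul, conv_end_apply, LinearMap.sum_apply, map_sum,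
        TensorProduct.sum_tmul]
      rfl
  · intro h
    refine TensorProduct.ext' fun f v => ?_
    induction v with
    | zero => simp
    | add x y hx hy => simp only [TensorProduct.tmul_add, map_add, hx, hy]
    | tmul g b => rfl
  · intro h
    refine TensorProduct.ext' fun f v => ?_
    induction v with
    | zero => simp
    | add x y hx hy => simp only [TensorProduct.tmul_add, map_add, hx, hy]
    | tmul g b =>
      simp only [LinearMap.comp_apply]
      rw [act_tmul, opF_tmul, opR_tmul, rightHit_mul, conv_end_apply, LinearMap.sum_apply, map_sum,
        TensorProduct.sum_tmul]
      rfl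

theorem doubleMul_eq_act (u v : ConvDual k H ⊗[k] H) :
    doubleMul u v = act ((leftMul.flip v).lTensor (ConvDual k H) u) := by
  induction u with
  | zero => simp
  | add x y hx hy => simp only [map_add, LinearMap.add_apply, hx, hy]
  | tmul g h => rfl

theorem doubleMul_leftMul (h : H) (u v : ConvDual k H ⊗[k] H) :
    doubleMul (leftMul h u) v = leftMul h (doubleMul u v) := by
  rw [doubleMul_eq_act, doubleMul_eq_act]
  have h1 : (actL k H * actP k H * actR k H).ofConv h ∘ₗ
      (leftMul.flip v).lTensor (ConvDual k H) =
      (leftMul.flip v).lTensor (ConvDual k H) ∘ₗ leftMul h := by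
    refine conv_intertwine _ _ _ (toConv opL * toConv opM) (toConv opR)
      (fun h => conv_intertwine _ _ _ (toConv opL) (toConv opM) ?_ ?_ h) ?_ h
    · intro h
      exact TensorProduct.ext' fun f b => rfl
    · intro h
      refine TensorProduct.ext' fun f b => ?_
      change f ⊗ₜ[k] (leftMul h (leftMul b v)) = f ⊗ₜ[k] (leftMul (h * b) v)
      rw [leftMul_mul]
      rfl
    · intro h
      exact TensorProduct.ext' fun f b => rfl
  have h2 := LinearMap.congr_fun h1 u
  have h3 := LinearMap.congr_fun (leftMul_act (k := k) h) ((leftMul.flip v).lTensor (ConvDual k H) u)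
  simp only [LinearMap.comp_apply] at h2 h3
  rw [h3, ← h2]

theorem doubleMul_opF (g : ConvDual k H) (u v : ConvDual k H ⊗[k] H) :
    doubleMul (opF g u) v = opF g (doubleMul u v) := by
  induction u with
  | zero => simp
  | add x y hx hy => simp only [map_add, LinearMap.add_apply, hx, hy]
  | tmul f h => rw [opF_tmul, doubleMul_tmul, doubleMul_tmul, opF_mul, Module.End.mul_apply]

theorem doubleMul_assoc (u v w : ConvDual k H ⊗[k] H) :
    doubleMul (doubleMul u v) w = doubleMul u (doubleMul v w) := by
  induction u with
  | zero => simp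
  | add x y hx hy => simp only [map_add, LinearMap.add_apply, hx, hy]
  | tmul g h => rw [doubleMul_tmul, doubleMul_tmul, doubleMul_opF, doubleMul_leftMul]

theorem leftMul_one_tmul (h b : H) :
    leftMul h ((1 : ConvDual k H) ⊗ₜ[k] b) = 1 ⊗ₜ[k] (h * b) := by
  have h1 : leftMul h ∘ₗ (TensorProduct.mk k (ConvDual k H) H 1) =
      (TensorProduct.mk k (ConvDual k H) H 1) ∘ₗ
        (1 * toConv (LinearMap.mul k H) * 1 : WithConv (H →ₗ[k] Module.End k H)).ofConv h := by
    refine conv_intertwine _ (toConv opL * toConv opM) (toConv opR) _ _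
      (fun h => conv_intertwine _ (toConv opL) (toConv opM) _ _ ?_ ?_ h) ?_ h
    · intro h
      ext b
      change leftHit h 1 ⊗ₜ[k] b = _
      rw [leftHit_one]
      simp [LinearMap.convOne_def, TensorProduct.smul_tmul]
    · intro h
      rfl
    · intro h
      ext b
      change rightHit (antipodeInv k H h) 1 ⊗ₜ[k] b = _
      rw [rightHit_one, counit_antipodeInv]
      simp [LinearMap.convOne_def, TensorProduct.smul_tmul]
  have h2 := LinearMap.congr_fun h1 b
  rw [one_mul, mul_one] at h2
  exact h2

theorem doubleMul_one (u : ConvDual k H ⊗[k] H) :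
    doubleMul u ((1 : ConvDual k H) ⊗ₜ[k] (1 : H)) = u := by
  induction u with
  | zero => simp
  | add x y hx hy => simp only [map_add, LinearMap.add_apply, hx, hy]
  | tmul g h => rw [doubleMul_tmul, leftMul_one_tmul, opF_tmul, mul_one, mul_one]

theorem one_doubleMul (u : ConvDual k H ⊗[k] H) :
    doubleMul ((1 : ConvDual k H) ⊗ₜ[k] (1 : H)) u = u := by
  rw [doubleMul_tmul, leftMul_one, opF_one]
  rfl

end Operators

section Comul

variable {k H : Type*} [Field k] [Ring H] [HopfAlgebra k H] [BijectiveAntipode k H]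
  [Module.Finite k H]

theorem comul_leftHit (h : H) (f : ConvDual k H) :
    comul (R := k) (leftHit h f) = (leftHit h).rTensor _ (comul f) := by
  apply eval₂_ext
  intro b c
  rw [eval₂_comul, leftHit_apply]
  have : ∀ t : ConvDual k H ⊗[k] ConvDual k H,
      eval₂ b c ((leftHit h).rTensor _ t) = eval₂ (b * h) c t := by
    intro t
    induction t with
    | zero => simp
    | add x y hx hy => simp only [map_add, hx, hy]
    | tmul p q => rfl
  rw [this, eval₂_comul, mul_assoc]

theorem comul_rightHit (h : H) (f : ConvDual k H) :
    comul (R := k) (rightHit h f) = (rightHit h).lTensor _ (comul f) := by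
  apply eval₂_ext
  intro b c
  rw [eval₂_comul, rightHit_apply]
  have : ∀ t : ConvDual k H ⊗[k] ConvDual k H,
      eval₂ b c ((rightHit h).lTensor _ t) = eval₂ b (h * c) t := by
    intro t
    induction t with
    | zero => simp
    | add x y hx hy => simp only [map_add, hx, hy]
    | tmul p q => rfl
  rw [this, eval₂_comul, mul_assoc]

theorem comul_hit_cancel (h : H) (f : ConvDual k H) :
    ∑ i ∈ (ℛ k h).index,
      TensorProduct.map (rightHit (antipodeInv k H ((ℛ k h).left i))) (leftHit ((ℛ k h).right i))
        (comul (R := k) f) = counit (R := k) h • comul (R := k) f := by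
  apply eval₂_ext
  intro b c
  have : ∀ (x y : H) (t : ConvDual k H ⊗[k] ConvDual k H),
      eval₂ b c (TensorProduct.map (rightHit x) (leftHit y) t) = eval₂ (x * b) (c * y) t := by
    intro x y t
    induction t with
    | zero => simp
    | add x y hx hy => simp only [map_add, hx, hy]
    | tmul p q => rfl
  simp only [map_sum, map_smul, this, eval₂_comul]
  have e : ∀ i, c * (ℛ k h).right i * (antipodeInv k H ((ℛ k h).left i) * b) =
      c * ((ℛ k h).right i * antipodeInv k H ((ℛ k h).left i)) * b := by
    intro i; simp only [mul_assoc]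
  simp only [e]
  rw [← map_sum, ← Finset.sum_mul, ← Finset.mul_sum, sum_right_mul_antipodeInv_left,
    Algebra.algebraMap_eq_smul_one]
  simp

theorem comul_convMul (f g : ConvDual k H) :
    comul (R := k) (f * g) = TensorProduct.map₂ (LinearMap.mul k (ConvDual k H))
      (LinearMap.mul k (ConvDual k H)) (comul (R := k) f) (comul (R := k) g) := by
  apply eval₂_ext
  intro b c
  have : ∀ s t : ConvDual k H ⊗[k] ConvDual k H,
      eval₂ b c (TensorProduct.map₂ (LinearMap.mul k (ConvDual k H))
        (LinearMap.mul k (ConvDual k H)) s t) =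
      ∑ i ∈ (ℛ k b).index, ∑ j ∈ (ℛ k c).index,
        eval₂ ((ℛ k b).left i) ((ℛ k c).left j) s *
          eval₂ ((ℛ k b).right i) ((ℛ k c).right j) t := by
    intro s t
    induction s with
    | zero => simp
    | add x y hx hy =>
      simp only [map_add, LinearMap.add_apply, add_mul, hx, hy, Finset.sum_add_distrib]
    | tmul p q =>
      induction t with
      | zero => simp
      | add x y hx hy => simp only [map_add, mul_add, hx, hy, Finset.sum_add_distrib]
      | tmul p' q' =>
        rw [TensorProduct.map₂_apply_tmul, TensorProduct.map_tmul, LinearMap.mul_apply',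
          LinearMap.mul_apply', eval₂_tmul,
          convDual_mul_apply, convDual_mul_apply, Finset.sum_mul_sum]
        refine Finset.sum_congr rfl fun i _ => Finset.sum_congr rfl fun j _ => ?_
        rw [eval₂_tmul, eval₂_tmul]
        ring
  rw [this, eval₂_comul, convDual_eq, Bialgebra.comul_mul]
  simp only [eval₂_comul]
  conv_lhs => rw [← (ℛ k c).eq, ← (ℛ k b).eq]
  simp only [Finset.sum_mul_sum, Algebra.TensorProduct.tmul_mul_tmul, map_sum,
    TensorProduct.map_tmul, LinearMap.mul'_apply]
  rw [Finset.sum_comm]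

theorem comul_opF (g : ConvDual k H) (u : ConvDual k H ⊗[k] H) :
    comul (R := k) (opF g u) =
      TensorProduct.map₂ opF opF (comul (R := k) g) (comul (R := k) u) := by
  induction u with
  | zero => simp
  | add x y hx hy => simp only [map_add, hx, hy]
  | tmul f b =>
    rw [opF_tmul]
    change TensorProduct.tensorTensorTensorComm k _ _ _ _
      (comul (R := k) (g * f) ⊗ₜ[k] comul (R := k) b) = TensorProduct.map₂ opF opF _
      (TensorProduct.tensorTensorTensorComm k _ _ _ _ (comul (R := k) f ⊗ₜ[k] comul (R := k) b))
    rw [comul_convMul]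
    generalize comul (R := k) g = r
    generalize comul (R := k) f = s
    generalize comul (R := k) b = t
    induction r with
    | zero => simp
    | add x y hx hy =>
      simp only [map_add, LinearMap.add_apply, TensorProduct.add_tmul, hx, hy]
    | tmul x y =>
      induction s with
      | zero => simp
      | add x y hx hy => simp only [map_add, TensorProduct.add_tmul, hx, hy]
      | tmul p q =>
        induction t with
        | zero => simp
        | add x y hx hy => simp only [map_add, TensorProduct.tmul_add, hx, hy]
        | tmul c d => rfl

/-- Elements of `V ⊗ V` built from the two coproducts. -/
theorem comul_tmul_sum (f : ConvDual k H) (b : H) :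
    comul (R := k) (f ⊗ₜ[k] b) = TensorProduct.tensorTensorTensorComm k _ _ _ _
      (comul (R := k) f ⊗ₜ[k] comul (R := k) b) := rfl

theorem comul_opL (h : H) :
    (opL h).rTensor (ConvDual k H ⊗[k] H) ∘ₗ comul = comul ∘ₗ opL (k := k) h := by
  refine TensorProduct.ext' fun f b => ?_
  simp only [LinearMap.comp_apply]
  rw [opL_tmul, comul_tmul_sum, comul_tmul_sum, comul_leftHit]
  generalize comul (R := k) f = s
  generalize comul (R := k) b = t
  induction s with
  | zero => simp
  | add x y hx hy => simp only [map_add, TensorProduct.add_tmul, hx, hy]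
  | tmul p q =>
    induction t with
    | zero => simp
    | add x y hx hy => simp only [map_add, TensorProduct.tmul_add, hx, hy]
    | tmul c d => rfl

theorem comul_opR (h : H) :
    (opR h).lTensor (ConvDual k H ⊗[k] H) ∘ₗ comul = comul ∘ₗ opR (k := k) h := by
  refine TensorProduct.ext' fun f b => ?_
  simp only [LinearMap.comp_apply]
  rw [opR_tmul, comul_tmul_sum, comul_tmul_sum, comul_rightHit]
  generalize comul (R := k) f = s
  generalize comul (R := k) b = t
  induction s with
  | zero => simp
  | add x y hx hy => simp only [map_add, TensorProduct.add_tmul, hx, hy]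
  | tmul p q =>
    induction t with
    | zero => simp
    | add x y hx hy => simp only [map_add, TensorProduct.tmul_add, hx, hy]
    | tmul c d => rfl

variable (k H) in
/-- An operator on the first factor. -/
def inl (X : H →ₗ[k] Module.End k (ConvDual k H ⊗[k] H)) :
    WithConv (H →ₗ[k] Module.End k ((ConvDual k H ⊗[k] H) ⊗[k] (ConvDual k H ⊗[k] H))) :=
  toConv (LinearMap.rTensorHom _ ∘ₗ X)

variable (k H) in
/-- An operator on the second factor. -/
def inr (X : H →ₗ[k] Module.End k (ConvDual k H ⊗[k] H)) :
    WithConv (H →ₗ[k] Module.End k ((ConvDual k H ⊗[k] H) ⊗[k] (ConvDual k H ⊗[k] H))) :=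
  toConv (LinearMap.lTensorHom _ ∘ₗ X)

theorem comul_opM (h : H) :
    (inl k H opM * inr k H opM).ofConv h ∘ₗ comul = comul ∘ₗ opM (k := k) h := by
  refine TensorProduct.ext' fun f b => ?_
  simp only [LinearMap.comp_apply]
  rw [opM_tmul, comul_tmul_sum, comul_tmul_sum, Bialgebra.comul_mul, conv_end_apply,
    LinearMap.sum_apply]
  conv_rhs => rw [← (ℛ k h).eq]
  rw [Finset.sum_mul, TensorProduct.tmul_sum, map_sum]
  refine Finset.sum_congr rfl fun i _ => ?_
  generalize comul (R := k) f = s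
  generalize comul (R := k) b = t
  induction s with
  | zero => simp
  | add x y hx hy => simp only [map_add, TensorProduct.add_tmul, hx, hy]
  | tmul p q =>
    induction t with
    | zero => simp
    | add x y hx hy => simp only [map_add, mul_add, TensorProduct.tmul_add, hx, hy]
    | tmul c d =>
      rw [Algebra.TensorProduct.tmul_mul_tmul]
      rfl

theorem comul_opRL (h : H) :
    (inl k H opR * inr k H opL).ofConv h ∘ₗ comul = counit (R := k) h • comul (R := k) := by
  refine TensorProduct.ext' fun f b => ?_
  simp only [LinearMap.comp_apply, LinearMap.smul_apply]
  rw [comul_tmul_sum, conv_end_apply, LinearMap.sum_apply, ← map_smul, TensorProduct.smul_tmul',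
    ← comul_hit_cancel, TensorProduct.sum_tmul, map_sum]
  refine Finset.sum_congr rfl fun i _ => ?_
  generalize comul (R := k) f = s
  generalize comul (R := k) b = t
  induction s with
  | zero => simp
  | add x y hx hy => simp only [map_add, TensorProduct.add_tmul, hx, hy]
  | tmul p q =>
    induction t with
    | zero => simp
    | add x y hx hy => simp only [map_add, TensorProduct.tmul_add, hx, hy]
    | tmul c d => rfl

theorem inl_inr_commute (X Y : H →ₗ[k] Module.End k (ConvDual k H ⊗[k] H)) (a b : H) :
    Commute ((inl k H X).ofConv a) ((inr k H Y).ofConv b) :=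
  TensorProduct.ext' fun _ _ => rfl

theorem inr_commute (X Y : H →ₗ[k] Module.End k (ConvDual k H ⊗[k] H)) (a b : H)
    (hXY : Commute (X a) (Y b)) :
    Commute ((inr k H X).ofConv a) ((inr k H Y).ofConv b) :=
  TensorProduct.ext' fun u v => congrArg (fun z => u ⊗ₜ[k] z) (LinearMap.congr_fun hXY v)

theorem comul_absorb (h : H) :
    ((inl k H opR * inr k H opL) * (inr k H opM * inr k H opR)).ofConv h ∘ₗ comul =
      (inr k H opM * inr k H opR).ofConv h ∘ₗ comul := by
  refine conv_absorb comul _ _ (fun h h' => ?_) h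
  refine LinearMap.ext fun u => ?_
  simp only [LinearMap.comp_apply, LinearMap.smul_apply]
  rw [conv_end_apply (inr k H opM) (inr k H opR), LinearMap.sum_apply, map_sum, Finset.smul_sum]
  refine Finset.sum_congr rfl fun i _ => ?_
  have h1 : Commute ((inl k H opR * inr k H opL).ofConv h)
      ((inr k H opM).ofConv ((ℛ k h').left i)) :=
    conv_commute _ _ _ (fun a => inl_inr_commute _ _ _ _)
      (fun a => inr_commute _ _ _ _ (opL_opM _ _)) h
  have h2 := LinearMap.congr_fun h1.eq
    ((inr k H opR).ofConv ((ℛ k h').right i) (comul (R := k) u))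
  have h3 := LinearMap.congr_fun (comul_opR (k := k) ((ℛ k h').right i)) u
  have h4 := LinearMap.congr_fun (comul_opRL (k := k) h) (opR ((ℛ k h').right i) u)
  simp only [LinearMap.comp_apply, LinearMap.smul_apply, Module.End.mul_apply] at h2 h3 h4
  rw [Module.End.mul_apply, h2]
  change _ = counit (R := k) h • (inr k H opM).ofConv _
    ((opR ((ℛ k h').right i)).lTensor _ (comul (R := k) u))
  change (inr k H opM).ofConv _ ((inl k H opR * inr k H opL).ofConv h
    ((opR ((ℛ k h').right i)).lTensor _ (comul (R := k) u))) = _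
  rw [h3, h4, map_smul]

theorem conv_congr {V W : Type*} [AddCommMonoid V] [Module k V] [AddCommMonoid W] [Module k W]
    (T : V →ₗ[k] W) (X Y Y' : WithConv (H →ₗ[k] Module.End k W))
    (hY : ∀ h, Y.ofConv h ∘ₗ T = Y'.ofConv h ∘ₗ T) (h : H) :
    (X * Y).ofConv h ∘ₗ T = (X * Y').ofConv h ∘ₗ T := by
  refine LinearMap.ext fun v => ?_
  rw [LinearMap.comp_apply, LinearMap.comp_apply, conv_end_apply, conv_end_apply,
    LinearMap.sum_apply, LinearMap.sum_apply]
  refine Finset.sum_congr rfl fun i _ => ?_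
  rw [Module.End.mul_apply, Module.End.mul_apply]
  exact congrArg _ (LinearMap.congr_fun (hY _) v)

theorem inl_leftMul : inl k H leftMul = inl k H opL * inl k H opM * inl k H opR := by
  have h1 := toConv_algHom (Module.End.rTensorAlgHom k (ConvDual k H ⊗[k] H)
      (ConvDual k H ⊗[k] H))
      (toConv (opL : H →ₗ[k] Module.End k (ConvDual k H ⊗[k] H)) * toConv opM)
      (toConv (opR : H →ₗ[k] Module.End k (ConvDual k H ⊗[k] H)))
  refine h1.trans ?_
  rw [toConv_algHom]
  rfl

theorem inr_leftMul : inr k H leftMul = inr k H opL * inr k H opM * inr k H opR := by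
  have h1 := toConv_algHom (Module.End.lTensorAlgHom k (ConvDual k H ⊗[k] H)
      (ConvDual k H ⊗[k] H))
      (toConv (opL : H →ₗ[k] Module.End k (ConvDual k H ⊗[k] H)) * toConv opM)
      (toConv (opR : H →ₗ[k] Module.End k (ConvDual k H ⊗[k] H)))
  refine h1.trans ?_
  rw [toConv_algHom]
  rfl

theorem comul_leftMul (h : H) :
    (inl k H leftMul * inr k H leftMul).ofConv h ∘ₗ comul = comul ∘ₗ leftMul (k := k) h := by
  have e : inl k H leftMul * inr k H leftMul = inl k H opL * (inl k H opM *
      ((inl k H opR * inr k H opL) * (inr k H opM * inr k H opR))) := by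
    rw [inl_leftMul, inr_leftMul]
    simp only [mul_assoc]
  have e2 : inl k H opL * (inl k H opM * (inr k H opM * inr k H opR)) =
      inl k H opL * (inl k H opM * inr k H opM) * inr k H opR := by
    simp only [mul_assoc]
  rw [e, conv_congr comul _ _ _ (fun h => conv_congr comul _ _ _ comul_absorb h) h, e2]
  exact conv_intertwine comul _ _ (toConv opL * toConv opM) (toConv opR)
    (fun h => conv_intertwine comul _ _ (toConv opL) (toConv opM) comul_opL comul_opM h)
    comul_opR h

theorem comul_leftMul_apply (h : H) (u : ConvDual k H ⊗[k] H) :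
    comul (R := k) (leftMul h u) = ∑ i ∈ (ℛ k h).index,
      ((inl k H leftMul).ofConv ((ℛ k h).left i) * (inr k H leftMul).ofConv ((ℛ k h).right i))
        (comul (R := k) u) := by
  rw [← LinearMap.comp_apply, ← comul_leftMul, LinearMap.comp_apply, conv_end_apply,
    LinearMap.sum_apply]

theorem sum_smul_counit (h : H) :
    ∑ i ∈ (ℛ k h).index, counit (R := k) ((ℛ k h).right i) • (ℛ k h).left i = h := by
  have := congrArg (TensorProduct.rid k H) (sum_tmul_counit_eq (R := k) (ℛ k h))
  simpa only [map_sum, TensorProduct.rid_tmul, one_smul] using this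

theorem counit_opL_opM (h : H) (u : ConvDual k H ⊗[k] H) :
    counit (R := k) ((toConv opL * toConv opM : WithConv (H →ₗ[k] Module.End k
      (ConvDual k H ⊗[k] H))).ofConv h u) = counit (R := k) (opL h u) := by
  conv_rhs => rw [← sum_smul_counit (k := k) h]
  rw [conv_end_apply, LinearMap.sum_apply, map_sum, map_sum, LinearMap.sum_apply, map_sum]
  refine Finset.sum_congr rfl fun i _ => ?_
  rw [map_smul, LinearMap.smul_apply, map_smul, Module.End.mul_apply]
  induction u with
  | zero => simp
  | add x y hx hy => simp only [map_add, smul_add, hx, hy]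
  | tmul f b =>
    rw [opM_tmul, opL_tmul, opL_tmul, TensorProduct.counit_tmul, TensorProduct.counit_tmul,
      Bialgebra.counit_mul]
    simp only [smul_eq_mul]
    ring

theorem counit_leftMul (h : H) (u : ConvDual k H ⊗[k] H) :
    counit (R := k) (leftMul h u) = counit (R := k) h * counit (R := k) u := by
  induction u with
  | zero => simp
  | add x y hx hy => simp only [map_add, mul_add, hx, hy]
  | tmul f b =>
    rw [leftMul, conv_end_apply, LinearMap.sum_apply, map_sum]
    have e : ∀ i, counit (R := k) (((toConv opL * toConv opM : WithConv (H →ₗ[k] Module.End k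
        (ConvDual k H ⊗[k] H))).ofConv ((ℛ k h).left i) * (toConv opR : WithConv (H →ₗ[k]
        Module.End k (ConvDual k H ⊗[k] H))).ofConv ((ℛ k h).right i)) (f ⊗ₜ[k] b)) =
        counit (R := k) b * f.ofConv (antipodeInv k H ((ℛ k h).right i) * (ℛ k h).left i) := by
      intro i
      rw [Module.End.mul_apply, counit_opL_opM]
      change counit (R := k) (opL _ (opR _ (f ⊗ₜ[k] b))) = _
      rw [opR_tmul, opL_tmul, TensorProduct.counit_tmul, coop_counit, leftHit_apply,
        rightHit_apply, one_mul, smul_eq_mul]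
    simp only [e]
    rw [← Finset.mul_sum, ← map_sum, sum_antipodeInv_right_mul_left,
      Algebra.algebraMap_eq_smul_one, map_smul, smul_eq_mul, TensorProduct.counit_tmul,
      coop_counit, smul_eq_mul]
    ring

theorem counit_opF (g : ConvDual k H) (u : ConvDual k H ⊗[k] H) :
    counit (R := k) (opF g u) = counit (R := k) g * counit (R := k) u := by
  induction u with
  | zero => simp
  | add x y hx hy => simp only [map_add, mul_add, hx, hy]
  | tmul f b =>
    rw [opF_tmul, TensorProduct.counit_tmul, TensorProduct.counit_tmul, coop_counit, coop_counit,
      coop_counit, convDual_eq, Bialgebra.comul_one, Algebra.TensorProduct.one_def,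
      TensorProduct.map_tmul, LinearMap.mul'_apply]
    simp only [smul_eq_mul]
    ring

end Comul

section Double

variable (k H : Type*) [Field k] [Ring H] [HopfAlgebra k H] [BijectiveAntipode k H]
  [Module.Finite k H]

/-- The Drinfel'd double `D(H) = (H^*)^cop ⊗ H` of a finite-dimensional Hopf algebra `H`. -/
def Double : Type _ := ConvDual k H ⊗[k] H

namespace Double

instance : AddCommGroup (Double k H) := inferInstanceAs (AddCommGroup (ConvDual k H ⊗[k] H))

instance : Module k (Double k H) := inferInstanceAs (Module k (ConvDual k H ⊗[k] H))

/-- As a coalgebra, `D(H)` is the tensor product of the coalgebras `(H^*)^cop` and `H`. -/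
instance : Coalgebra k (Double k H) := inferInstanceAs (Coalgebra k (ConvDual k H ⊗[k] H))

instance : Mul (Double k H) := ⟨fun u v => doubleMul (k := k) (H := H) u v⟩

instance : One (Double k H) := ⟨(1 : ConvDual k H) ⊗ₜ[k] (1 : H)⟩

variable {k H}

/-- The element `f ⊗ h` of `D(H)`. -/
def mk (f : ConvDual k H) (h : H) : Double k H := f ⊗ₜ[k] h

theorem mul_def (u v : Double k H) : u * v = doubleMul (k := k) (H := H) u v := rfl

theorem one_def : (1 : Double k H) = mk 1 1 := rfl

theorem mk_mul (g : ConvDual k H) (h : H) (v : Double k H) :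
    mk g h * v = opF (k := k) g (leftMul h v) := rfl

/-- The multiplication rule `(g ⊗ h)(f ⊗ b) = ∑ g (h₁ ⇀ f ↼ S⁻¹ h₃) ⊗ h₂ b`. -/
theorem mk_mul_mk (g f : ConvDual k H) (h b : H) :
    mk g h * mk f b =
      ∑ i ∈ (ℛ k h).index, ∑ j ∈ (ℛ k ((ℛ k h).left i)).index,
        mk (g * leftHit ((ℛ k ((ℛ k h).left i)).left j)
          (rightHit (antipodeInv k H ((ℛ k h).right i)) f))
          ((ℛ k ((ℛ k h).left i)).right j * b) :=
  doubleMul_tmul_tmul g f h b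

@[elab_as_elim]
theorem induction {motive : Double k H → Prop} (zero : motive 0)
    (tmul : ∀ f h, motive (mk f h)) (add : ∀ u v, motive u → motive v → motive (u + v))
    (u : Double k H) : motive u :=
  TensorProduct.induction_on u zero tmul add

variable (k H) in
/-- The ring structure of the double. -/
instance : Ring (Double k H) where
  __ := (inferInstance : AddCommGroup (Double k H))
  mul u v := u * v
  one := 1
  left_distrib u v w := map_add (doubleMul (k := k) (H := H) u) v w
  right_distrib u v w := LinearMap.congr_fun (map_add (doubleMul (k := k) (H := H)) u v) w
  zero_mul u := LinearMap.congr_fun (map_zero (doubleMul (k := k) (H := H))) u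
  mul_zero u := map_zero (doubleMul (k := k) (H := H) u)
  mul_assoc := doubleMul_assoc (k := k) (H := H)
  one_mul := one_doubleMul (k := k) (H := H)
  mul_one := doubleMul_one (k := k) (H := H)

instance : Algebra k (Double k H) :=
  Algebra.ofModule
    (fun r u v => LinearMap.congr_fun (map_smul (doubleMul (k := k) (H := H)) r u) v)
    (fun r u v => map_smul (doubleMul (k := k) (H := H) u) r v)

/-- `f ↦ f ⊗ 1`. -/
def ofDual : ConvDual k H →ₗ[k] Double k H :=
  (TensorProduct.mk k (ConvDual k H) H).flip 1

/-- `h ↦ 1 ⊗ h`. -/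
def ofHopf : H →ₗ[k] Double k H :=
  TensorProduct.mk k (ConvDual k H) H 1

theorem mk_eq (f : ConvDual k H) (h : H) : mk f h = ofDual f * ofHopf h := by
  change mk f h = mk f 1 * mk 1 h
  rw [mk_mul, leftMul_one]
  change mk f h = opF (k := k) f (1 ⊗ₜ[k] h)
  rw [opF_tmul, mul_one]
  rfl

theorem ofDual_mul (f : ConvDual k H) (u : Double k H) :
    @Eq (Double k H) (ofDual f * u) (opF (k := k) f u) := by
  change mk f 1 * u = _
  rw [mk_mul, leftMul_one]
  rfl

theorem ofHopf_mul (h : H) (u : Double k H) :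
    @Eq (Double k H) (ofHopf h * u) (leftMul (k := k) h u) := by
  change mk 1 h * u = _
  rw [mk_mul, opF_one]
  rfl

theorem comul_one : comul (R := k) (1 : Double k H) = 1 := by
  change TensorProduct.tensorTensorTensorComm k _ _ _ _
      (comul (R := k) (1 : ConvDual k H) ⊗ₜ[k] comul (R := k) (1 : H)) = _
  have h1 : comul (R := k) (1 : ConvDual k H) = 1 ⊗ₜ[k] 1 := by
    apply eval₂_ext
    intro b c
    rw [eval₂_comul, eval₂_tmul]
    simp [mul_comm]
  rw [h1, Bialgebra.comul_one]
  rfl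

theorem comul_ofDual_mul (f : ConvDual k H) (u : Double k H) :
    comul (R := k) (ofDual f * u) =
      TensorProduct.map ofDual ofDual (comul (R := k) f) * comul (R := k) u := by
  rw [ofDual_mul]
  refine (comul_opF (k := k) f u).trans ?_
  have : ∀ (s : ConvDual k H ⊗[k] ConvDual k H) (t : Double k H ⊗[k] Double k H),
      TensorProduct.map₂ (opF (k := k) (H := H)) (opF (k := k) (H := H)) s t =
        TensorProduct.map ofDual ofDual s * t := by
    intro s t
    induction s with
    | zero =>
      rw [map_zero, map_zero, zero_mul]
      rfl
    | add x y hx hy =>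
      rw [map_add, map_add, add_mul, ← hx, ← hy]
      rfl
    | tmul x y =>
      induction t with
      | zero =>
        rw [mul_zero]
        exact map_zero _
      | add u v hu hv =>
        rw [mul_add, ← hu, ← hv]
        exact map_add _ u v
      | tmul u v =>
        rw [TensorProduct.map_tmul, Algebra.TensorProduct.tmul_mul_tmul, ofDual_mul, ofDual_mul]
        rfl
  exact this _ _

theorem comul_ofHopf_mul (h : H) (u : Double k H) :
    comul (R := k) (ofHopf h * u) =
      TensorProduct.map ofHopf ofHopf (comul (R := k) h) * comul (R := k) u := by
  rw [ofHopf_mul]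
  refine (comul_leftMul_apply (k := k) h u).trans ?_
  conv_rhs => rw [← (ℛ k h).eq]
  rw [map_sum, Finset.sum_mul]
  refine Finset.sum_congr rfl fun i _ => ?_
  have : ∀ (x y : H) (t : Double k H ⊗[k] Double k H),
      ((inl k H leftMul).ofConv x * (inr k H leftMul).ofConv y) t =
        TensorProduct.map ofHopf ofHopf (x ⊗ₜ[k] y) * t := by
    intro x y t
    induction t with
    | zero =>
      rw [mul_zero]
      exact map_zero _
    | add u v hu hv =>
      rw [mul_add, ← hu, ← hv]
      exact map_add _ u v
    | tmul u v =>
      rw [TensorProduct.map_tmul, Algebra.TensorProduct.tmul_mul_tmul, ofHopf_mul, ofHopf_mul]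
      rfl
  exact this _ _ _

theorem comul_mul (u v : Double k H) :
    comul (R := k) (u * v) = comul (R := k) u * comul (R := k) v := by
  induction u using induction with
  | zero => rw [zero_mul, map_zero, zero_mul]
  | add x y hx hy => rw [add_mul, map_add, map_add, add_mul, hx, hy]
  | tmul f h =>
    have e : comul (R := k) (ofHopf h : Double k H) =
        TensorProduct.map ofHopf ofHopf (comul (R := k) h) := by
      have := comul_ofHopf_mul (k := k) h (1 : Double k H)
      rwa [mul_one, comul_one, mul_one] at this
    rw [mk_eq, mul_assoc, comul_ofDual_mul, comul_ofHopf_mul, comul_ofDual_mul, e, mul_assoc]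

theorem counit_mul (u v : Double k H) :
    counit (R := k) (u * v) = counit (R := k) u * counit (R := k) v := by
  induction u using induction with
  | zero => rw [zero_mul, map_zero, zero_mul]
  | add x y hx hy => rw [add_mul, map_add, map_add, add_mul, hx, hy]
  | tmul f h =>
    have e : counit (R := k) (mk f h) = counit (R := k) h * counit (R := k) f :=
      TensorProduct.counit_tmul (S := k) (R := k) f h
    rw [mk_mul, e, mul_comm (counit (R := k) h), mul_assoc]
    exact (counit_opF (k := k) f _).trans (congrArg _ (counit_leftMul h v))

theorem counit_one : counit (R := k) (1 : Double k H) = 1 := by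
  have e : counit (R := k) (mk (1 : ConvDual k H) (1 : H)) =
      counit (R := k) (1 : H) * counit (R := k) (1 : ConvDual k H) :=
    TensorProduct.counit_tmul (S := k) (R := k) _ _
  rw [one_def, e, Bialgebra.counit_one, coop_counit]
  simp

variable (k H) in
/-- The bialgebra structure of the double. -/
instance : Bialgebra k (Double k H) :=
  Bialgebra.mk' k (Double k H) counit_one (counit_mul _ _) comul_one (comul_mul _ _)

end Double
end Double

section QBinomial

variable {k A : Type*} [Field k] [Ring A] [Algebra k A]

/-- Gaussian binomial coefficients. -/
def gauss (q : k) : ℕ → ℕ → k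
  | _, 0 => 1
  | 0, _ + 1 => 0
  | n + 1, i + 1 => gauss q n i + q ^ (i + 1) * gauss q n (i + 1)

/-- The `q`-integer `1 + q + ⋯ + q ^ (n - 1)`. -/
def qint (q : k) (n : ℕ) : k := ∑ i ∈ Finset.range n, q ^ i

theorem qint_succ (q : k) (n : ℕ) : qint q (n + 1) = qint q n + q ^ n :=
  Finset.sum_range_succ _ _

theorem gauss_eq_zero (q : k) : ∀ (n i : ℕ), n < i → gauss q n i = 0
  | 0, i + 1, _ => rfl
  | n + 1, i + 1, h => by
    rw [gauss, gauss_eq_zero q n i (by omega), gauss_eq_zero q n (i + 1) (by omega)]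
    simp

theorem gauss_self (q : k) : ∀ n, gauss q n n = 1
  | 0 => rfl
  | n + 1 => by rw [gauss, gauss_self q n, gauss_eq_zero q n (n + 1) (by omega)]; simp

theorem qint_add (q : k) (m n : ℕ) : qint q (m + n) = qint q m + q ^ m * qint q n := by
  rw [qint, Finset.sum_range_add, ← qint, qint, qint, Finset.mul_sum]
  simp only [pow_add]

theorem gauss_mul (q : k) : ∀ n i, i ≤ n →
    qint q (i + 1) * gauss q (n + 1) (i + 1) = qint q (n + 1) * gauss q n i := by
  intro n
  induction n with
  | zero =>
    intro i hi
    obtain rfl : i = 0 := by omega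
    simp [gauss]
  | succ n ih =>
    intro i hi
    cases i with
    | zero =>
      have h := ih 0 (Nat.zero_le _)
      have h0 : gauss q n 0 = 1 := by cases n <;> rfl
      rw [show gauss q (n + 1 + 1) (0 + 1) = gauss q (n + 1) 0 + q ^ (0 + 1) *
        gauss q (n + 1) (0 + 1) from rfl]
      have h1 : gauss q (n + 1) 0 = 1 := rfl
      rw [h1]
      have h2 : qint q (0 + 1) = 1 := by simp [qint]
      rw [h2, h0] at h
      rw [h2, show n + 1 + 1 = 1 + (n + 1) by omega, qint_add]
      have h3 : qint q 1 = 1 := by simp [qint]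
      rw [h3]
      linear_combination q * h
    | succ i =>
      by_cases hin : i = n
      · subst hin
        rw [gauss_self, gauss_self]
      · have h1 := ih (i + 1) (by omega)
        have h2 := ih i (by omega)
        rw [show gauss q (n + 1 + 1) (i + 1 + 1) = gauss q (n + 1) (i + 1) +
          q ^ (i + 1 + 1) * gauss q (n + 1) (i + 1 + 1) from rfl]
        have h3 : gauss q (n + 1) (i + 1) = gauss q n i + q ^ (i + 1) * gauss q n (i + 1) := rfl
        have h4 : qint q (i + 1 + 1) = qint q (i + 1) + q ^ (i + 1) := qint_succ _ _
        have h5 : qint q (n + 1 + 1) = qint q (i + 1) + q ^ (i + 1) * qint q (n + 1 - i) := by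
          rw [← qint_add]; congr 1; omega
        have h6 : qint q (n + 1) = qint q (i + 1) + q ^ (i + 1) * qint q (n - i) := by
          rw [← qint_add]; congr 1; omega
        have h7 : qint q (n + 1 + 1) = 1 + q * qint q (n + 1) := by
          rw [show n + 1 + 1 = 1 + (n + 1) by omega, qint_add]; simp [qint]
        have h8 : qint q (i + 1 + 1) = 1 + q * qint q (i + 1) := by
          rw [show i + 1 + 1 = 1 + (i + 1) by omega, qint_add]; simp [qint]
        rw [mul_add, h8]
        have h1' : qint q (i + 1 + 1) * gauss q (n + 1) (i + 1 + 1) =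
          qint q (n + 1) * gauss q n (i + 1) := h1
        rw [h8] at h1'
        rw [h7]
        linear_combination (q ^ (i + 1 + 1)) * h1' + q * h2 - q * qint q (n + 1) * h3

theorem gauss_vanish (q : k) (n i : ℕ) (hn : qint q n = 0)
    (hq : ∀ m, 0 < m → m < n → qint q m ≠ 0) (hi : 0 < i) (hin : i < n) : gauss q n i = 0 := by
  obtain ⟨i, rfl⟩ : ∃ j, i = j + 1 := ⟨i - 1, by omega⟩
  obtain ⟨n, rfl⟩ : ∃ j, n = j + 1 := ⟨n - 1, by omega⟩
  have h := gauss_mul q n i (by omega)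
  rw [hn, zero_mul] at h
  exact (mul_eq_zero.1 h).resolve_left (hq _ hi hin)

theorem q_binomial (q : k) (x y : A) (h : y * x = q • (x * y)) (n : ℕ) :
    (x + y) ^ n = ∑ i ∈ Finset.range (n + 1), gauss q n i • (x ^ (n - i) * y ^ i) := by
  have hc : ∀ m, y ^ m * x = q ^ m • (x * y ^ m) := by
    intro m
    induction m with
    | zero => simp
    | succ m ih =>
      rw [pow_succ, mul_assoc, h, mul_smul_comm, ← mul_assoc, ih, smul_mul_assoc, smul_smul,
        mul_assoc, ← pow_succ, ← pow_succ']
  induction n with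
  | zero => simp [gauss]
  | succ n ih =>
    have e1 : ∑ i ∈ Finset.range (n + 1), gauss q n i • (x ^ (n - i) * y ^ i) * x =
        x ^ (n + 1) + ∑ i ∈ Finset.range (n + 1),
          (q ^ (i + 1) * gauss q n (i + 1)) • (x ^ (n - i) * y ^ (i + 1)) := by
      have e2 : ∀ i ∈ Finset.range (n + 1), gauss q n i • (x ^ (n - i) * y ^ i) * x =
          (q ^ i * gauss q n i) • (x ^ (n + 1 - i) * y ^ i) := by
        intro i hi
        have hi' : i ≤ n := by simpa [Nat.lt_succ_iff] using hi
        rw [smul_mul_assoc, mul_assoc, hc, mul_smul_comm, smul_smul, ← mul_assoc, ← pow_succ,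
          mul_comm (gauss q n i), show n - i + 1 = n + 1 - i by omega]
      rw [Finset.sum_congr rfl e2, Finset.sum_range_succ',
        Finset.sum_range_succ (fun i => (q ^ (i + 1) * gauss q n (i + 1)) •
          (x ^ (n - i) * y ^ (i + 1))) n, gauss_eq_zero q n (n + 1) (by omega)]
      have h0 : gauss q n 0 = 1 := by cases n <;> rfl
      rw [h0]
      simp [add_comm]
    rw [pow_succ, ih, mul_add, Finset.sum_mul, Finset.sum_mul, e1]
    rw [Finset.sum_range_succ' (fun i => gauss q (n + 1) i • (x ^ (n + 1 - i) * y ^ i)) (n + 1)]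
    have e3 : ∀ i, gauss q (n + 1) (i + 1) • (x ^ (n + 1 - (i + 1)) * y ^ (i + 1)) =
        gauss q n i • (x ^ (n - i) * y ^ i) * y +
          (q ^ (i + 1) * gauss q n (i + 1)) • (x ^ (n - i) * y ^ (i + 1)) := by
      intro i
      rw [show n + 1 - (i + 1) = n - i by omega, gauss, add_smul, smul_mul_assoc, mul_assoc,
        ← pow_succ]
    rw [Finset.sum_congr rfl fun i _ => e3 i, Finset.sum_add_distrib]
    have h0 : gauss q (n + 1) 0 = 1 := rfl
    rw [h0]
    simp
    abel

theorem qint_orderOf (q : kˣ) :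
    (orderOf q = 1 ∨ qint (q : k) (orderOf q) = 0) ∧
      ∀ m, 0 < m → m < orderOf q → qint (q : k) m ≠ 0 := by
  have key : ∀ m, ((q : k) - 1) * qint (q : k) m = (q : k) ^ m - 1 := by
    intro m
    rw [qint, mul_comm]
    exact geom_sum_mul _ _
  constructor
  · by_cases h1 : orderOf q = 1
    · exact Or.inl h1
    · refine Or.inr ?_
      have h2 := key (orderOf q)
      have h3 : (q : k) ^ orderOf q = 1 := by
        rw [← Units.val_pow_eq_pow_val, pow_orderOf_eq_one, Units.val_one]
      rw [h3, sub_self] at h2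
      refine (mul_eq_zero.1 h2).resolve_left fun h4 => h1 ?_
      rw [orderOf_eq_one_iff]
      exact Units.ext (sub_eq_zero.1 h4)
  · intro m hm0 hm h
    have h2 := key m
    rw [h, mul_zero] at h2
    refine pow_ne_one_of_lt_orderOf (x := q) hm0.ne' hm (Units.ext ?_)
    rw [Units.val_pow_eq_pow_val, Units.val_one]
    exact (sub_eq_zero.1 h2.symm)

/-- If `y x = q x y` with `q` of finite order `n` and `x ^ n = y ^ n = 0`, then
`(x + y) ^ n = 0`. -/
theorem add_pow_orderOf_eq_zero (q : kˣ) (x y : A)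
    (h : y * x = (q : k) • (x * y)) (hx : x ^ orderOf q = 0) (hy : y ^ orderOf q = 0) :
    (x + y) ^ orderOf q = 0 := by
  obtain ⟨h1, h2⟩ := qint_orderOf q
  rw [q_binomial (q : k) x y h]
  refine Finset.sum_eq_zero fun i hi => ?_
  have hi' : i ≤ orderOf q := by simpa [Nat.lt_succ_iff] using hi
  by_cases hi0 : i = 0
  · subst hi0
    rw [Nat.sub_zero, hx, zero_mul, smul_zero]
  by_cases hin : i = orderOf q
  · rw [hin, hy, mul_zero, smul_zero]
  · rw [gauss_vanish (q : k) (orderOf q) i (h1.resolve_left (by omega)) h2 (by omega) (by omega),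
      zero_smul]

end QBinomial

section RankOne

variable {k : Type*} [Field k] {G : Type*} [CommGroup G]

/-- The generators of the rank one Hopf algebra: the elements of the group `G` and `x`. -/
inductive Gen (G : Type*) : Type _
  | grp (g : G) : Gen G
  | x : Gen G

/-- The defining relations of the rank one Hopf algebra of nilpotent type with data `(G, χ, a)`:
the relations of the group algebra of `G`, together with `x ^ ℓ = 0` for `ℓ = |χ(a)|` and
`x g = χ(g) g x` for `g` in `G`. -/
inductive HRel (χ : G →* kˣ) (a : G) : FreeAlgebra k (Gen G) → FreeAlgebra k (Gen G) → Prop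
  | one : HRel χ a (FreeAlgebra.ι k (Gen.grp 1)) 1
  | mul (g h : G) : HRel χ a (FreeAlgebra.ι k (Gen.grp (g * h)))
      (FreeAlgebra.ι k (Gen.grp g) * FreeAlgebra.ι k (Gen.grp h))
  | nil : HRel χ a (FreeAlgebra.ι k Gen.x ^ orderOf (χ a)) 0
  | comm (g : G) : HRel χ a (FreeAlgebra.ι k Gen.x * FreeAlgebra.ι k (Gen.grp g))
      ((χ g : k) • (FreeAlgebra.ι k (Gen.grp g) * FreeAlgebra.ι k Gen.x))

/-- The algebra `H_𝒟` of the data `𝒟 = (G, χ, a)`, generated by `G` and `x`. -/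
def RankOne (χ : G →* kˣ) (a : G) : Type _ := RingQuot (HRel χ a)

namespace RankOne

variable (χ : G →* kˣ) (a : G)

instance : Ring (RankOne χ a) := inferInstanceAs (Ring (RingQuot (HRel χ a)))

instance : Algebra k (RankOne χ a) := inferInstanceAs (Algebra k (RingQuot (HRel χ a)))

/-- The quotient map from the free algebra. -/
def proj : FreeAlgebra k (Gen G) →ₐ[k] RankOne χ a := RingQuot.mkAlgHom k (HRel χ a)

/-- The image of `g ∈ G`. -/
def grp (g : G) : RankOne χ a := proj χ a (FreeAlgebra.ι k (Gen.grp g))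

/-- The generator `x`. -/
def x : RankOne χ a := proj χ a (FreeAlgebra.ι k Gen.x)

theorem grp_one : grp χ a 1 = 1 :=
  (RingQuot.mkAlgHom_rel k (HRel.one (χ := χ) (a := a))).trans (map_one _)

theorem grp_mul (g h : G) : grp χ a (g * h) = grp χ a g * grp χ a h :=
  (RingQuot.mkAlgHom_rel k (HRel.mul (χ := χ) (a := a) g h)).trans (map_mul _ _ _)

theorem x_pow : x χ a ^ orderOf (χ a) = 0 :=
  (map_pow (proj χ a) _ _).symm.trans
    ((RingQuot.mkAlgHom_rel k (HRel.nil (χ := χ) (a := a))).trans (map_zero _))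

theorem x_grp (g : G) : x χ a * grp χ a g = (χ g : k) • (grp χ a g * x χ a) := by
  refine (map_mul (proj χ a) _ _).symm.trans
    ((RingQuot.mkAlgHom_rel k (HRel.comm (χ := χ) (a := a) g)).trans ?_)
  change proj χ a _ = _
  rw [map_smul, map_mul]
  rfl

section Lift

variable {χ a} {B : Type*} [Ring B] [Algebra k B]

/-- The universal property of `H_𝒟`. -/
def lift (φ : G → B) (y : B) (h1 : φ 1 = 1) (hm : ∀ g h, φ (g * h) = φ g * φ h)
    (hy : y ^ orderOf (χ a) = 0) (hc : ∀ g, y * φ g = (χ g : k) • (φ g * y)) :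
    RankOne χ a →ₐ[k] B :=
  RingQuot.liftAlgHom k ⟨FreeAlgebra.lift k (fun | Gen.grp g => φ g | Gen.x => y), by
    intro u v huv
    cases huv with
    | one => simpa using h1
    | mul g h => simpa using hm g h
    | nil => simpa using hy
    | comm g => simpa using hc g⟩

variable (φ : G → B) (y : B) (h1 : φ 1 = 1) (hm : ∀ g h, φ (g * h) = φ g * φ h)
    (hy : y ^ orderOf (χ a) = 0) (hc : ∀ g, y * φ g = (χ g : k) • (φ g * y))

@[simp]
theorem lift_grp (g : G) : lift φ y h1 hm hy hc (grp χ a g) = φ g := by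
  refine (RingQuot.liftAlgHom_mkAlgHom_apply k _ _ _).trans ?_
  simp

@[simp]
theorem lift_x : lift φ y h1 hm hy hc (x χ a) = y := by
  refine (RingQuot.liftAlgHom_mkAlgHom_apply k _ _ _).trans ?_
  simp

theorem algHom_ext {f g : RankOne χ a →ₐ[k] B} (hg : ∀ c, f (grp χ a c) = g (grp χ a c))
    (hx : f (x χ a) = g (x χ a)) : f = g := by
  refine RingQuot.ringQuot_ext' k f g ?_
  refine FreeAlgebra.hom_ext (funext fun i => ?_)
  cases i with
  | grp c => exact hg c
  | x => exact hx

/-- Induction principle: a property that holds for scalars and generators and is closed under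
sums and left multiplication by generators holds everywhere. -/
theorem induction {p : RankOne χ a → Prop} (hone : p 1) (hadd : ∀ u v, p u → p v → p (u + v))
    (hsmul : ∀ (c : k) u, p u → p (c • u)) (hgrp : ∀ c u, p u → p (grp χ a c * u))
    (hx : ∀ u, p u → p (x χ a * u)) (u : RankOne χ a) : p u := by
  have key : ∀ w : FreeAlgebra k (Gen G), ∀ u, p u → p (proj χ a w * u) := by
    intro w
    induction w using FreeAlgebra.induction with
    | grade0 r =>
      intro u hu
      rw [AlgHom.commutes, ← Algebra.smul_def]
      exact hsmul r u hu
    | grade1 i =>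
      intro u hu
      cases i with
      | grp c => exact hgrp c u hu
      | x => exact hx u hu
    | mul v w hv hw =>
      intro u hu
      rw [map_mul, mul_assoc]
      exact hv _ (hw _ hu)
    | add v w hv hw =>
      intro u hu
      rw [map_add, add_mul]
      exact hadd _ _ (hv _ hu) (hw _ hu)
  obtain ⟨w, rfl⟩ := RingQuot.mkAlgHom_surjective k (HRel χ a) u
  have := key w 1 hone
  rwa [mul_one] at this

end Lift

variable [Finite G]

theorem orderOf_pos' : 0 < orderOf (χ a) := by
  refine (isOfFinOrder_iff_pow_eq_one.2 ⟨Nat.card G, Nat.card_pos, ?_⟩).orderOf_pos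
  rw [← map_pow, pow_card_eq_one', map_one]

open TensorProduct in
/-- `Δ(g) = g ⊗ g` and `Δ(x) = x ⊗ a + 1 ⊗ x`. -/
def comulHom : RankOne χ a →ₐ[k] RankOne χ a ⊗[k] RankOne χ a :=
  lift (fun g => grp χ a g ⊗ₜ[k] grp χ a g)
    (x χ a ⊗ₜ[k] grp χ a a + 1 ⊗ₜ[k] x χ a)
    (by rw [grp_one]; rfl)
    (fun g h => by rw [grp_mul, Algebra.TensorProduct.tmul_mul_tmul])
    (by
      refine add_pow_orderOf_eq_zero (χ a) _ _ ?_ ?_ ?_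
      · rw [Algebra.TensorProduct.tmul_mul_tmul, Algebra.TensorProduct.tmul_mul_tmul, one_mul,
          mul_one, x_grp, TensorProduct.tmul_smul]
      · rw [Algebra.TensorProduct.tmul_pow, x_pow, TensorProduct.zero_tmul]
      · rw [Algebra.TensorProduct.tmul_pow, x_pow, TensorProduct.tmul_zero])
    (fun g => by
      rw [add_mul, mul_add, smul_add]
      simp only [Algebra.TensorProduct.tmul_mul_tmul, x_grp, one_mul, mul_one]
      rw [← grp_mul, ← grp_mul, mul_comm g a, TensorProduct.smul_tmul', TensorProduct.tmul_smul])

/-- `ε(g) = 1` and `ε(x) = 0`. -/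
def counitHom : RankOne χ a →ₐ[k] k :=
  lift (fun _ => 1) 0 rfl (fun _ _ => (one_mul 1).symm)
    (zero_pow (orderOf_pos' χ a).ne') (fun g => by simp)

open TensorProduct in
instance : Bialgebra k (RankOne χ a) :=
  Bialgebra.ofAlgHom (comulHom χ a) (counitHom χ a)
    (algHom_ext (fun g => by simp [comulHom]) (by
      simp [comulHom, TensorProduct.add_tmul, TensorProduct.tmul_add, add_assoc,
        Algebra.TensorProduct.one_def]))
    (algHom_ext (fun g => by simp [comulHom, counitHom]) (by
      simp [comulHom, counitHom]))
    (algHom_ext (fun g => by simp [comulHom, counitHom]) (by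
      simp [comulHom, counitHom]))


@[simp]
theorem comul_grp (g : G) : Coalgebra.comul (R := k) (grp χ a g) = grp χ a g ⊗ₜ[k] grp χ a g :=
  lift_grp _ _ _ _ _ _ g

@[simp]
theorem comul_x : Coalgebra.comul (R := k) (x χ a) =
    x χ a ⊗ₜ[k] grp χ a a + 1 ⊗ₜ[k] x χ a :=
  lift_x _ _ _ _ _ _

@[simp]
theorem counit_grp (g : G) : Coalgebra.counit (R := k) (grp χ a g) = 1 :=
  lift_grp _ _ _ _ _ _ g

@[simp]
theorem counit_x : Coalgebra.counit (R := k) (x χ a) = 0 :=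
  lift_x _ _ _ _ _ _

theorem grp_mul_inv (g : G) : grp χ a g * grp χ a g⁻¹ = 1 := by
  rw [← grp_mul, mul_inv_cancel, grp_one]

theorem grp_inv_mul (g : G) : grp χ a g⁻¹ * grp χ a g = 1 := by
  rw [← grp_mul, inv_mul_cancel, grp_one]

theorem grp_x (g : G) : grp χ a g * x χ a = (χ g : k)⁻¹ • (x χ a * grp χ a g) := by
  rw [x_grp, smul_smul, inv_mul_cancel₀ (Units.ne_zero _), one_smul]

theorem x_mul_grp_pow (g : G) (n : ℕ) : ∃ c : k,
    (x χ a * grp χ a g) ^ n = c • (grp χ a (g ^ n) * x χ a ^ n) := by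
  induction n with
  | zero => exact ⟨1, by simp [grp_one]⟩
  | succ n ih =>
    obtain ⟨c, hc⟩ := ih
    have hx : ∀ m, ∃ d : k, x χ a ^ m * grp χ a g = d • (grp χ a g * x χ a ^ m) := by
      intro m
      induction m with
      | zero => exact ⟨1, by simp⟩
      | succ m ih =>
        obtain ⟨d, hd⟩ := ih
        refine ⟨d * χ g, ?_⟩
        rw [pow_succ', mul_assoc, hd, mul_smul_comm, ← mul_assoc, x_grp, smul_mul_assoc, smul_smul,
          mul_assoc]
    obtain ⟨d, hd⟩ := hx (n + 1)
    refine ⟨c * d, ?_⟩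
    rw [pow_succ, hc, smul_mul_assoc, mul_assoc, ← mul_assoc (x χ a ^ n), ← pow_succ, hd,
      mul_smul_comm, smul_smul, ← mul_assoc, ← grp_mul, ← pow_succ]

theorem x_grp_pow_orderOf (g : G) : (x χ a * grp χ a g) ^ orderOf (χ a) = 0 := by
  obtain ⟨c, hc⟩ := x_mul_grp_pow χ a g (orderOf (χ a))
  rw [hc, x_pow, mul_zero, smul_zero]

theorem grp_x_pow_orderOf (g : G) : (grp χ a g * x χ a) ^ orderOf (χ a) = 0 := by
  rw [grp_x, smul_pow, x_grp_pow_orderOf, smul_zero]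

/-- An antimultiplicative map `H_𝒟 → H_𝒟` given by `g ↦ g⁻¹` and `x ↦ - y`. -/
def antiLift (y : RankOne χ a) (hy : y ^ orderOf (χ a) = 0)
    (hc : ∀ g, grp χ a g⁻¹ * y = (χ g : k) • (y * grp χ a g⁻¹)) :
    RankOne χ a →ₐ[k] (RankOne χ a)ᵐᵒᵖ :=
  lift (fun g => MulOpposite.op (grp χ a g⁻¹)) (MulOpposite.op (-y))
    (by rw [inv_one, grp_one]; rfl)
    (fun g h => by rw [mul_inv_rev, grp_mul]; rfl)
    (by rw [← MulOpposite.op_pow, neg_pow, hy, mul_zero]; rfl)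
    (fun g => by
      rw [← MulOpposite.op_mul, ← MulOpposite.op_mul, ← MulOpposite.op_smul, mul_neg, neg_mul, hc,
        smul_neg])

theorem antiLift_grp (y : RankOne χ a) (hy : y ^ orderOf (χ a) = 0)
    (hc : ∀ g, grp χ a g⁻¹ * y = (χ g : k) • (y * grp χ a g⁻¹)) (g : G) :
    antiLift χ a y hy hc (grp χ a g) = MulOpposite.op (grp χ a g⁻¹) := by
  unfold antiLift
  rw [lift_grp]

theorem antiLift_x (y : RankOne χ a) (hy : y ^ orderOf (χ a) = 0)
    (hc : ∀ g, grp χ a g⁻¹ * y = (χ g : k) • (y * grp χ a g⁻¹)) :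
    antiLift χ a y hy hc (x χ a) = MulOpposite.op (-y) := by
  unfold antiLift
  rw [lift_x]

/-- The antipode, `S(g) = g⁻¹` and `S(x) = - x a⁻¹`, as a homomorphism to the opposite algebra. -/
def antipodeHom : RankOne χ a →ₐ[k] (RankOne χ a)ᵐᵒᵖ :=
  antiLift χ a (x χ a * grp χ a a⁻¹) (x_grp_pow_orderOf χ a a⁻¹) fun g => by
    rw [← mul_assoc, grp_x, smul_mul_assoc, mul_assoc, mul_assoc, ← grp_mul, ← grp_mul,
      mul_comm g⁻¹, map_inv, Units.val_inv_eq_inv_val, inv_inv]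

/-- The inverse of the antipode, `g ↦ g⁻¹` and `x ↦ - a⁻¹ x`. -/
def antipodeInvHom : RankOne χ a →ₐ[k] (RankOne χ a)ᵐᵒᵖ :=
  antiLift χ a (grp χ a a⁻¹ * x χ a) (grp_x_pow_orderOf χ a a⁻¹) fun g => by
    rw [mul_assoc, x_grp, mul_smul_comm, smul_smul, ← mul_assoc, ← mul_assoc, ← grp_mul, ← grp_mul,
      mul_comm g⁻¹, map_inv, Units.val_inv_eq_inv_val, mul_inv_cancel₀ (Units.ne_zero _), one_smul]

/-- The antipode as a linear map. -/
def anti : RankOne χ a →ₗ[k] RankOne χ a :=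
  (MulOpposite.opLinearEquiv k).symm.toLinearMap ∘ₗ (antipodeHom χ a).toLinearMap

/-- The inverse of the antipode as a linear map. -/
def antiInv : RankOne χ a →ₗ[k] RankOne χ a :=
  (MulOpposite.opLinearEquiv k).symm.toLinearMap ∘ₗ (antipodeInvHom χ a).toLinearMap

theorem anti_mul (u v : RankOne χ a) : anti χ a (u * v) = anti χ a v * anti χ a u :=
  congrArg MulOpposite.unop (map_mul (antipodeHom χ a) u v)

theorem anti_one : anti χ a 1 = 1 := congrArg MulOpposite.unop (map_one (antipodeHom χ a))

theorem anti_grp (g : G) : anti χ a (grp χ a g) = grp χ a g⁻¹ :=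
  congrArg MulOpposite.unop (antiLift_grp χ a _ _ _ g)

theorem anti_x : anti χ a (x χ a) = -(x χ a * grp χ a a⁻¹) :=
  congrArg MulOpposite.unop (antiLift_x χ a _ _ _)

theorem antiInv_mul (u v : RankOne χ a) :
    antiInv χ a (u * v) = antiInv χ a v * antiInv χ a u :=
  congrArg MulOpposite.unop (map_mul (antipodeInvHom χ a) u v)

theorem antiInv_one : antiInv χ a 1 = 1 :=
  congrArg MulOpposite.unop (map_one (antipodeInvHom χ a))

theorem antiInv_grp (g : G) : antiInv χ a (grp χ a g) = grp χ a g⁻¹ :=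
  congrArg MulOpposite.unop (antiLift_grp χ a _ _ _ g)

theorem antiInv_x : antiInv χ a (x χ a) = -(grp χ a a⁻¹ * x χ a) :=
  congrArg MulOpposite.unop (antiLift_x χ a _ _ _)

theorem antiInv_anti (u : RankOne χ a) : antiInv χ a (anti χ a u) = u := by
  induction u using induction with
  | hone => rw [anti_one, antiInv_one]
  | hadd u v hu hv => rw [map_add, map_add, hu, hv]
  | hsmul c u hu => rw [map_smul, map_smul, hu]
  | hgrp c u hu => rw [anti_mul, antiInv_mul, hu, anti_grp, antiInv_grp, inv_inv]
  | hx u hu =>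
    rw [anti_mul, antiInv_mul, hu, anti_x, map_neg, antiInv_mul, antiInv_grp, antiInv_x, mul_neg,
      neg_neg, ← mul_assoc, inv_inv, grp_mul_inv, one_mul]

theorem anti_antiInv (u : RankOne χ a) : anti χ a (antiInv χ a u) = u := by
  induction u using induction with
  | hone => rw [antiInv_one, anti_one]
  | hadd u v hu hv => rw [map_add, map_add, hu, hv]
  | hsmul c u hu => rw [map_smul, map_smul, hu]
  | hgrp c u hu => rw [antiInv_mul, anti_mul, hu, antiInv_grp, anti_grp, inv_inv]
  | hx u hu =>
    rw [antiInv_mul, anti_mul, hu, antiInv_x, map_neg, anti_mul, anti_grp, anti_x, neg_mul,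
      neg_mul, neg_mul, neg_neg, mul_assoc (x χ a), inv_inv, grp_inv_mul, mul_one]

open TensorProduct in
theorem mul_anti_right (u : RankOne χ a) :
    LinearMap.mul' k _ ((anti χ a).lTensor _ (Coalgebra.comul (R := k) u)) =
      algebraMap k _ (Coalgebra.counit (R := k) u) := by
  induction u using induction with
  | hone => simp [Algebra.TensorProduct.one_def, anti_one]
  | hadd u v hu hv => simp only [map_add, hu, hv]
  | hsmul c u hu =>
    rw [map_smul, map_smul, map_smul, map_smul, hu, smul_eq_mul, map_mul, Algebra.smul_def]
  | hgrp c u hu =>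
    have key : ∀ t : RankOne χ a ⊗[k] RankOne χ a,
        LinearMap.mul' k _ ((anti χ a).lTensor _ (grp χ a c ⊗ₜ[k] grp χ a c * t)) =
        grp χ a c * LinearMap.mul' k _ ((anti χ a).lTensor _ t) * grp χ a c⁻¹ := by
      intro t
      induction t with
      | zero => simp
      | add p q hp hq => simp only [mul_add, map_add, hp, hq, add_mul]
      | tmul p q => simp [anti_mul, anti_grp, mul_assoc]
    rw [Bialgebra.comul_mul, comul_grp, key, hu, Bialgebra.counit_mul, counit_grp, one_mul,
      ← Algebra.commutes, mul_assoc, grp_mul_inv, mul_one]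
  | hx u hu =>
    have key : ∀ t : RankOne χ a ⊗[k] RankOne χ a,
        LinearMap.mul' k _ ((anti χ a).lTensor _ ((x χ a ⊗ₜ[k] grp χ a a + 1 ⊗ₜ[k] x χ a) * t)) =
        x χ a * LinearMap.mul' k _ ((anti χ a).lTensor _ t) * grp χ a a⁻¹ -
          LinearMap.mul' k _ ((anti χ a).lTensor _ t) * (x χ a * grp χ a a⁻¹) := by
      intro t
      induction t with
      | zero => simp
      | add p q hp hq =>
        rw [mul_add, map_add, map_add, hp, hq, map_add, map_add]
        noncomm_ring
      | tmul p q => simp [add_mul, anti_mul, anti_grp, anti_x, mul_assoc, sub_eq_add_neg]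
    rw [Bialgebra.comul_mul, comul_x, key, hu, Bialgebra.counit_mul, counit_x, zero_mul, map_zero,
      ← Algebra.commutes, mul_assoc, sub_self]

open TensorProduct in
theorem mul_anti_left (u : RankOne χ a) :
    LinearMap.mul' k _ ((anti χ a).rTensor _ (Coalgebra.comul (R := k) u)) =
      algebraMap k _ (Coalgebra.counit (R := k) u) := by
  have key1 : ∀ (c : G) (t : RankOne χ a ⊗[k] RankOne χ a),
      LinearMap.mul' k _ ((anti χ a).rTensor _ (grp χ a c ⊗ₜ[k] grp χ a c * t)) =
      LinearMap.mul' k _ ((anti χ a).rTensor _ t) := by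
    intro c t
    induction t with
    | zero => simp
    | add p q hp hq => simp only [mul_add, map_add, hp, hq]
    | tmul p q =>
      simp only [Algebra.TensorProduct.tmul_mul_tmul, LinearMap.rTensor_tmul, LinearMap.mul'_apply,
        anti_mul, anti_grp]
      rw [mul_assoc, ← mul_assoc (grp χ a c⁻¹), grp_inv_mul, one_mul]
  have key2 : ∀ t : RankOne χ a ⊗[k] RankOne χ a,
      LinearMap.mul' k _ ((anti χ a).rTensor _ ((x χ a ⊗ₜ[k] grp χ a a + 1 ⊗ₜ[k] x χ a) * t)) =
      0 := by
    intro t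
    induction t with
    | zero => simp
    | add p q hp hq => simp only [mul_add, map_add, hp, hq, add_zero]
    | tmul p q =>
      simp only [add_mul, map_add, Algebra.TensorProduct.tmul_mul_tmul, LinearMap.rTensor_tmul,
        LinearMap.mul'_apply, anti_mul, anti_x, one_mul, mul_neg, neg_mul]
      rw [mul_assoc, mul_assoc, ← mul_assoc (grp χ a a⁻¹), grp_inv_mul, one_mul, neg_add_cancel]
  induction u using induction with
  | hone => simp [Algebra.TensorProduct.one_def, anti_one]
  | hadd u v hu hv => simp only [map_add, hu, hv]
  | hsmul c u hu =>
    rw [map_smul, map_smul, map_smul, map_smul, hu, smul_eq_mul, map_mul, Algebra.smul_def]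
  | hgrp c u hu =>
    rw [Bialgebra.comul_mul, comul_grp, key1, hu, Bialgebra.counit_mul, counit_grp, one_mul]
  | hx u hu =>
    rw [Bialgebra.comul_mul, comul_x, key2, Bialgebra.counit_mul, counit_x, zero_mul, map_zero]

instance : HopfAlgebra k (RankOne χ a) where
  antipode := anti χ a
  mul_antipode_rTensor_comul := LinearMap.ext (mul_anti_left χ a)
  mul_antipode_lTensor_comul := LinearMap.ext (mul_anti_right χ a)

instance : BijectiveAntipode k (RankOne χ a) :=
  ⟨Function.bijective_iff_has_inverse.2 ⟨antiInv χ a, antiInv_anti χ a, anti_antiInv χ a⟩⟩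

instance : Module.Finite k (RankOne χ a) := by
  let s : Set (RankOne χ a) :=
    Set.range fun p : G × Fin (orderOf (χ a)) => grp χ a p.1 * x χ a ^ (p.2 : ℕ)
  have hx : ∀ (c : G) (n : ℕ), grp χ a c * x χ a ^ n ∈ Submodule.span k s := by
    intro c n
    by_cases hn : n < orderOf (χ a)
    · exact Submodule.subset_span ⟨(c, ⟨n, hn⟩), rfl⟩
    · obtain ⟨m, rfl⟩ := Nat.exists_eq_add_of_le (not_lt.1 hn)
      rw [pow_add, x_pow, zero_mul, mul_zero]
      exact zero_mem _
  have hs : ∀ u : RankOne χ a, u ∈ Submodule.span k s := by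
    have hl : ∀ (y : RankOne χ a), (∀ v ∈ s, y * v ∈ Submodule.span k s) →
        ∀ u ∈ Submodule.span k s, y * u ∈ Submodule.span k s := by
      intro y hy u hu
      induction hu using Submodule.span_induction with
      | mem v hv => exact hy v hv
      | zero => rw [mul_zero]; exact zero_mem _
      | add v w _ _ hv hw => rw [mul_add]; exact add_mem hv hw
      | smul c v _ hv => rw [mul_smul_comm]; exact Submodule.smul_mem _ _ hv
    intro u
    induction u using induction with
    | hone =>
      have := hx 1 0
      rwa [grp_one, one_mul, pow_zero] at this
    | hadd u v hu hv => exact add_mem hu hv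
    | hsmul c u hu => exact Submodule.smul_mem _ _ hu
    | hgrp c u hu =>
      refine hl _ ?_ u hu
      rintro _ ⟨p, rfl⟩
      change grp χ a c * (grp χ a p.1 * x χ a ^ (p.2 : ℕ)) ∈ _
      rw [← mul_assoc, ← grp_mul]
      exact hx _ _
    | hx u hu =>
      refine hl _ ?_ u hu
      rintro _ ⟨p, rfl⟩
      change x χ a * (grp χ a p.1 * x χ a ^ (p.2 : ℕ)) ∈ _
      rw [← mul_assoc, x_grp, smul_mul_assoc, mul_assoc, ← pow_succ']
      exact Submodule.smul_mem _ _ (hx _ _)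
  exact Module.Finite.of_fg_top ⟨(Set.finite_range _).toFinset, by
    rw [Set.Finite.coe_toFinset]
    exact eq_top_iff.2 fun u _ => hs u⟩

end RankOne
end RankOne

section Factorization

universe w

attribute [local instance] ModuleCat.moduleOfAlgebraModule
  ModuleCat.isScalarTower_of_algebra_moduleCat

section Quotient

variable (k : Type*) (A : Type*) [Field k] [Ring A] [Bialgebra k A]

/-- The set `G_C(A)` of central group-like elements. -/
def centralGroupLike : Set A := {g | IsGroupLikeElem k g ∧ g ∈ Set.center A}

/-- The linear span of the central group-like elements. -/
def centralSpan : Submodule k A := Submodule.span k (centralGroupLike k A)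

/-- The left ideal `A L⁺`, where `L` is the span of the central group-like elements and
`L⁺ = L ∩ ker ε`. -/
def centralIdeal : Ideal A :=
  Ideal.span {z | z ∈ centralSpan k A ∧ Coalgebra.counit (R := k) z = 0}

theorem commute_of_mem_centralSpan {z : A} (hz : z ∈ centralSpan k A) (b : A) :
    z * b = b * z := by
  induction hz using Submodule.span_induction with
  | mem x hx => exact hx.2.comm b
  | zero => rw [zero_mul, mul_zero]
  | add x y _ _ hx hy => rw [add_mul, mul_add, hx, hy]
  | smul c x _ hx => rw [smul_mul_assoc, mul_smul_comm, hx]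

/-- As `L` is central, the left ideal `A L⁺` is two-sided. -/
instance : (centralIdeal k A).IsTwoSided := by
  refine ⟨fun {z} b hz => ?_⟩
  induction hz using Submodule.span_induction with
  | mem x hx =>
    rw [commute_of_mem_centralSpan k A hx.1 b]
    exact Ideal.mul_mem_left _ _ (Ideal.subset_span hx)
  | zero => rw [zero_mul]; exact zero_mem _
  | add x y _ _ hx hy => rw [add_mul]; exact add_mem hx hy
  | smul c x _ hx => rw [smul_eq_mul, mul_assoc]; exact Ideal.mul_mem_left _ _ hx

/-- The quotient of `A` by its central group-like elements, `A / A (k G_C(A))⁺`. -/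
abbrev CentralQuotient : Type _ := A ⧸ centralIdeal k A

end Quotient

section IsoClasses

variable (A : Type*) [Ring A]

/-- Isomorphism of `A`-modules. -/
def isoSetoid : Setoid (ModuleCat.{w} A) where
  r M N := Nonempty (M ≃ₗ[A] N)
  iseqv := ⟨fun _ => ⟨LinearEquiv.refl A _⟩, fun ⟨e⟩ => ⟨e.symm⟩, fun ⟨e⟩ ⟨f⟩ => ⟨e.trans f⟩⟩

/-- Isomorphism classes of (left) `A`-modules. -/
def IsoClass : Type _ := Quotient (isoSetoid.{w} A)

variable {A}

/-- The isomorphism class of a module. -/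
def IsoClass.mk (M : ModuleCat.{w} A) : IsoClass.{w} A := Quotient.mk (isoSetoid A) M

variable (A)

/-- The set `S_A` of isomorphism classes of simple `A`-modules. -/
def simpleClasses : Set (IsoClass.{w} A) :=
  {c | ∃ M : ModuleCat.{w} A, IsSimpleModule A M ∧ IsoClass.mk M = c}

/-- The set `S¹_A` of isomorphism classes of `A`-modules that are one-dimensional over `k`. -/
def oneDimClasses (k : Type*) [Field k] [Algebra k A] : Set (IsoClass.{w} A) :=
  {c | ∃ M : ModuleCat.{w} A, Module.finrank k M = 1 ∧ IsoClass.mk M = c}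

end IsoClasses

section Tensor

/-- The tensor product over `k` of two modules over a bialgebra `A`, on which `A` acts through its
comultiplication. -/
def TensorMod (k _A U V : Type*) [Field k] [AddCommGroup U] [Module k U] [AddCommGroup V]
    [Module k V] : Type _ := U ⊗[k] V

variable (k A : Type*) [Field k] [Ring A] [Bialgebra k A]
  (U V : Type*) [AddCommGroup U] [Module k U] [Module A U] [IsScalarTower k A U]
  [AddCommGroup V] [Module k V] [Module A V] [IsScalarTower k A V]

instance : AddCommGroup (TensorMod k A U V) := inferInstanceAs (AddCommGroup (U ⊗[k] V))

/-- The action of `A` on `U ⊗ V`: the composition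
`A → A ⊗ A → End U ⊗ End V → End (U ⊗ V)`. -/
def tensorAction : A →ₐ[k] Module.End k (U ⊗[k] V) :=
  (Module.endTensorEndAlgHom (R := k) (S := k) (A := k) (M := U) (N := V)).comp
    ((Algebra.TensorProduct.map (Algebra.lsmul k k U) (Algebra.lsmul k k V)).comp
      (Bialgebra.comulAlgHom k A))

instance : Module A (TensorMod k A U V) :=
  Module.compHom (U ⊗[k] V) (tensorAction k A U V).toRingHom

variable {k A U V}

/-- `b (u ⊗ v) = ∑ b₁ u ⊗ b₂ v`. -/
theorem tensorAction_tmul (b : A) (u : U) (v : V) : tensorAction k A U V b (u ⊗ₜ[k] v) =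
    ∑ i ∈ (ℛ k b).index, ((ℛ k b).left i • u) ⊗ₜ[k] ((ℛ k b).right i • v) := by
  change Module.endTensorEndAlgHom (R := k) (S := k) (A := k) (M := U) (N := V)
    (Algebra.TensorProduct.map (Algebra.lsmul k k U) (Algebra.lsmul k k V) (comul (R := k) b))
    (u ⊗ₜ[k] v) = _
  conv_lhs => rw [← (ℛ k b).eq]
  simp [LinearMap.sum_apply, Module.endTensorEndAlgHom_apply]

variable {U' V' : Type*} [AddCommGroup U'] [Module k U'] [Module A U'] [IsScalarTower k A U']
  [AddCommGroup V'] [Module k V'] [Module A V'] [IsScalarTower k A V']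

/-- Isomorphic modules have isomorphic tensor products. -/
def tensorCongr (e : U ≃ₗ[A] U') (f : V ≃ₗ[A] V') :
    TensorMod k A U V ≃ₗ[A] TensorMod k A U' V' where
  __ := (TensorProduct.congr (e.restrictScalars k) (f.restrictScalars k)).toAddEquiv
  map_smul' b t := by
    change TensorProduct.map (e.restrictScalars k : U →ₗ[k] U') (f.restrictScalars k : V →ₗ[k] V')
        (tensorAction k A U V b t) = tensorAction k A U' V' b (TensorProduct.map
          (e.restrictScalars k : U →ₗ[k] U') (f.restrictScalars k : V →ₗ[k] V') t)
    induction t using TensorProduct.induction_on with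
    | zero => simp
    | add x y hx hy => simp only [map_add, hx, hy]
    | tmul u v =>
      rw [TensorProduct.map_tmul, tensorAction_tmul, tensorAction_tmul, map_sum]
      simp

end Tensor

section Phi

variable (k : Type*) (A : Type*) [Field k] [Ring A] [Bialgebra k A]

/-- The `A`-module `U ⊗ V`. -/
def tensorObj (U V : ModuleCat.{w} A) : ModuleCat.{w} A :=
  ModuleCat.of A (TensorMod k A U V)

/-- A module over the quotient of `A` by its central group-like elements, as an `A`-module. -/
def inflate (U : ModuleCat.{w} (CentralQuotient k A)) : ModuleCat.{w} A :=
  (ModuleCat.restrictScalars (Ideal.Quotient.mk (centralIdeal k A))).obj U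

/-- The map `([U], [V]) ↦ [U ⊗ V]`, where `U` is a module over the quotient of `A` by its central
group-like elements (viewed as an `A`-module) and `V` is an `A`-module. -/
def tensorMap (p : IsoClass.{w} (CentralQuotient k A) × IsoClass.{w} A) : IsoClass.{w} A :=
  Quotient.map₂ (sa := isoSetoid (CentralQuotient k A)) (sb := isoSetoid A) (sc := isoSetoid A)
    (fun U V => tensorObj k A (inflate k A U) V)
    (fun U U' ⟨e⟩ _ _ ⟨f⟩ => ⟨tensorCongr (U := inflate k A U) (U' := inflate k A U')
      { toFun := e, invFun := e.symm, left_inv := e.left_inv, right_inv := e.right_inv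
        map_add' := map_add e
        map_smul' := fun b u => e.map_smul (Ideal.Quotient.mk (centralIdeal k A) b) u } f⟩)
    p.1 p.2

theorem tensorMap_mk (U : ModuleCat.{w} (CentralQuotient k A)) (V : ModuleCat.{w} A) :
    tensorMap k A (IsoClass.mk U, IsoClass.mk V) =
      IsoClass.mk (tensorObj k A (inflate k A U) V) := rfl

end Phi

end Factorization

section Characters

variable {k : Type*} [Field k] {G : Type*} [CommGroup G] (χ : G →* kˣ) (a : G)

/-- The character `(g, γ) ↦ χ⁻¹(g) γ(a)` of `G × Γ`, where `Γ` is the group of characters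
of `G`. -/
def evChar : G × (G →* kˣ) →* kˣ where
  toFun p := (χ p.1)⁻¹ * p.2 a
  map_one' := by simp
  map_mul' p q := by
    rw [Prod.fst_mul, Prod.snd_mul, map_mul, mul_inv, MonoidHom.mul_apply, mul_mul_mul_comm]

/-- The kernel `K` of the character `(g, γ) ↦ χ⁻¹(g) γ(a)`. -/
def kerEv : Subgroup (G × (G →* kˣ)) := (evChar χ a).ker

/-- The annihilator `B^⊥` in the character group of `A` of a subgroup `B` of `A`. -/
def perp {A : Type*} [CommGroup A] (B : Subgroup A) : Subgroup (A →* kˣ) where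
  carrier := {f | ∀ b ∈ B, f b = 1}
  one_mem' _ _ := rfl
  mul_mem' hf hg b hb := by rw [MonoidHom.mul_apply, hf b hb, hg b hb, one_mul]
  inv_mem' hf b hb := by rw [MonoidHom.inv_apply, hf b hb, inv_one]

variable (k G) in
/-- The identification of `G × Γ` with the character group of `G × Γ`: the pair `(g, β)`
corresponds to the character `(f, γ) ↦ β(f) γ(g)`. -/
def toChar : G × (G →* kˣ) →* (G × (G →* kˣ) →* kˣ) where
  toFun p :=
    { toFun := fun q => p.2 q.1 * q.2 p.1
      map_one' := by simp
      map_mul' := fun q r => by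
        rw [Prod.fst_mul, Prod.snd_mul, map_mul, MonoidHom.mul_apply, mul_mul_mul_comm] }
  map_one' := by ext; simp
  map_mul' p q := by
    refine MonoidHom.ext fun r => ?_
    change (p.2 * q.2) r.1 * r.2 (p.1 * q.1) = p.2 r.1 * r.2 p.1 * (q.2 r.1 * r.2 q.1)
    rw [map_mul, MonoidHom.mul_apply, mul_mul_mul_comm]

/-- The group `K^⊥`, viewed as a subgroup of `G × Γ`. -/
def kerEvPerp : Subgroup (G × (G →* kˣ)) := 
  (perp (k := k) (A := G × (G →* kˣ)) (kerEv χ a)).comap (toChar k G)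

end Characters

section Main

variable {k : Type*} [Field k] {G : Type*} [CommGroup G] [Finite G]

/-- The Drinfel'd double `D(H_𝒟)` of the rank one Hopf algebra with data `𝒟 = (G, χ, a)`. -/
abbrev DoubleRankOne (χ : G →* kˣ) (a : G) : Type _ := Double k (RankOne χ a)

end Main

end HopfDouble

end

universe u v

noncomputable section

open TensorProduct WithConv Coalgebra

set_option linter.unusedSectionVars false

/-! The group K controls both sides of the problem. A character of D restricts to a character β of
H_𝒟 and, on H^*, to evaluation at a group-like element, which must be some g in G; compatibility
with the relation between x and H^* is exactly β(a) = χ(g). A central group-like element is γ ⊗ g,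
and it commutes with x exactly when γ(a) = χ(g). So the characters of D and the set G_C(D) are both
parametrized by K (`exists_eq_doubleChar`, `exists_eq_doubleGrp`), and evaluating the first on the
second is the symmetric pairing ((g, β), (f, γ)) ↦ β(f)γ(g) on K, whose radical is K^⊥ ∩ K.

Tensoring with a one-dimensional module of character α amounts to pulling the action back along b ↦
∑ α(b₂) b₁. For D this endomorphism is invertible, so it preserves simplicity, and it multiplies
each group-like z by α(z). Modules over the quotient of D are the D-modules on which G_C(D) acts
trivially.

If the radical is trivial, the pairing identifies K with its own character group. By Schur's lemma
G_C(D) acts on a simple module M through a character of K, hence through a unique character α of D;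
untwisting M by α gives a module over the quotient, so Φ is surjective, and α is recovered from the
action, so Φ is injective. If the radical is nontrivial, some character α ≠ ε is trivial on G_C(D).
Then k_α and k_ε both descend to the quotient and k_α ⊗ k_ε ≅ k_ε ⊗ k_α, so Φ is not injective
(`eq_counit_of_injOn`).

For the arithmetic criterion, (a, χ⁻¹) corresponds to the character defining K, so its powers lie in
K^⊥; its j-th power lies in K exactly when χ(a)^(2j) = 1. That this forces a^j = 1 and χ^j = 1 for
all j gives ℓ odd and ℓ = |a| = |χ|. Under these equalities of orders K^⊥ consists of the powers of
(a, χ⁻¹), and oddness removes the factor 2. -/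

namespace HopfDouble

/-! ### Arithmetic of K and K^⊥. -/

section Characters

variable {k : Type*} [Field k] {G : Type*} [CommGroup G] (χ : G →* kˣ) (a : G)

theorem mem_kerEv {p : G × (G →* kˣ)} : p ∈ kerEv χ a ↔ p.2 a = χ p.1 := by
  change (χ p.1)⁻¹ * p.2 a = 1 ↔ _
  rw [inv_mul_eq_one, eq_comm]

theorem mem_kerEvPerp {p : G × (G →* kˣ)} :
    p ∈ kerEvPerp χ a ↔ ∀ q ∈ kerEv χ a, toChar k G p q = 1 := Iff.rfl

theorem toChar_apply (p q : G × (G →* kˣ)) : toChar k G p q = p.2 q.1 * q.2 p.1 := rfl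

/-- The powers of (a, χ⁻¹) in K^⊥ test the orders of a and χ. Conversely, the conditions on orders
make these powers exhaust K^⊥. -/
theorem kerEvPerp_inf_kerEv_eq_bot_iff [IsAlgClosed k] [CharZero k] [Finite G] :
    kerEvPerp χ a ⊓ kerEv χ a = ⊥ ↔
      Odd (orderOf (χ a)) ∧ orderOf (χ a) = orderOf a ∧ orderOf (χ a) = orderOf χ := by
  have hℓ : 0 < orderOf (χ a) := RankOne.orderOf_pos' χ a
  have hda : orderOf (χ a) ∣ orderOf a := orderOf_map_dvd χ a
  have hdχ : orderOf (χ a) ∣ orderOf χ := orderOf_map_dvd (MonoidHom.eval a) χ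
  constructor
  · intro h
    -- The element (a, χ⁻¹)^j lies in K^⊥ for every j, and in K precisely when χ(a)^(2j) = 1.
    have key : ∀ j : ℕ, χ a ^ (2 * j) = 1 → a ^ j = 1 ∧ χ ^ j = 1 := by
      intro j hj
      have hm : (a ^ j, (χ ^ j)⁻¹) ∈ kerEvPerp χ a ⊓ kerEv χ a := by
        refine ⟨?_, ?_⟩
        · change _ ∈ kerEvPerp χ a
          rw [mem_kerEvPerp]
          intro q hq
          rw [mem_kerEv] at hq
          rw [toChar_apply]
          simp [hq]
        · change _ ∈ kerEv χ a
          rw [mem_kerEv]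
          rw [MonoidHom.inv_apply, MonoidHom.pow_apply, map_pow, inv_eq_iff_mul_eq_one, ← pow_add,
            ← two_mul, hj]
      rw [h, Subgroup.mem_bot, Prod.mk_eq_one] at hm
      exact ⟨hm.1, (inv_eq_one (a := χ ^ j)).1 hm.2⟩
    have h1 : ∀ j : ℕ, χ a ^ (2 * j) = 1 → orderOf (χ a) ∣ j := fun j hj =>
      hda.trans (orderOf_dvd_of_pow_eq_one (key j hj).1)
    -- Taking j = ℓ makes a^ℓ and χ^ℓ trivial, which bounds both orders by ℓ.
    have h2 := key (orderOf (χ a)) (by rw [mul_comm, pow_mul, pow_orderOf_eq_one, one_pow])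
    refine ⟨?_, Nat.dvd_antisymm hda (orderOf_dvd_of_pow_eq_one h2.1),
      Nat.dvd_antisymm hdχ (orderOf_dvd_of_pow_eq_one h2.2)⟩
    by_contra hodd
    rw [Nat.not_odd_iff_even, even_iff_two_dvd] at hodd
    obtain ⟨j, hj⟩ := hodd
    -- If ℓ = 2j, then χ(a)^(2j) = 1 forces ℓ to divide j = ℓ/2.
    have := Nat.le_of_dvd (by omega) (h1 j (by rw [← hj, pow_orderOf_eq_one]))
    omega
  · rintro ⟨hodd, hla, hlχ⟩
    rw [eq_bot_iff]
    rintro ⟨g, β⟩ ⟨hp, hk⟩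
    replace hp := (mem_kerEvPerp χ a).1 hp
    replace hk := (mem_kerEv χ a).1 hk
    simp only at hk
    have hprim : IsPrimitiveRoot (χ a) (orderOf (χ a)) := IsPrimitiveRoot.orderOf _
    have : NeZero (orderOf (χ a)) := ⟨hℓ.ne'⟩
    -- In a field every ℓ-th root of unity is a power of the primitive root χ(a).
    have hpow : ∀ u : kˣ, u ^ orderOf (χ a) = 1 → ∃ j : ℕ, χ a ^ j = u := fun u hu => by
      obtain ⟨i, -, hi⟩ := (IsPrimitiveRoot.coe_units_iff.2 hprim).eq_pow_of_pow_eq_one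
        (ξ := (u : k)) (by rw [← Units.val_pow_eq_pow_val, hu, Units.val_one])
      exact ⟨i, Units.ext (by simpa using hi)⟩
    obtain ⟨m, hm⟩ := hpow (β a) (by rw [← map_pow, hla, pow_orderOf_eq_one, map_one])
    -- An arbitrary (f, γ) is moved into K by multiplying f by a suitable a^(-j), where (g, β) pairs
    -- trivially; this determines the pairing of (g, β) with (f, γ). Hence (g, β) is the inverse of
    -- the m-th power of (a, χ⁻¹).
    have e : ∀ (f : G) (γ : G →* kˣ), β f * γ g = (χ f * (γ a)⁻¹) ^ m := by
      intro f γ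
      obtain ⟨j, hj⟩ := hpow ((γ a)⁻¹ * χ f) (by
        rw [mul_pow, inv_pow, ← map_pow γ, ← MonoidHom.pow_apply χ]
        conv_lhs => rw [hla, pow_orderOf_eq_one, ← hla, hlχ, pow_orderOf_eq_one]
        simp)
      have h1 := hp ((a ^ j)⁻¹ * f, γ) (by
        rw [mem_kerEv]
        simp only [map_mul, map_inv, map_pow]
        rw [hj, mul_inv_rev, inv_inv, mul_assoc, mul_left_comm, inv_mul_cancel, mul_one])
      rw [toChar_apply] at h1
      simp only [map_mul, map_inv, map_pow] at h1
      rw [← hm, mul_assoc, inv_mul_eq_one] at h1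
      rw [← h1, ← pow_mul, mul_comm m j, pow_mul, hj, mul_comm (χ f)]
    have hβ : β = χ ^ m := MonoidHom.ext fun f => by simpa using e f 1
    have hg : g = (a ^ m)⁻¹ := by
      by_contra hne
      have : g * a ^ m ≠ 1 := fun h => hne (eq_inv_of_mul_eq_one_left h)
      obtain ⟨γ, hγ⟩ := CommGroup.exists_apply_ne_one_of_hasEnoughRootsOfUnity G k this
      -- The characters of G separate its points, so the values γ(g) = γ(a)^(-m) determine g.
      refine hγ ?_
      have := e 1 γ
      simp only [map_one, one_mul, inv_pow] at this
      rw [map_mul, map_pow, this, inv_mul_cancel]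
    -- Membership in K of (a^(-m), χ^m) says that χ(a)^m = χ(a)^(-m).
    have h2 : χ a ^ (2 * m) = 1 := by
      rw [hβ, hg, MonoidHom.pow_apply, map_inv, map_pow, eq_inv_iff_mul_eq_one, ← pow_add,
        ← two_mul] at hk
      exact hk
    have h3 : orderOf (χ a) ∣ m :=
      (Nat.Coprime.dvd_of_dvd_mul_left hodd.coprime_two_right) (orderOf_dvd_of_pow_eq_one h2)
    rw [Subgroup.mem_bot, Prod.mk_eq_one]
    refine ⟨?_, ?_⟩
    · rw [hg, inv_eq_one, ← orderOf_dvd_iff_pow_eq_one, ← hla]; exact h3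
    · rw [hβ]
      exact orderOf_dvd_iff_pow_eq_one.1 (hlχ ▸ h3)

end Characters

/-! ### Characters and group-like elements of the rank one Hopf algebra. -/

namespace RankOne

variable {k : Type*} [Field k] {G : Type*} [CommGroup G] (χ : G →* kˣ) (a : G)

section Finite
variable [Finite G]

/-- A representation by 2 × 2 matrices detects x: g acts by diag(1, χ(g)) and x by a matrix unit of
square zero, which is allowed because ℓ ≥ 2. This is all that is needed from a basis of H_𝒟. -/
theorem x_ne_zero (hχa : χ a ≠ 1) : x χ a ≠ 0 := by
  intro hx
  have hpos := orderOf_pos' χ a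
  have h1 : orderOf (χ a) ≠ 1 := fun h => hχa (orderOf_eq_one_iff.1 h)
  obtain ⟨n, hn⟩ : ∃ n, orderOf (χ a) = n + 2 := ⟨orderOf (χ a) - 2, by omega⟩
  let y : Matrix (Fin 2) (Fin 2) k := !![0, 1; 0, 0]
  have hy : y ^ orderOf (χ a) = 0 := by
    have h2 : y ^ 2 = 0 := by ext i j; fin_cases i <;> fin_cases j <;> simp [y, pow_two]
    rw [hn, pow_add, h2, mul_zero]
  let F : RankOne χ a →ₐ[k] Matrix (Fin 2) (Fin 2) k :=
    lift (fun g => !![1, 0; 0, (χ g : k)]) y (by simp [Matrix.one_fin_two]) (by simp) hy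
      (fun g => by ext i j; fin_cases i <;> fin_cases j <;> simp [y])
  have hF : F (x χ a) = y := lift_x ..
  rw [hx, map_zero] at hF
  have := congrFun (congrFun hF 0) 1
  simp [y] at this

/-- The algebra homomorphism `H_𝒟 → k` that extends a character of `G` and kills `x`. -/
def charHom (γ : G →* kˣ) : RankOne χ a →ₐ[k] k :=
  lift (fun g => (γ g : k)) 0 (by simp) (by simp) (zero_pow (orderOf_pos' χ a).ne') (by simp)

@[simp]
theorem charHom_grp (γ : G →* kˣ) (g : G) : charHom χ a γ (grp χ a g) = γ g := lift_grp ..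

@[simp]
theorem charHom_x (γ : G →* kˣ) : charHom χ a γ (x χ a) = 0 := lift_x ..

/-- The nilpotent x must go to 0 in the field k, so only the values on G remain. -/
theorem exists_eq_charHom (f : RankOne χ a →ₐ[k] k) : ∃ γ : G →* kˣ, f = charHom χ a γ := by
  refine ⟨MonoidHom.toHomUnits ⟨⟨fun g => f (grp χ a g), by rw [grp_one, map_one]⟩,
    fun g h => by simp only [grp_mul, map_mul]⟩, algHom_ext (fun g => ?_) ?_⟩
  · rw [charHom_grp]
    rfl
  · rw [charHom_x]
    have : f (x χ a) ^ orderOf (χ a) = 0 := by rw [← map_pow, x_pow, map_zero]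
    exact pow_eq_zero_iff (orderOf_pos' χ a).ne' |>.1 this

theorem isGroupLikeElem_grp (g : G) : IsGroupLikeElem k (grp χ a g) :=
  ⟨counit_grp χ a g, comul_grp χ a g⟩

/-- The bialgebra endomorphism `g ↦ g`, `x ↦ c x`. -/
def scale (c : k) : RankOne χ a →ₐ[k] RankOne χ a :=
  lift (grp χ a) (c • x χ a) (grp_one χ a) (grp_mul χ a) (by rw [smul_pow, x_pow, smul_zero])
    (fun g => by rw [smul_mul_assoc, x_grp, mul_smul_comm, smul_comm])

@[simp]
theorem scale_grp (c : k) (g : G) : scale χ a c (grp χ a g) = grp χ a g := lift_grp ..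

@[simp]
theorem scale_x (c : k) : scale χ a c (x χ a) = c • x χ a := lift_x ..

theorem scale_one : scale χ a 1 = AlgHom.id k _ := algHom_ext (by simp) (by simp)

/-- `scale` as a homomorphism of bialgebras. -/
def scaleBialgHom (c : k) : RankOne χ a →ₐc[k] RankOne χ a :=
  BialgHom.ofAlgHom (scale χ a c) (algHom_ext (fun g => by simp) (by simp))
    (algHom_ext (fun g => by simp) (by simp [TensorProduct.smul_tmul, smul_add]))

theorem isGroupLikeElem_scale {h : RankOne χ a} (hh : IsGroupLikeElem k h) (c : k) :
    IsGroupLikeElem k (scale χ a c h) :=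
  hh.map (scaleBialgHom χ a c)

/-- Each occurrence of x in a word contributes one factor c. -/
theorem exists_polynomial_scale (h : RankOne χ a) (φ : Module.Dual k (RankOne χ a)) :
    ∃ p : Polynomial k, ∀ c, φ (scale χ a c h) = p.eval c := by
  induction h using induction generalizing φ with
  | hone => exact ⟨Polynomial.C (φ 1), fun c => by simp⟩
  | hadd u v hu hv =>
    obtain ⟨p, hp⟩ := hu φ
    obtain ⟨q, hq⟩ := hv φ
    exact ⟨p + q, fun c => by simp [hp, hq]⟩
  | hsmul r u hu =>
    obtain ⟨p, hp⟩ := hu φ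
    exact ⟨Polynomial.C r * p, fun c => by simp [hp]⟩
  | hgrp g u hu =>
    obtain ⟨p, hp⟩ := hu (φ ∘ₗ LinearMap.mulLeft k (grp χ a g))
    exact ⟨p, fun c => by simpa using hp c⟩
  | hx u hu =>
    obtain ⟨p, hp⟩ := hu (φ ∘ₗ LinearMap.mulLeft k (x χ a))
    exact ⟨Polynomial.X * p, fun c => by simpa using congrArg (c * ·) (hp c)⟩

/-- Distinct group-like elements are linearly independent, and H_𝒟 is finite-dimensional. -/
theorem finite_isGroupLikeElem : {h : RankOne χ a | IsGroupLikeElem k h}.Finite :=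
  (linearIndepOn_isGroupLikeElem (R := k) (A := RankOne χ a)).setFinite

theorem scale_zero_mem (h : RankOne χ a) :
    scale χ a 0 h ∈ Submodule.span k (Set.range (grp χ a)) := by
  induction h using induction with
  | hone => rw [map_one, ← grp_one]; exact Submodule.subset_span ⟨1, rfl⟩
  | hadd u v hu hv => rw [map_add]; exact add_mem hu hv
  | hsmul r u hu => rw [map_smul]; exact Submodule.smul_mem _ _ hu
  | hgrp g u hu =>
    rw [map_mul, scale_grp]
    generalize scale χ a 0 u = w at hu
    induction hu using Submodule.span_induction with
    | mem v hv =>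
      obtain ⟨b, rfl⟩ := hv
      rw [← grp_mul]
      exact Submodule.subset_span ⟨_, rfl⟩
    | zero => rw [mul_zero]; exact zero_mem _
    | add v w _ _ hv hw => rw [mul_add]; exact add_mem hv hw
    | smul c v _ hv => rw [mul_smul_comm]; exact Submodule.smul_mem _ _ hv
  | hx u hu => rw [map_mul, scale_x, zero_smul, zero_mul]; exact zero_mem _

/-- The orbit of h under the scalings stays in the finite set of group-like elements but depends
polynomially on c. Over an infinite field it is therefore constant, and its values at c = 1 and c =
0 agree. -/
theorem scale_zero_eq_self [Infinite k] {h : RankOne χ a} (hh : IsGroupLikeElem k h) :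
    scale χ a 0 h = h := by
  have : Finite {h : RankOne χ a | IsGroupLikeElem k h} := finite_isGroupLikeElem χ a
  -- By the pigeonhole principle one group-like element w is attained for infinitely many c.
  obtain ⟨⟨w, _⟩, hw⟩ := Finite.exists_infinite_fiber
    (fun c : k => (⟨scale χ a c h, isGroupLikeElem_scale χ a hh c⟩ :
      {h : RankOne χ a | IsGroupLikeElem k h}))
  have key : ∀ c, scale χ a c h = w := by
    intro c
    rw [← sub_eq_zero, ← Module.forall_dual_apply_eq_zero_iff k]
    intro φ
    rw [map_sub, sub_eq_zero]
    obtain ⟨p, hp⟩ := exists_polynomial_scale χ a h φ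
    have hp' : p = Polynomial.C (φ w) := by
      refine Polynomial.eq_of_infinite_eval_eq _ _ (Set.Infinite.mono ?_ (Set.infinite_coe_iff.1 hw))
      intro d hd
      have : scale χ a d h = w := congrArg Subtype.val hd
      rw [Set.mem_ofPred_eq, ← hp, this, Polynomial.eval_C]
    rw [hp, hp', Polynomial.eval_C]
  rw [key 0, ← key 1, scale_one]
  rfl

/-- The group-like elements of `H_𝒟` are the elements of `G`. -/
theorem exists_eq_grp [Infinite k] {h : RankOne χ a} (hh : IsGroupLikeElem k h) :
    ∃ g, h = grp χ a g := by
  by_contra hne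
  have hmem : h ∈ Submodule.span k (Set.range (grp χ a)) := by
    rw [← scale_zero_eq_self χ a hh]
    exact scale_zero_mem χ a h
  -- A group-like element outside G would be linearly independent of G, yet h lies in the span of G
  -- because killing x fixes it.
  refine LinearIndepOn.notMem_span_of_insert (R := k) (v := id) (s := Set.range (grp χ a)) (i := h)
    ((linearIndepOn_isGroupLikeElem (R := k) (A := RankOne χ a)).mono ?_) ?_ (by simpa using hmem)
  · rintro _ (rfl | ⟨g, rfl⟩)
    exacts [hh, isGroupLikeElem_grp χ a g]
  · rintro ⟨g, rfl⟩
    exact hne ⟨g, rfl⟩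

end Finite
end RankOne

universe w w'

attribute [local instance] ModuleCat.moduleOfAlgebraModule
  ModuleCat.isScalarTower_of_algebra_moduleCat

/-! ### Twisting by characters of a bialgebra. -/

section CharTwist

variable {k : Type*} {A : Type*} [Field k] [Ring A] [Bialgebra k A]

/-- The algebra endomorphism `b ↦ ∑ α(b₂) b₁` attached to an algebra homomorphism `α`. -/
def charTwist (α : A →ₐ[k] k) : A →ₐ[k] A :=
  (Algebra.TensorProduct.rid k k A).toAlgHom.comp
    ((Algebra.TensorProduct.map (AlgHom.id k A) α).comp (Bialgebra.comulAlgHom k A))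

theorem charTwist_apply' (α : A →ₐ[k] k) (b : A) : charTwist α b =
    TensorProduct.rid k A (α.toLinearMap.lTensor A (comul (R := k) b)) := rfl

theorem charTwist_apply (α : A →ₐ[k] k) (b : A) :
    charTwist α b = ∑ i ∈ (ℛ k b).index, α ((ℛ k b).right i) • (ℛ k b).left i := by
  rw [charTwist_apply']
  conv_lhs => rw [← (ℛ k b).eq]
  simp

/-- This eigenvalue records how tensoring with a one-dimensional module changes the action of the
group-like elements. -/
theorem charTwist_of_isGroupLikeElem (α : A →ₐ[k] k) {z : A} (hz : IsGroupLikeElem k z) :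
    charTwist α z = α z • z := by
  rw [charTwist_apply', hz.comul_eq_tmul_self]
  simp

variable {U V : Type*} [AddCommGroup U] [Module k U] [Module A U] [IsScalarTower k A U]
  [AddCommGroup V] [Module k V] [Module A V] [IsScalarTower k A V]

theorem tensorAction_tmul_of_char {α : A →ₐ[k] k} {v : V} (hv : ∀ b : A, b • v = α b • v) (b : A)
    (u : U) : tensorAction k A U V b (u ⊗ₜ[k] v) = (charTwist α b • u) ⊗ₜ[k] v := by
  rw [tensorAction_tmul, charTwist_apply, Finset.sum_smul, TensorProduct.sum_tmul]
  refine Finset.sum_congr rfl fun i _ => ?_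
  rw [hv, TensorProduct.tmul_smul, smul_assoc, TensorProduct.smul_tmul']

theorem exists_char_of_finrank_eq_one (hV : Module.finrank k V = 1) :
    ∃ α : A →ₐ[k] k, ∀ (b : A) (v : V), b • v = α b • v := by
  have h : ∀ b : A, ∃ c : k, ∀ v : V, b • v = c • v := fun b => by
    obtain ⟨c, hc, -⟩ := (Algebra.lsmul k k V b).existsUnique_eq_smul_id_of_finrank_eq_one hV
    exact ⟨c, fun v => LinearMap.congr_fun hc v⟩
  choose f hf using h
  obtain ⟨v, hv, -⟩ := finrank_eq_one_iff'.1 hV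
  have inj : ∀ {c d : k}, c • v = d • v → c = d := fun {c d} h => smul_left_injective k hv h
  exact ⟨{ toFun := f
           map_one' := inj (by rw [← hf, one_smul, one_smul])
           map_mul' := fun b c => inj (by rw [← hf, mul_smul, hf c, hf b, smul_smul])
           map_zero' := inj (by rw [← hf, zero_smul, zero_smul])
           map_add' := fun b c => inj (by rw [← hf, add_smul, add_smul, hf, hf])
           commutes' := fun c => inj (by rw [← hf, algebraMap_smul]; rfl) }, hf⟩

end CharTwist

/-! ### The map Φ for an arbitrary bialgebra. -/

section Modules

/-- The identity map is a bijective semilinear map over a surjective ring homomorphism, so the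
submodules are the same on both sides. -/
theorem isSimpleModule_restrictScalars_iff {R S : Type*} [Ring R] [Ring S] {f : R →+* S}
    (hf : Function.Surjective f) (M : ModuleCat.{w} S) :
    IsSimpleModule R ((ModuleCat.restrictScalars f).obj M) ↔ IsSimpleModule S M := by
  have : RingHomSurjective f := ⟨hf⟩
  let l : (ModuleCat.restrictScalars f).obj M →ₛₗ[f] M :=
    { toFun := fun m => m, map_add' := fun _ _ => rfl, map_smul' := fun _ _ => rfl }
  exact l.isSimpleModule_iff_of_bijective Function.bijective_id

theorem nonempty_linearEquiv_of_restrictScalars {R S : Type*} [Ring R] [Ring S] {f : R →+* S}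
    (hf : Function.Surjective f) {M N : ModuleCat.{w} S}
    (e : (ModuleCat.restrictScalars f).obj M ≃ₗ[R] (ModuleCat.restrictScalars f).obj N) :
    Nonempty (M ≃ₗ[S] N) := by
  refine ⟨{ (e.toAddEquiv : M ≃+ N) with map_smul' := fun s m => ?_ }⟩
  obtain ⟨r, rfl⟩ := hf s
  exact e.map_smul r m

theorem isoClass_mk_eq_iff {A : Type*} [Ring A] {M N : ModuleCat.{w} A} :
    IsoClass.mk M = IsoClass.mk N ↔ Nonempty (M ≃ₗ[A] N) :=
  Quotient.eq (r := isoSetoid A)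

variable {k : Type u} {A : Type*} [Field k] [Ring A] [Bialgebra k A]

/-- Tensoring with a one-dimensional module amounts to twisting the action. -/
theorem nonempty_tensorObj_equiv (U V : ModuleCat.{w} A) (hV : Module.finrank k V = 1)
    {α : A →ₐ[k] k} (hα : ∀ (b : A) (v : V), b • v = α b • v) :
    Nonempty (tensorObj k A U V ≃ₗ[A]
      (ModuleCat.restrictScalars (charTwist α : A →+* A)).obj U) := by
  obtain ⟨e⟩ := Module.nonempty_linearEquiv_of_finrank_eq_one hV
  -- The map m ↦ m ⊗ v for a basis vector v of V; moving b₂ through v turns the action of b into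
  -- that of its twist.
  let E : U ≃ₗ[k] U ⊗[k] V := (TensorProduct.rid k U).symm ≪≫ₗ TensorProduct.congr (.refl k U) e
  have hE : ∀ (b : A) (m : U), E (charTwist α b • m) = tensorAction k A U V b (E m) := fun b m =>
    (tensorAction_tmul_of_char (fun b => hα b (e 1)) b m).symm
  exact ⟨LinearEquiv.symm { (E.toAddEquiv : _ ≃+ _) with map_smul' := hE }⟩

/-- The one-dimensional module attached to an algebra homomorphism `α`. -/
def oneDim (α : A →ₐ[k] k) : ModuleCat.{max u w'} A :=
  (ModuleCat.restrictScalars (α : A →+* k)).obj (ModuleCat.of k (ULift.{w'} k))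

theorem oneDim_smul (α : A →ₐ[k] k) (b : A) (v : oneDim.{u, w'} α) : b • v = α b • v := by
  let x : ULift.{w'} k := v
  -- The scalar structure on a module object comes from `algebraMap k A`, so a scalar acts through α
  -- applied to its image in A.
  change α b • x = α (algebraMap k A (α b)) • x
  rw [AlgHom.commutes]
  rfl

theorem finrank_oneDim (α : A →ₐ[k] k) : Module.finrank k (oneDim.{u, w'} α) = 1 := by
  refine finrank_eq_one (ULift.up 1 : ULift.{w'} k) (fun h => one_ne_zero (congrArg ULift.down h))
    fun v => ⟨ULift.down v, ?_⟩
  change α (algebraMap k A (ULift.down v)) • (ULift.up 1 : ULift.{w'} k) = v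
  rw [AlgHom.commutes]
  exact ULift.ext _ _ (mul_one _)

theorem nonempty_equiv_oneDim (V : ModuleCat.{max u w'} A) (hV : Module.finrank k V = 1)
    {α : A →ₐ[k] k} (hα : ∀ (b : A) (v : V), b • v = α b • v) :
    Nonempty (V ≃ₗ[A] oneDim.{u, w'} α) := by
  obtain ⟨e⟩ := Module.nonempty_linearEquiv_of_finrank_eq_one hV
  obtain ⟨f⟩ := Module.nonempty_linearEquiv_of_finrank_eq_one (finrank_oneDim.{u, w'} α)
  let E : V ≃ₗ[k] oneDim.{u, w'} α := e.symm ≪≫ₗ f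
  exact ⟨{ E.toAddEquiv with
    map_smul' := fun b v => ((congrArg E (hα b v)).trans (map_smul E _ _)).trans
      (oneDim_smul α b (E v)).symm }⟩

/-- The difference z - 1 lies in the span of the central group-like elements and has counit zero, so
it vanishes in the quotient. -/
theorem smul_inflate (U : ModuleCat.{w} (CentralQuotient k A)) {z : A}
    (hz : z ∈ centralGroupLike k A) (m : inflate k A U) : z • m = m := by
  have h : z - 1 ∈ centralIdeal k A := by
    refine Ideal.subset_span ⟨sub_mem (Submodule.subset_span hz)
      (Submodule.subset_span ⟨.one, Set.one_mem_center⟩), ?_⟩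
    rw [map_sub, hz.1.counit_eq_one, Bialgebra.counit_one, sub_self]
  have h1 : Ideal.Quotient.mk (centralIdeal k A) z = 1 := by
    rw [← map_one (Ideal.Quotient.mk (centralIdeal k A)), Ideal.Quotient.eq]
    exact h
  let x : U := m
  change Ideal.Quotient.mk (centralIdeal k A) z • x = x
  rw [h1, one_smul]

/-- A module on which the central group-like elements act trivially is a module over the quotient. -/
theorem exists_inflate (M : ModuleCat.{w} A)
    (hM : ∀ z ∈ centralGroupLike k A, ∀ m : M, z • m = m) :
    ∃ U : ModuleCat.{w} (CentralQuotient k A), Nonempty (inflate k A U ≃ₗ[A] M) := by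
  -- By linearity the span L of the central group-like elements acts through ε. Hence L⁺, and the
  -- left ideal it generates, annihilate M.
  have h1 : ∀ z ∈ centralSpan k A, ∀ m : M, z • m = counit (R := k) z • m := by
    intro z hz m
    induction hz using Submodule.span_induction with
    | mem z hz => rw [hM z hz, hz.1.counit_eq_one, one_smul]
    | zero => simp
    | add y z _ _ hy hz => rw [add_smul, hy, hz, map_add, add_smul]
    | smul c z _ hz => rw [smul_assoc, hz, map_smul, smul_assoc]
  have h2 : ∀ z ∈ centralIdeal k A, ∀ m : M, z • m = 0 := by
    intro z hz m
    induction hz using Submodule.span_induction with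
    | mem z hz => rw [h1 z hz.1, hz.2, zero_smul]
    | zero => exact zero_smul _ _
    | add y z _ _ hy hz => rw [add_smul, hy, hz, add_zero]
    | smul c z _ hz => rw [smul_eq_mul, mul_smul, hz, smul_zero]
  let ρ : CentralQuotient k A →+* AddMonoid.End M :=
    Ideal.Quotient.lift (centralIdeal k A) (Module.toAddMonoidEnd A M)
      fun z hz => AddMonoidHom.ext (h2 z hz)
  let inst : Module (CentralQuotient k A) M := Module.compHom M ρ
  exact ⟨ModuleCat.of (CentralQuotient k A) M, ⟨{ AddEquiv.refl M with map_smul' := fun _ _ => rfl }⟩⟩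

/-- The map `Φ` sends pairs of a simple class and a one-dimensional class to simple classes as soon
as all twists by characters are surjective. -/
theorem mapsTo_tensorMap
    (hσ : ∀ α : A →ₐ[k] k, Function.Surjective (charTwist α)) :
    Set.MapsTo (tensorMap.{w} k A) (simpleClasses (CentralQuotient k A) ×ˢ oneDimClasses A k)
      (simpleClasses A) := by
  rintro ⟨_, _⟩ ⟨⟨U, hU, rfl⟩, V, hV, rfl⟩
  obtain ⟨α, hα⟩ := exists_char_of_finrank_eq_one (A := A) (V := V) hV
  obtain ⟨e⟩ := nonempty_tensorObj_equiv (inflate k A U) V hV hα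
  refine ⟨_, ?_, (tensorMap_mk k A U V).symm⟩
  rw [e.isSimpleModule_iff]
  exact (isSimpleModule_restrictScalars_iff (hσ α) _).2
    ((isSimpleModule_restrictScalars_iff Ideal.Quotient.mk_surjective U).2 hU)

theorem mk_oneDim_mem (α : A →ₐ[k] k) :
    IsoClass.mk (oneDim.{u, w'} α) ∈ oneDimClasses A k := ⟨_, finrank_oneDim α, rfl⟩

theorem eq_of_oneDim_equiv {α β : A →ₐ[k] k} (e : oneDim.{u, w'} α ≃ₗ[A] oneDim.{u, w'} β) :
    α = β := by
  obtain ⟨v, hv, -⟩ := finrank_eq_one_iff'.1 (finrank_oneDim.{u, w'} α)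
  ext b
  have h1 : b • e v = α b • e v := by
    rw [← map_smul, oneDim_smul]
    exact map_smul (e.restrictScalars k) _ _
  rw [oneDim_smul] at h1
  exact (smul_left_injective k (fun h => hv (e.map_eq_zero_iff.1 h)) h1).symm

/-- By the counit axiom, tensoring on the right with the trivial module changes nothing. The other
counit axiom gives `counit_comp_charTwist`, the same for the trivial module on the left. -/
theorem charTwist_counit : charTwist (Bialgebra.counitAlgHom k A) = AlgHom.id k A := by
  ext b
  rw [charTwist_apply']
  exact congrArg (TensorProduct.rid k A) (LinearMap.congr_fun lTensor_counit_comp_comul b)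
    |>.trans (by simp)

theorem comp_charTwist (α β : A →ₐ[k] k) (b : A) : α (charTwist β b) =
    ∑ i ∈ (ℛ k b).index, α ((ℛ k b).left i) * β ((ℛ k b).right i) := by
  rw [charTwist_apply, map_sum]
  exact Finset.sum_congr rfl fun i _ => by rw [map_smul, smul_eq_mul, mul_comm]

theorem counit_comp_charTwist (β : A →ₐ[k] k) (b : A) :
    Bialgebra.counitAlgHom k A (charTwist β b) = β b := by
  rw [comp_charTwist]
  conv_rhs => rw [← sum_counit_smul (ℛ k b), map_sum]
  simp

/-- If `Φ` is injective, no nontrivial character of `A` is trivial on the central group-like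
elements. -/
theorem eq_counit_of_injOn
    (hinj : Set.InjOn (tensorMap.{max u w'} k A)
      (simpleClasses (CentralQuotient k A) ×ˢ oneDimClasses A k))
    {α : A →ₐ[k] k} (hα : ∀ z ∈ centralGroupLike k A, α z = 1) :
    α = Bialgebra.counitAlgHom k A := by
  set ε := Bialgebra.counitAlgHom k A with hε
  -- Triviality on the central group-like elements lets the one-dimensional module of β descend to
  -- the quotient, where it is simple.
  have hex : ∀ β : A →ₐ[k] k, (∀ z ∈ centralGroupLike k A, β z = 1) →
      ∃ U : ModuleCat.{max u w'} (CentralQuotient k A), IsSimpleModule (CentralQuotient k A) U ∧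
        Nonempty (inflate k A U ≃ₗ[A] oneDim.{u, w'} β) := by
    intro β hβ
    obtain ⟨U, ⟨e⟩⟩ := exists_inflate (oneDim.{u, w'} β) fun z hz m => by
      rw [oneDim_smul, hβ z hz, one_smul]
    refine ⟨U, ?_, ⟨e⟩⟩
    refine (isSimpleModule_restrictScalars_iff Ideal.Quotient.mk_surjective U).1 ?_
    refine e.isSimpleModule_iff.2 ?_
    exact (isSimpleModule_iff _ _).2 (is_simple_module_of_finrank_eq_one (finrank_oneDim β))
  obtain ⟨U, hU, ⟨e⟩⟩ := hex α hα
  obtain ⟨W, hW, ⟨f⟩⟩ := hex ε fun z hz => hz.1.counit_eq_one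
  -- The tensor product of the lines with characters β and γ is the line whose character is their
  -- convolution product, here δ.
  have key : ∀ (U : ModuleCat.{max u w'} (CentralQuotient k A)) (β γ δ : A →ₐ[k] k),
      (inflate k A U ≃ₗ[A] oneDim.{u, w'} β) → (∀ b, β (charTwist γ b) = δ b) →
      tensorMap k A (IsoClass.mk U, IsoClass.mk (oneDim.{u, w'} γ)) =
        IsoClass.mk (oneDim.{u, w'} δ) := by
    intro U β γ δ e h
    rw [tensorMap_mk, isoClass_mk_eq_iff]
    obtain ⟨e1⟩ := nonempty_tensorObj_equiv (inflate k A U) (oneDim.{u, w'} γ) (finrank_oneDim γ)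
      (oneDim_smul γ)
    refine ⟨e1.trans { e.toAddEquiv with map_smul' := fun b m => ?_ }⟩
    refine (e.map_smul (charTwist γ b) m).trans ?_
    let x : ULift.{w'} k := e m
    change β (charTwist γ b) • x = δ b • x
    rw [h]
  -- Both k_α ⊗ k_ε and k_ε ⊗ k_α are k_α. Injectivity identifies the second factors k_ε and k_α.
  have h1 := key U α ε α e fun b => by rw [hε, charTwist_counit]; rfl
  have h2 := key W ε α α f fun b => counit_comp_charTwist α b
  have h3 := hinj ⟨⟨U, hU, rfl⟩, mk_oneDim_mem ε⟩ ⟨⟨W, hW, rfl⟩, mk_oneDim_mem α⟩ (h1.trans h2.symm)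
  obtain ⟨e3⟩ := isoClass_mk_eq_iff.1 (Prod.mk.inj h3).2
  exact (eq_of_oneDim_equiv e3).symm

/-- If characters of `A` are determined by their values on the central group-like elements, then
`Φ` is injective. -/
theorem injOn_tensorMap (hσ : ∀ α : A →ₐ[k] k, Function.Surjective (charTwist α))
    (h : ∀ α β : A →ₐ[k] k, (∀ z ∈ centralGroupLike k A, α z = β z) → α = β) :
    Set.InjOn (tensorMap.{max u w'} k A)
      (simpleClasses (CentralQuotient k A) ×ˢ oneDimClasses A k) := by
  rintro ⟨_, _⟩ ⟨⟨U, hU, rfl⟩, V, hV, rfl⟩ ⟨_, _⟩ ⟨⟨U', hU', rfl⟩, V', hV', rfl⟩ heq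
  obtain ⟨α, hα⟩ := exists_char_of_finrank_eq_one (A := A) (V := V) hV
  obtain ⟨β, hβ⟩ := exists_char_of_finrank_eq_one (A := A) (V := V') hV'
  obtain ⟨e⟩ := nonempty_tensorObj_equiv (inflate k A U) V hV hα
  obtain ⟨e'⟩ := nonempty_tensorObj_equiv (inflate k A U') V' hV' hβ
  rw [tensorMap_mk, tensorMap_mk, isoClass_mk_eq_iff] at heq
  obtain ⟨f⟩ := heq
  have F := (e.symm.trans f).trans e'
  -- A central group-like z is trivial on W, so on the twist of W by γ it acts by the scalar γ(z).
  -- An isomorphism of twists thus forces the two characters to agree on these elements.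
  have hact : ∀ (W : ModuleCat.{max u w'} (CentralQuotient k A)) (γ : A →ₐ[k] k),
      ∀ z ∈ centralGroupLike k A,
      ∀ m : (ModuleCat.restrictScalars (charTwist γ : A →+* A)).obj (inflate k A W),
      z • m = algebraMap k A (γ z) • m := by
    intro W γ z hz m
    let x : inflate k A W := m
    change charTwist γ z • x = charTwist γ (algebraMap k A (γ z)) • x
    rw [charTwist_of_isGroupLikeElem γ hz.1, AlgHom.commutes, smul_assoc, smul_inflate W hz,
      algebraMap_smul]
  have hαβ : α = β := by
    refine h α β fun z hz => ?_
    have : Nontrivial U := IsSimpleModule.nontrivial (CentralQuotient k A) U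
    obtain ⟨m, hm⟩ := exists_ne (0 : U)
    let x : (ModuleCat.restrictScalars (charTwist α : A →+* A)).obj (inflate k A U) := m
    have h1 : algebraMap k A (α z) • F x = algebraMap k A (β z) • F x := by
      rw [← hact U' β z hz (F x), ← map_smul, ← map_smul, hact U α z hz x]
    rw [algebraMap_smul, algebraMap_smul] at h1
    exact smul_left_injective k (fun h0 => hm (F.map_eq_zero_iff.1 h0)) h1
  subst hαβ
  -- Once the characters coincide, surjectivity of the twist, and then of the quotient map, makes
  -- the isomorphism linear over the quotient.
  obtain ⟨F1⟩ := nonempty_linearEquiv_of_restrictScalars (hσ α) F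
  obtain ⟨F2⟩ := nonempty_linearEquiv_of_restrictScalars Ideal.Quotient.mk_surjective F1
  obtain ⟨F3⟩ := nonempty_equiv_oneDim V hV hα
  obtain ⟨F4⟩ := nonempty_equiv_oneDim V' hV' hβ
  rw [Prod.mk.injEq, isoClass_mk_eq_iff, isoClass_mk_eq_iff]
  exact ⟨⟨F2⟩, ⟨F3.trans F4.symm⟩⟩

/-- If the central group-like elements act on every simple module through a character of `A`, then
`Φ` is surjective. -/
theorem surjOn_tensorMap
    (hσ : ∀ α : A →ₐ[k] k, ∃ β : A →ₐ[k] k, (charTwist β).comp (charTwist α) = AlgHom.id k A ∧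
      (charTwist α).comp (charTwist β) = AlgHom.id k A)
    (h : ∀ M : ModuleCat.{max u w'} A, IsSimpleModule A M →
      ∃ α : A →ₐ[k] k, ∀ z ∈ centralGroupLike k A, ∀ m : M, z • m = α z • m) :
    Set.SurjOn (tensorMap.{max u w'} k A)
      (simpleClasses (CentralQuotient k A) ×ˢ oneDimClasses A k) (simpleClasses A) := by
  rintro _ ⟨M, hM, rfl⟩
  obtain ⟨α, hα⟩ := h M hM
  obtain ⟨β, hβ, hβ'⟩ := hσ α
  have hsurj : Function.Surjective (charTwist β) := fun b => ⟨charTwist α b, DFunLike.congr_fun hβ b⟩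
  -- Untwisting M by the inverse of α cancels the scalars α(z), so N descends to the quotient;
  -- tensoring with the line of α restores M.
  let N : ModuleCat.{max u w'} A := (ModuleCat.restrictScalars (charTwist β : A →+* A)).obj M
  have hN : IsSimpleModule A N := (isSimpleModule_restrictScalars_iff hsurj M).2 hM
  obtain ⟨U, ⟨e⟩⟩ := exists_inflate (k := k) N (by
    intro z hz m
    let x : M := m
    change charTwist β z • x = x
    have h1 := DFunLike.congr_fun hβ' z
    rw [AlgHom.comp_apply, charTwist_of_isGroupLikeElem β hz.1, map_smul,
      charTwist_of_isGroupLikeElem α hz.1, AlgHom.id_apply, smul_smul] at h1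
    rw [charTwist_of_isGroupLikeElem β hz.1, smul_assoc, hα z hz, smul_smul]
    -- Composing the two inverse twists gives z back multiplied by β(z)α(z); the counit, which is 1
    -- on z, reads off the factor.
    have h2 : β z * α z = 1 := by
      have := congrArg (counit (R := k)) h1
      rwa [map_smul, hz.1.counit_eq_one, smul_eq_mul, mul_one] at this
    rw [h2, one_smul])
  refine ⟨(IsoClass.mk U, IsoClass.mk (oneDim α)), ⟨⟨U, ?_, rfl⟩, mk_oneDim_mem α⟩, ?_⟩
  · exact (isSimpleModule_restrictScalars_iff Ideal.Quotient.mk_surjective U).1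
      (e.isSimpleModule_iff.2 hN)
  · rw [tensorMap_mk, isoClass_mk_eq_iff]
    obtain ⟨f⟩ := nonempty_tensorObj_equiv (inflate k A U) (oneDim.{u, w'} α) (finrank_oneDim α)
      (oneDim_smul α)
    refine ⟨f.trans { e.toAddEquiv with map_smul' := fun b m => ?_ }⟩
    refine (e.map_smul (charTwist α b) m).trans ?_
    let x : M := e m
    change charTwist β (charTwist α b) • x = b • x
    rw [← AlgHom.comp_apply, hβ, AlgHom.id_apply]

end Modules

/-! ### Group-like elements of H^* and of the double. -/

section General

variable {k H : Type*} [Field k] [Ring H] [HopfAlgebra k H] [BijectiveAntipode k H]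

/-- An algebra homomorphism `H → k` as an element of `H^*`. -/
def dualOfHom (γ : H →ₐ[k] k) : ConvDual k H := toConv γ.toLinearMap

@[simp]
theorem dualOfHom_apply (γ : H →ₐ[k] k) (b : H) : (dualOfHom γ).ofConv b = γ b := rfl

/-- Right convolution by a character is the transpose of the twist; `dualOfHom_mul_apply` is the
left-handed version. Together they turn commutation in H^* into identities in H. -/
theorem mul_dualOfHom_apply (f : ConvDual k H) (γ : H →ₐ[k] k) (b : H) :
    (f * dualOfHom γ).ofConv b = f.ofConv (charTwist γ b) := by
  rw [convDual_mul_apply, charTwist_apply, map_sum]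
  exact Finset.sum_congr rfl fun i _ => by rw [map_smul, smul_eq_mul, mul_comm, dualOfHom_apply]

/-- The algebra endomorphism `b ↦ ∑ γ(b₁) b₂`. -/
def leftCharTwist (γ : H →ₐ[k] k) : H →ₐ[k] H :=
  (Algebra.TensorProduct.lid k H).toAlgHom.comp
    ((Algebra.TensorProduct.map γ (AlgHom.id k H)).comp (Bialgebra.comulAlgHom k H))

theorem leftCharTwist_apply (γ : H →ₐ[k] k) (b : H) : leftCharTwist γ b =
    TensorProduct.lid k H (γ.toLinearMap.rTensor H (comul (R := k) b)) := rfl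

theorem dualOfHom_mul_apply (f : ConvDual k H) (γ : H →ₐ[k] k) (b : H) :
    (dualOfHom γ * f).ofConv b = f.ofConv (leftCharTwist γ b) := by
  rw [convDual_mul_apply, leftCharTwist_apply]
  conv_rhs => rw [← (ℛ k b).eq]
  simp

/-- An element at which evaluation is multiplicative on `H^*` is group-like. -/
theorem isGroupLikeElem_of_forall_dual [Module.Finite k H] {h : H}
    (h1 : (1 : ConvDual k H).ofConv h = 1)
    (hm : ∀ f g : ConvDual k H, (f * g).ofConv h = f.ofConv h * g.ofConv h) :
    IsGroupLikeElem k h := by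
  refine ⟨by simpa using h1, ?_⟩
  rw [← sub_eq_zero, ← Module.forall_dual_apply_eq_zero_iff k]
  intro φ
  -- In finite dimension the functionals f ⊗ g span the dual of H ⊗ H, and on them the claim is
  -- multiplicativity of the evaluation at h.
  obtain ⟨t, rfl⟩ := (TensorProduct.dualDistribEquiv k H H).surjective φ
  rw [map_sub, sub_eq_zero]
  induction t with
  | zero => simp
  | add x y hx hy => simp only [map_add, LinearMap.add_apply, hx, hy]
  | tmul f g =>
    have h2 := hm (toConv f) (toConv g)
    rw [convDual_eq] at h2
    have h3 : ∀ t : H ⊗[k] H, TensorProduct.dualDistribEquiv k H H (f ⊗ₜ g) t =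
        LinearMap.mul' k k (TensorProduct.map f g t) := by
      intro t
      induction t with
      | zero => simp
      | add x y hx hy => simp only [map_add, hx, hy]
      | tmul x y => rfl
    rw [h3, h3]
    exact h2

variable [Module.Finite k H]

theorem isGroupLikeElem_dualOfHom (γ : H →ₐ[k] k) : IsGroupLikeElem k (dualOfHom γ) := by
  refine ⟨by rw [coop_counit, dualOfHom_apply, map_one], eval₂_ext fun b c => ?_⟩
  rw [eval₂_comul, eval₂_tmul, dualOfHom_apply, map_mul, mul_comm]
  rfl

/-- Pairing the coproduct of f with b ⊗ c gives f(cb), and commutativity of k makes the reversed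
order harmless: f is multiplicative. -/
theorem exists_eq_dualOfHom {f : ConvDual k H} (hf : IsGroupLikeElem k f) :
    ∃ γ : H →ₐ[k] k, f = dualOfHom γ := by
  refine ⟨AlgHom.ofLinearMap f.ofConv ?_ fun b c => ?_, rfl⟩
  · rw [← coop_counit, hf.counit_eq_one]
  · rw [← eval₂_comul, hf.comul_eq_tmul_self, eval₂_tmul, mul_comm]

/-- Because the coproduct on H^* is the co-opposite one, evaluating its second leg at h inserts h on
the left of the argument. -/
theorem rid_lTensor_comul (f : ConvDual k H) (h : H) :
    TensorProduct.rid k (ConvDual k H) ((Module.Dual.eval k H h ∘ₗ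
      (WithConv.linearEquiv k (Module.Dual k H)).toLinearMap).lTensor _ (comul (R := k) f)) =
      rightHit h f := by
  ext c
  rw [rightHit_apply, ← eval₂_comul]
  generalize comul (R := k) f = s
  induction s with
  | zero => simp
  | add x y hx hy => simp only [map_add, ofConv_add, LinearMap.add_apply, hx, hy]
  | tmul f g => simp [mul_comm]

namespace Double

theorem ofHopf_one : (ofHopf 1 : Double k H) = 1 := rfl

theorem ofHopf_map_mul (b c : H) : (ofHopf (b * c) : Double k H) = ofHopf b * ofHopf c := by
  rw [ofHopf_mul]
  exact (leftMul_one_tmul b c).symm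

theorem ofDual_map_mul (f g : ConvDual k H) : (ofDual (f * g) : Double k H) = ofDual f * ofDual g := by
  rw [ofDual_mul]
  rfl

theorem ofDual_mul_mk (f g : ConvDual k H) (b : H) : ofDual f * mk g b = mk (f * g) b := by
  rw [ofDual_mul]
  rfl

theorem mk_mul_ofHopf (f : ConvDual k H) (b c : H) : mk f b * ofHopf c = mk f (b * c) := by
  rw [mk_eq, mul_assoc, ← ofHopf_map_mul, ← mk_eq]

theorem comul_mk (f : ConvDual k H) (b : H) : comul (R := k) (mk f b) =
    TensorProduct.tensorTensorTensorComm k _ _ _ _ (comul (R := k) f ⊗ₜ[k] comul (R := k) b) := rfl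

theorem counit_mk (f : ConvDual k H) (b : H) :
    counit (R := k) (mk f b) = f.ofConv 1 * counit (R := k) b :=
  (TensorProduct.counit_tmul (S := k) (R := k) f b).trans (mul_comm _ _)

theorem isGroupLikeElem_mk {f : ConvDual k H} {b : H} (hf : IsGroupLikeElem k f)
    (hb : IsGroupLikeElem k b) : IsGroupLikeElem k (mk f b) := by
  refine ⟨?_, ?_⟩
  · rw [counit_mk, hb.counit_eq_one, ← coop_counit, hf.counit_eq_one, mul_one]
  · rw [comul_mk, hf.comul_eq_tmul_self, hb.comul_eq_tmul_self]
    rfl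

/-- The projection `f ⊗ b ↦ ε(b) f`. -/
def toDual : Double k H →ₗc[k] ConvDual k H :=
  (Coalgebra.TensorProduct.rid k k (ConvDual k H) : _ →ₗc[k] _).comp
    (Coalgebra.TensorProduct.map (CoalgHom.id k (ConvDual k H)) (counitCoalgHom k H))

/-- The projection `f ⊗ b ↦ f(1) b`. -/
def toHopf : Double k H →ₗc[k] H :=
  (Coalgebra.TensorProduct.lid k H : _ →ₗc[k] _).comp
    (Coalgebra.TensorProduct.map (counitCoalgHom k (ConvDual k H)) (CoalgHom.id k H))

theorem toDual_mk (f : ConvDual k H) (b : H) : toDual (mk f b) = counit (R := k) b • f := rfl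

theorem toHopf_mk (f : ConvDual k H) (b : H) : toHopf (mk f b) = f.ofConv 1 • b := rfl

/-- This is the counit axiom in both tensor factors, valid for any tensor product of coalgebras.
Both projections being coalgebra maps, it splits every group-like element as a tensor of group-like
elements. -/
theorem map_toDual_toHopf_comul (z : Double k H) :
    @Eq (Double k H) (TensorProduct.map (toDual (k := k) (H := H)).toLinearMap
      (toHopf (k := k) (H := H)).toLinearMap (comul (R := k) z)) z := by
  induction z using induction with
  | zero => rw [map_zero, map_zero]; rfl
  | add u v hu hv =>
    rw [map_add, map_add]
    exact congrArg₂ (fun x y : Double k H => x + y) hu hv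
  | tmul f b =>
    -- The identity is proved for arbitrary tensors s and t, so that induction applies to each
    -- coproduct separately.
    have key : ∀ (P : ConvDual k H ⊗[k] H →ₗ[k] ConvDual k H) (Q : ConvDual k H ⊗[k] H →ₗ[k] H)
        (_ : ∀ f b, P (f ⊗ₜ[k] b) = counit (R := k) b • f)
        (_ : ∀ f b, Q (f ⊗ₜ[k] b) = f.ofConv 1 • b)
        (s : ConvDual k H ⊗[k] ConvDual k H) (t : H ⊗[k] H), TensorProduct.map P Q
          (TensorProduct.tensorTensorTensorComm k _ _ _ _ (s ⊗ₜ[k] t)) =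
        TensorProduct.rid k _ (counit.lTensor _ s) ⊗ₜ[k] TensorProduct.lid k _ (counit.rTensor _ t) := by
      intro P Q hP hQ s t
      induction s with
      | zero => simp
      | add x y hx hy => simp only [map_add, TensorProduct.add_tmul, hx, hy]
      | tmul p q =>
        induction t with
        | zero => simp
        | add x y hx hy => simp only [map_add, TensorProduct.tmul_add, hx, hy]
        | tmul c d =>
          rw [TensorProduct.tensorTensorTensorComm_tmul, TensorProduct.map_tmul, hP, hQ,
            LinearMap.lTensor_tmul, LinearMap.rTensor_tmul, TensorProduct.rid_tmul,
            TensorProduct.lid_tmul, coop_counit, TensorProduct.smul_tmul_smul, TensorProduct.smul_tmul_smul, mul_comm]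
    rw [comul_mk]
    refine (key _ _ toDual_mk toHopf_mk _ _).trans ?_
    rw [lTensor_counit_comul, rTensor_counit_comul, TensorProduct.rid_tmul, TensorProduct.lid_tmul,
      one_smul, one_smul]
    rfl

theorem exists_eq_mk_of_isGroupLikeElem {z : Double k H} (hz : IsGroupLikeElem k z) :
    ∃ f b, IsGroupLikeElem k f ∧ IsGroupLikeElem k b ∧ z = mk f b := by
  refine ⟨toDual z, toHopf z, hz.map toDual, hz.map toHopf, ?_⟩
  have := map_toDual_toHopf_comul z
  rw [hz.comul_eq_tmul_self] at this
  exact this.symm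

end Double
end General

/-! ### Products in the double of H_𝒟 and its characters. -/

section RankOne

open Double RankOne

variable {k : Type*} [Field k] {G : Type*} [CommGroup G] [Finite G] (χ : G →* kˣ) (a : G)

theorem antipodeInv_eq (h : RankOne χ a) : antipodeInv k (RankOne χ a) h = antiInv χ a h :=
  antipode_inj (k := k) ((antipode_antipodeInv h).trans (anti_antiInv χ a h).symm)

theorem leftMul_grp (g : G) : leftMul (k := k) (grp χ a g) =
    opL (grp χ a g) * opM (grp χ a g) * opR (grp χ a g) := by
  simp [leftMul, LinearMap.convMul_def]

/-- The three summands come from the iterated coproduct x ⊗ a ⊗ a + 1 ⊗ x ⊗ a + 1 ⊗ 1 ⊗ x. -/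
theorem leftMul_x : leftMul (k := k) (x χ a) =
    opL (x χ a) * opM (grp χ a a) * opR (grp χ a a) + opM (x χ a) * opR (grp χ a a) +
      opR (x χ a) := by
  simp [leftMul, LinearMap.convMul_def, Algebra.TensorProduct.one_def, opL_one, opM_one, add_mul]

theorem ofHopf_grp_mul_mk (g : G) (f : ConvDual k (RankOne χ a)) (b : RankOne χ a) :
    ofHopf (grp χ a g) * mk f b =
      mk (leftHit (grp χ a g) (rightHit (grp χ a g⁻¹) f)) (grp χ a g * b) := by
  rw [ofHopf_mul]
  change leftMul (grp χ a g) (f ⊗ₜ[k] b) = _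
  rw [leftMul_grp, Module.End.mul_apply, Module.End.mul_apply, opR_tmul, opM_tmul,
    opL_tmul, antipodeInv_eq, antiInv_grp]
  rfl

/-- The negative term arises from S⁻¹(x) = -a⁻¹x. All relations between x and H^* used below follow
from this formula. -/
theorem ofHopf_x_mul_mk (f : ConvDual k (RankOne χ a)) (b : RankOne χ a) :
    ofHopf (x χ a) * mk f b =
      mk (leftHit (x χ a) (rightHit (grp χ a a⁻¹) f)) (grp χ a a * b) +
        mk (rightHit (grp χ a a⁻¹) f) (x χ a * b) -
        mk (rightHit (grp χ a a⁻¹ * x χ a) f) b := by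
  rw [ofHopf_mul]
  change leftMul (x χ a) (f ⊗ₜ[k] b) = _
  rw [leftMul_x, LinearMap.add_apply, LinearMap.add_apply, Module.End.mul_apply,
    Module.End.mul_apply, Module.End.mul_apply, opR_tmul, opM_tmul, opM_tmul,
    opL_tmul, opR_tmul, antipodeInv_eq, antipodeInv_eq, antiInv_grp, antiInv_x, map_neg, sub_eq_add_neg,
    LinearMap.neg_apply, TensorProduct.neg_tmul]
  rfl

theorem charTwist_grp (β : G →* kˣ) (g : G) :
    charTwist (charHom χ a β) (grp χ a g) = (β g : k) • grp χ a g := by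
  rw [charTwist_of_isGroupLikeElem _ (isGroupLikeElem_grp χ a g), charHom_grp]

theorem charTwist_x (β : G →* kˣ) :
    charTwist (charHom χ a β) (x χ a) = (β a : k) • x χ a := by
  rw [charTwist_apply']
  simp

theorem leftCharTwist_grp (β : G →* kˣ) (g : G) :
    leftCharTwist (charHom χ a β) (grp χ a g) = (β g : k) • grp χ a g := by
  rw [leftCharTwist_apply]
  simp

theorem leftCharTwist_x (β : G →* kˣ) :
    leftCharTwist (charHom χ a β) (x χ a) = x χ a := by
  rw [leftCharTwist_apply]
  simp

/-- For `(g, β)` in `K`, conjugation by `g` intertwines the two translations by `β`. -/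
theorem leftCharTwist_mul_grp {g : G} {β : G →* kˣ} (h : β a = χ g) (b : RankOne χ a) :
    leftCharTwist (charHom χ a β) b * grp χ a g = grp χ a g * charTwist (charHom χ a β) b := by
  induction b using RankOne.induction with
  | hone => simp
  | hadd u v hu hv => simp only [map_add, add_mul, mul_add, hu, hv]
  | hsmul c u hu => simp only [map_smul, smul_mul_assoc, mul_smul_comm, hu]
  | hgrp c u hu =>
    rw [map_mul, map_mul, mul_assoc, hu, leftCharTwist_grp, charTwist_grp, smul_mul_assoc,
      smul_mul_assoc, mul_smul_comm, ← mul_assoc, ← mul_assoc, ← grp_mul, ← grp_mul, mul_comm c]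
  | hx u hu =>
    rw [map_mul, map_mul, mul_assoc, hu, leftCharTwist_x, charTwist_x, ← mul_assoc, x_grp,
      smul_mul_assoc, smul_mul_assoc, mul_smul_comm, mul_assoc, h]

theorem charTwist_comp_charTwist_inv (β : G →* kˣ) (b : RankOne χ a) :
    charTwist (charHom χ a β) (charTwist (charHom χ a β⁻¹) b) = b := by
  have : (charTwist (charHom χ a β)).comp (charTwist (charHom χ a β⁻¹)) = AlgHom.id k _ :=
    algHom_ext (fun g => by simp [charTwist_grp, smul_smul]) (by simp [charTwist_x, smul_smul])
  exact DFunLike.congr_fun this b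

section CharForm

/-- The linear form `f ⊗ b ↦ f(g) β(b)` on the double. -/
def charForm (p : G × (G →* kˣ)) : DoubleRankOne χ a →ₗ[k] k :=
  LinearMap.mul' k k ∘ₗ TensorProduct.map
    (Module.Dual.eval k (RankOne χ a) (grp χ a p.1) ∘ₗ (WithConv.linearEquiv k _).toLinearMap)
    (charHom χ a p.2).toLinearMap

theorem charForm_mk (p : G × (G →* kˣ)) (f : ConvDual k (RankOne χ a)) (b : RankOne χ a) :
    charForm χ a p (mk f b) = f.ofConv (grp χ a p.1) * charHom χ a p.2 b := rfl

theorem charForm_ofDual_mul (p : G × (G →* kˣ)) (f : ConvDual k (RankOne χ a))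
    (v : DoubleRankOne χ a) :
    charForm χ a p (ofDual f * v) = f.ofConv (grp χ a p.1) * charForm χ a p v := by
  induction v using Double.induction with
  | zero => rw [mul_zero, map_zero, mul_zero]
  | add u v hu hv => rw [mul_add, map_add, map_add, mul_add, hu, hv]
  | tmul g b =>
    rw [ofDual_mul_mk, charForm_mk, charForm_mk, convDual_eq, comul_grp, TensorProduct.map_tmul,
      LinearMap.mul'_apply, mul_assoc]

/-- Multiplicativity need only be checked on generators. For g in G it holds because G is
commutative; for x it is where membership in K is used. -/
theorem charForm_ofHopf_mul {p : G × (G →* kˣ)} (hp : p ∈ kerEv χ a) (h : RankOne χ a)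
    (v : DoubleRankOne χ a) :
    charForm χ a p (ofHopf h * v) = charHom χ a p.2 h * charForm χ a p v := by
  rw [mem_kerEv] at hp
  induction h using RankOne.induction generalizing v with
  | hone => rw [ofHopf_one, one_mul, map_one, one_mul]
  | hadd u v hu hv => rw [map_add, add_mul, map_add, hu, hv, map_add, add_mul]
  | hsmul c u hu => rw [map_smul, smul_mul_assoc, map_smul, hu, map_smul, smul_mul_assoc]
  | hgrp g u hu =>
    rw [ofHopf_map_mul, mul_assoc, map_mul (charHom χ a p.2), mul_assoc, ← hu]
    generalize ofHopf u * v = w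
    induction w using Double.induction with
    | zero => rw [mul_zero, map_zero, mul_zero]
    | add u v hu hv => rw [mul_add, map_add, map_add, mul_add, hu, hv]
    | tmul f b =>
      rw [ofHopf_grp_mul_mk, charForm_mk, charForm_mk, leftHit_apply, rightHit_apply,
        map_mul (charHom χ a p.2), ← grp_mul, ← grp_mul, mul_comm p.1 g, inv_mul_cancel_left]
      ring
  | hx u hu =>
    rw [ofHopf_map_mul, mul_assoc, map_mul (charHom χ a p.2), mul_assoc, ← hu]
    generalize ofHopf u * v = w
    induction w using Double.induction with
    | zero => rw [mul_zero, map_zero, mul_zero]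
    | add u v hu hv => rw [mul_add, map_add, map_add, mul_add, hu, hv]
    | tmul f b =>
      -- The middle term vanishes because β(x) = 0. The outer terms are β(a) f(a⁻¹gx)β(b) and χ(g)
      -- f(a⁻¹gx)β(b), which cancel because β(a) = χ(g).
      rw [ofHopf_x_mul_mk, map_sub, map_add, charForm_mk, charForm_mk, charForm_mk, leftHit_apply,
        rightHit_apply, rightHit_apply, rightHit_apply, map_mul (charHom χ a p.2),
        map_mul (charHom χ a p.2), charHom_x, charHom_grp, hp,
        mul_assoc (grp χ a a⁻¹), x_grp, mul_smul_comm, map_smul, smul_eq_mul]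
      ring

/-- The character `f ⊗ b ↦ f(g) β(b)` of the double, for `(g, β)` in `K`. -/
def doubleChar {p : G × (G →* kˣ)} (hp : p ∈ kerEv χ a) : DoubleRankOne χ a →ₐ[k] k :=
  AlgHom.ofLinearMap (charForm χ a p)
    (by rw [Double.one_def, charForm_mk, map_one, mul_one]; exact counit_grp χ a p.1)
    fun u v => by
      induction u using Double.induction with
      | zero => rw [zero_mul, map_zero, zero_mul]
      | add u w hu hw => rw [add_mul, map_add, map_add, add_mul, hu, hw]
      | tmul f b =>
        rw [mk_eq, mul_assoc, charForm_ofDual_mul, charForm_ofHopf_mul χ a hp, ← mul_assoc, ← mk_eq,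
          charForm_mk]

theorem doubleChar_mk {p : G × (G →* kˣ)} (hp : p ∈ kerEv χ a) (f : ConvDual k (RankOne χ a))
    (b : RankOne χ a) :
    doubleChar χ a hp (mk f b) = f.ofConv (grp χ a p.1) * charHom χ a p.2 b := rfl

end CharForm

theorem rightHit_map_mul {H : Type*} [Ring H] [HopfAlgebra k H] (b c : H) (f : ConvDual k H) :
    rightHit c (rightHit b f) = rightHit (b * c) f := by
  ext d
  rw [rightHit_apply, rightHit_apply, rightHit_apply, mul_assoc]

/-- The twist acts factor by factor. This explicit form shows that inverse elements of K give
inverse twists. -/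
theorem charTwist_doubleChar {p : G × (G →* kˣ)} (hp : p ∈ kerEv χ a)
    (f : ConvDual k (RankOne χ a)) (b : RankOne χ a) :
    charTwist (doubleChar χ a hp) (mk f b) =
      mk (rightHit (grp χ a p.1) f) (charTwist (charHom χ a p.2) b) := by
  have key : ∀ (Λ : ConvDual k (RankOne χ a) ⊗[k] RankOne χ a →ₗ[k] k)
      (ev : ConvDual k (RankOne χ a) →ₗ[k] k) (β : RankOne χ a →ₗ[k] k)
      (_ : ∀ f b, Λ (f ⊗ₜ[k] b) = ev f * β b)
      (s : ConvDual k (RankOne χ a) ⊗[k] ConvDual k (RankOne χ a))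
      (t : RankOne χ a ⊗[k] RankOne χ a),
      TensorProduct.rid k _ (Λ.lTensor _ (TensorProduct.tensorTensorTensorComm k _ _ _ _
        (s ⊗ₜ[k] t))) =
      TensorProduct.rid k _ (ev.lTensor _ s) ⊗ₜ[k] TensorProduct.rid k _ (β.lTensor _ t) := by
    intro Λ ev β hΛ s t
    induction s with
    | zero => simp
    | add x y hx hy => simp only [map_add, TensorProduct.add_tmul, hx, hy]
    | tmul p q =>
      induction t with
      | zero => simp
      | add x y hx hy => simp only [map_add, TensorProduct.tmul_add, hx, hy]
      | tmul c d =>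
        simp only [TensorProduct.tensorTensorTensorComm_tmul, LinearMap.lTensor_tmul, hΛ,
          TensorProduct.rid_tmul, TensorProduct.smul_tmul_smul]
  rw [charTwist_apply', comul_mk]
  refine (key (doubleChar χ a hp).toLinearMap (Module.Dual.eval k (RankOne χ a) (grp χ a p.1) ∘ₗ
    (WithConv.linearEquiv k _).toLinearMap) (charHom χ a p.2).toLinearMap
    (fun f b => doubleChar_mk χ a hp f b) _ _).trans ?_
  rw [rid_lTensor_comul, ← charTwist_apply']
  rfl

theorem charTwist_comp_doubleChar_inv {p : G × (G →* kˣ)} (hp : p ∈ kerEv χ a) :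
    (charTwist (doubleChar χ a hp)).comp (charTwist (doubleChar χ a (inv_mem hp))) =
      AlgHom.id k _ := by
  ext u
  rw [AlgHom.comp_apply, AlgHom.id_apply]
  induction u using Double.induction with
  | zero => rw [map_zero, map_zero]
  | add u v hu hv => rw [map_add, map_add, hu, hv]
  | tmul f b =>
    rw [charTwist_doubleChar, charTwist_doubleChar, rightHit_map_mul, Prod.fst_inv, Prod.snd_inv,
      charTwist_comp_charTwist_inv, grp_inv_mul]
    congr 1
    ext d
    rw [rightHit_apply, one_mul]

end RankOne

/-! ### Classification of characters and central group-like elements of the double. -/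

section Classification

open Double RankOne

variable {k : Type*} [Field k] {G : Type*} [CommGroup G] [Finite G] (χ : G →* kˣ) (a : G)

namespace Double

variable {H : Type*} [Ring H] [HopfAlgebra k H] [BijectiveAntipode k H] [Module.Finite k H]

theorem zero_mk (b : H) : Double.mk (0 : ConvDual k H) b = 0 := TensorProduct.zero_tmul _ _

theorem smul_mk_smul (c d : k) (f : ConvDual k H) (b : H) :
    Double.mk (c • f) (d • b) = (c * d) • Double.mk f b := TensorProduct.smul_tmul_smul _ _ _ _

end Double

/-- Characters of G, extended to H_𝒟 by zero on x, separate the first components; taking f = ε in f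
⊗ g isolates the second. -/
theorem doubleChar_injective [IsAlgClosed k] [CharZero k] {p q : G × (G →* kˣ)}
    (hp : p ∈ kerEv χ a) (hq : q ∈ kerEv χ a)
    (h : doubleChar χ a hp = doubleChar χ a hq) : p = q := by
  have e : ∀ (f : ConvDual k (RankOne χ a)) (b : RankOne χ a), f.ofConv (grp χ a p.1) * charHom χ a p.2 b =
      f.ofConv (grp χ a q.1) * charHom χ a q.2 b := fun f b => DFunLike.congr_fun h (mk f b)
  refine Prod.ext ?_ ?_
  · by_contra hne
    have h1 : p.1 * q.1⁻¹ ≠ 1 := fun h => hne (mul_inv_eq_one.1 h)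
    obtain ⟨γ, hγ⟩ := CommGroup.exists_apply_ne_one_of_hasEnoughRootsOfUnity G k h1
    have h2 := e (dualOfHom (charHom χ a γ)) 1
    rw [map_one, map_one, mul_one, mul_one, dualOfHom_apply, dualOfHom_apply, charHom_grp,
      charHom_grp] at h2
    exact hγ (by rw [map_mul, map_inv, mul_inv_eq_one]; exact Units.ext h2)
  · refine MonoidHom.ext fun g => Units.ext ?_
    have h2 := e (dualOfHom (Bialgebra.counitAlgHom k _)) (grp χ a g)
    simpa using h2

variable {χ a} in
/-- The characters of the double are those attached to the elements of `K`. -/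
theorem exists_eq_doubleChar [Infinite k] (hχa : χ a ≠ 1) (α : DoubleRankOne χ a →ₐ[k] k) :
    ∃ (p : G × (G →* kˣ)) (hp : p ∈ kerEv χ a), α = doubleChar χ a hp := by
  obtain ⟨β, hβ⟩ := exists_eq_charHom χ a (AlgHom.ofLinearMap (α.toLinearMap ∘ₗ ofHopf)
    (by rw [LinearMap.comp_apply, ofHopf_one]; exact map_one α)
    fun b c => by rw [LinearMap.comp_apply, ofHopf_map_mul]; exact map_mul α _ _)
  replace hβ : ∀ b, α (ofHopf b) = charHom χ a β b := fun b => DFunLike.congr_fun hβ b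
  -- By finite duality the restriction of α to H^* is evaluation at some h, and its multiplicativity
  -- makes h group-like.
  obtain ⟨h, hh⟩ := (Module.evalEquiv k (RankOne χ a)).surjective
    (α.toLinearMap ∘ₗ ofDual ∘ₗ (WithConv.linearEquiv k (Module.Dual k (RankOne χ a))).symm.toLinearMap)
  replace hh : ∀ f : ConvDual k (RankOne χ a), α (ofDual f) = f.ofConv h := fun f =>
    (LinearMap.congr_fun hh f.ofConv).symm
  obtain ⟨g, rfl⟩ := exists_eq_grp χ a (isGroupLikeElem_of_forall_dual (h := h)
    (by rw [← hh]; exact map_one α) fun f f' => by rw [← hh, ← hh, ← hh, ofDual_map_mul, map_mul])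
  have hmk : ∀ f b, α (mk f b) = f.ofConv (grp χ a g) * charHom χ a β b := fun f b => by
    rw [mk_eq, map_mul, hh, hβ]
  have hp : (g, β) ∈ kerEv χ a := by
    rw [mem_kerEv]
    -- A functional f not vanishing at a⁻¹gx exists because x ≠ 0. Applying α to x(f ⊗ 1), where
    -- α(x) = 0, leaves (β(a) - χ(g)) f(a⁻¹gx) = 0.
    have hne : grp χ a a⁻¹ * (grp χ a g * x χ a) ≠ 0 := by
      intro h0
      refine x_ne_zero χ a hχa ?_
      rw [← mul_assoc, ← grp_mul] at h0
      have := congrArg (grp χ a (a⁻¹ * g)⁻¹ * ·) h0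
      simpa only [← mul_assoc, grp_inv_mul, one_mul, mul_zero] using this
    have h1 : ¬ ∀ f : Module.Dual k (RankOne χ a), f (grp χ a a⁻¹ * (grp χ a g * x χ a)) = 0 :=
      fun h => hne ((Module.forall_dual_apply_eq_zero_iff k _).1 h)
    push Not at h1
    obtain ⟨f, hf⟩ := h1
    have h2 : α (ofHopf (x χ a) * mk (toConv f) 1) = 0 := by
      rw [map_mul, hβ, charHom_x, zero_mul]
    rw [ofHopf_x_mul_mk, map_sub, map_add, hmk, hmk, hmk, leftHit_apply, rightHit_apply,
      rightHit_apply, rightHit_apply, mul_one, mul_one, charHom_x, charHom_grp, mul_zero, add_zero,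
      map_one, mul_one, mul_assoc (grp χ a a⁻¹), x_grp, mul_smul_comm, map_smul, smul_eq_mul,
      mul_comm, ← sub_mul] at h2
    exact Units.ext (sub_eq_zero.1 ((mul_eq_zero.1 h2).resolve_right hf))
  refine ⟨(g, β), hp, AlgHom.ext fun u => ?_⟩
  induction u using Double.induction with
  | zero => rw [map_zero, map_zero]
  | add u v hu hv => rw [map_add, map_add, hu, hv]
  | tmul f b => rw [hmk, doubleChar_mk]

/-- The group-like element `γ ⊗ g` of the double. -/
def doubleGrp (p : G × (G →* kˣ)) : DoubleRankOne χ a :=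
  mk (dualOfHom (charHom χ a p.2)) (grp χ a p.1)

/-- The pairing of characters with group-like elements is the one that defines K^⊥, so its radical
on K is K^⊥ ∩ K. -/
theorem doubleChar_doubleGrp {p : G × (G →* kˣ)} (hp : p ∈ kerEv χ a) (q : G × (G →* kˣ)) :
    doubleChar χ a hp (doubleGrp χ a q) = (toChar k G p q : kˣ) := by
  rw [doubleGrp, doubleChar_mk, dualOfHom_apply, charHom_grp, charHom_grp, toChar_apply,
    Units.val_mul, mul_comm]

/-- The terms in which x acts on γ vanish because γ(x) = 0. What remains is a scalar that equals 1
exactly on K. -/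
theorem ofHopf_x_mul_doubleGrp (p : G × (G →* kˣ)) :
    ofHopf (x χ a) * doubleGrp χ a p =
      ((p.2 a : k)⁻¹ * χ p.1) • (doubleGrp χ a p * ofHopf (x χ a)) := by
  have h1 : leftHit (x χ a) (rightHit (grp χ a a⁻¹) (dualOfHom (charHom χ a p.2))) = 0 := by
    ext b
    rw [leftHit_apply, rightHit_apply, dualOfHom_apply, map_mul, map_mul, charHom_x]
    simp
  have h2 : rightHit (grp χ a a⁻¹ * x χ a) (dualOfHom (charHom χ a p.2)) = 0 := by
    ext b
    rw [rightHit_apply, dualOfHom_apply, map_mul, map_mul, charHom_x]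
    simp
  have h3 : rightHit (grp χ a a⁻¹) (dualOfHom (charHom χ a p.2)) =
      (p.2 a : k)⁻¹ • dualOfHom (charHom χ a p.2) := by
    ext b
    rw [rightHit_apply, dualOfHom_apply, map_mul, charHom_grp]
    simp
  rw [doubleGrp, ofHopf_x_mul_mk, h1, h2, h3, mk_mul_ofHopf, x_grp]
  rw [zero_mk, zero_mk, zero_add, sub_zero, smul_mk_smul]

/-- The two products are mk of γ · (g ⇀ f ↼ g⁻¹) and of f · γ with g. Transposing the convolutions,
their equality becomes `leftCharTwist_mul_grp`. -/
theorem commute_doubleGrp_ofDual {p : G × (G →* kˣ)} (hp : p ∈ kerEv χ a)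
    (f : ConvDual k (RankOne χ a)) : Commute (doubleGrp χ a p) (ofDual f) := by
  rw [mem_kerEv] at hp
  have h1 : ofHopf (grp χ a p.1) * (ofDual f : DoubleRankOne χ a) =
      mk (leftHit (grp χ a p.1) (rightHit (grp χ a p.1⁻¹) f)) (grp χ a p.1) := by
    have := ofHopf_grp_mul_mk χ a p.1 f 1
    rwa [mul_one] at this
  change doubleGrp χ a p * ofDual f = ofDual f * doubleGrp χ a p
  rw [doubleGrp, ofDual_mul_mk, mk_eq, mul_assoc, h1, ofDual_mul_mk]
  congr 1
  ext b
  rw [mul_dualOfHom_apply, dualOfHom_mul_apply, leftHit_apply, rightHit_apply,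
    leftCharTwist_mul_grp χ a hp, ← mul_assoc, grp_inv_mul, one_mul]

theorem commute_doubleGrp_ofHopf {p : G × (G →* kˣ)} (hp : p ∈ kerEv χ a)
    (b : RankOne χ a) : Commute (doubleGrp χ a p) (ofHopf b) := by
  rw [mem_kerEv] at hp
  induction b using RankOne.induction with
  | hone => rw [ofHopf_one]; exact Commute.one_right _
  | hadd u v hu hv => rw [map_add]; exact hu.add_right hv
  | hsmul c u hu => rw [map_smul]; exact hu.smul_right c
  | hgrp c u hu =>
    rw [ofHopf_map_mul]
    refine Commute.mul_right ?_ hu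
    have : leftHit (grp χ a c) (rightHit (grp χ a c⁻¹) (dualOfHom (charHom χ a p.2))) =
        dualOfHom (charHom χ a p.2) := by
      ext b
      rw [leftHit_apply, rightHit_apply, dualOfHom_apply, dualOfHom_apply, map_mul, map_mul,
        mul_left_comm, ← map_mul, grp_inv_mul, map_one, mul_one]
    change doubleGrp χ a p * ofHopf _ = ofHopf _ * doubleGrp χ a p
    rw [doubleGrp, mk_mul_ofHopf, ofHopf_grp_mul_mk, this, ← grp_mul, ← grp_mul, mul_comm]
  | hx u hu =>
    rw [ofHopf_map_mul]
    refine Commute.mul_right ?_ hu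
    change _ = _
    rw [ofHopf_x_mul_doubleGrp, hp, inv_mul_cancel₀ (Units.ne_zero _), one_smul]

theorem doubleGrp_mem_centralGroupLike {p : G × (G →* kˣ)} (hp : p ∈ kerEv χ a) :
    doubleGrp χ a p ∈ centralGroupLike k (DoubleRankOne χ a) := by
  refine ⟨isGroupLikeElem_mk (isGroupLikeElem_dualOfHom _) (isGroupLikeElem_grp χ a _), ?_⟩
  rw [Semigroup.mem_center_iff]
  intro u
  induction u using Double.induction with
  | zero => rw [zero_mul, mul_zero]
  | add u v hu hv => rw [add_mul, mul_add, hu, hv]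
  | tmul f b =>
    rw [mk_eq]
    exact ((commute_doubleGrp_ofDual χ a hp f).mul_right (commute_doubleGrp_ofHopf χ a hp b)).symm

theorem mk_ne_zero {H : Type*} [Ring H] [HopfAlgebra k H] [BijectiveAntipode k H]
    [Module.Finite k H] (γ : H →ₐ[k] k) {b : H} (hb : b ≠ 0) :
    Double.mk (dualOfHom γ) b ≠ 0 := by
  intro h
  refine hb ?_
  have h1 := congrArg toHopf h
  rwa [toHopf_mk, dualOfHom_apply, map_one, one_smul, map_zero] at h1

theorem doubleGrp_mul_doubleGrp (p : G × (G →* kˣ)) {q : G × (G →* kˣ)} (hq : q ∈ kerEv χ a) :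
    doubleGrp χ a p * doubleGrp χ a q = doubleGrp χ a (p * q) := by
  have h1 : dualOfHom (charHom χ a p.2) * dualOfHom (charHom χ a q.2) =
      dualOfHom (charHom χ a (p.2 * q.2)) := by
    ext b
    rw [mul_dualOfHom_apply, dualOfHom_apply, dualOfHom_apply, ← AlgHom.comp_apply]
    congr 1
    exact algHom_ext (fun g => by simp [charTwist_grp, mul_comm]) (by simp [charTwist_x])
  conv_lhs => rw [doubleGrp]
  -- The centrality of the second factor moves it past the group element of the first.
  rw [mk_eq, mul_assoc, ← (commute_doubleGrp_ofHopf χ a hq _).eq, ← mul_assoc, doubleGrp,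
    ofDual_mul_mk, mk_mul_ofHopf, h1, ← grp_mul, mul_comm q.1]
  rfl

variable {χ a} in
/-- The central group-like elements of the double are the elements of `K`. -/
theorem exists_eq_doubleGrp [Infinite k] (hχa : χ a ≠ 1) {z : DoubleRankOne χ a}
    (hz : z ∈ centralGroupLike k (DoubleRankOne χ a)) :
    ∃ p ∈ kerEv χ a, z = doubleGrp χ a p := by
  obtain ⟨hz, hc⟩ := hz
  obtain ⟨f, b, hf, hb, rfl⟩ := exists_eq_mk_of_isGroupLikeElem hz
  obtain ⟨g, rfl⟩ := exists_eq_grp χ a hb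
  obtain ⟨γ, rfl⟩ := exists_eq_dualOfHom hf
  obtain ⟨γ, rfl⟩ := exists_eq_charHom χ a γ
  refine ⟨(g, γ), ?_, rfl⟩
  rw [mem_kerEv]
  have h1 := ofHopf_x_mul_doubleGrp χ a (g, γ)
  replace h1 := ((hc.comm (ofHopf (x χ a))).eq).trans h1
  -- Since x ≠ 0, the scalar in the commutation rule with x can be compared with 1.
  have hne : doubleGrp χ a (g, γ) * ofHopf (x χ a) ≠ 0 := by
    rw [doubleGrp, mk_mul_ofHopf]
    refine mk_ne_zero _ fun h0 => x_ne_zero χ a hχa ?_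
    have := congrArg (grp χ a g⁻¹ * ·) h0
    simpa only [← mul_assoc, grp_inv_mul, one_mul, mul_zero] using this
  have h2 : (1 : k) = (γ a : k)⁻¹ * χ g :=
    smul_left_injective k hne ((one_smul k _).trans h1)
  rw [eq_inv_mul_iff_mul_eq₀ (Units.ne_zero _), mul_one] at h2
  exact Units.ext h2

end Classification

/-! ### Scalar action of central elements. -/

section Schur

/-- A central element acts on a simple module over a finite-dimensional algebra by a scalar. -/
theorem exists_smul_eq_of_mem_center {k A M : Type*} [Field k] [IsAlgClosed k] [Ring A] [Algebra k A]
    [Module.Finite k A] [AddCommGroup M] [Module k M] [Module A M] [IsScalarTower k A M]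
    [IsSimpleModule A M] {z : A} (hz : z ∈ Set.center A) : ∃ c : k, ∀ m : M, z • m = c • m := by
  have : Nontrivial M := IsSimpleModule.nontrivial A M
  obtain ⟨m, hm⟩ := exists_ne (0 : M)
  -- A simple module is a quotient of A, hence finite-dimensional, as Schur's lemma over an
  -- algebraically closed field requires.
  have : Module.Finite k M := Module.Finite.of_surjective
    ((LinearMap.toSpanSingleton A M m).restrictScalars k)
    (IsSimpleModule.toSpanSingleton_surjective A hm)
  let F : Module.End A M :=
    { toFun := fun m => z • m
      map_add' := smul_add z
      map_smul' := fun b m => by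
        rw [RingHom.id_apply, ← mul_smul, ← mul_smul, (hz.comm b).eq] }
  obtain ⟨c, hc⟩ := (IsSimpleModule.algebraMap_end_bijective_of_isAlgClosed k (A := A) (V := M)).2 F
  exact ⟨c, fun m => (LinearMap.congr_fun hc m).symm⟩

end Schur

/-! ### Nondegeneracy of the pairing and bijectivity of Φ. -/

section Main

open Double RankOne

variable {k : Type*} [Field k] {G : Type*} [CommGroup G] [Finite G] {χ : G →* kˣ} {a : G}

instance (H : Type*) [Ring H] [HopfAlgebra k H] [BijectiveAntipode k H] [Module.Finite k H] :
    Module.Finite k (Double k H) :=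
  have : Module.Finite k (ConvDual k H) := Module.Finite.equiv (WithConv.linearEquiv k _).symm
  inferInstanceAs (Module.Finite k (ConvDual k H ⊗[k] H))

variable (χ a) in
theorem charHom_one : charHom χ a 1 = Bialgebra.counitAlgHom k _ :=
  algHom_ext (by simp) (by simp)

/-- The pairing embeds K in its character group when the radical K^⊥ ∩ K is trivial, and the two
finite groups have the same order. -/
theorem exists_toChar_eq [IsAlgClosed k] [CharZero k]
    (h : kerEvPerp χ a ⊓ kerEv χ a = ⊥) (ν : kerEv χ a →* kˣ) :
    ∃ p ∈ kerEv χ a, ∀ q : kerEv χ a, toChar k G p q = ν q := by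
  let F : kerEv χ a →* (kerEv χ a →* kˣ) :=
    { toFun := fun p => (toChar k G p).comp (kerEv χ a).subtype
      map_one' := by ext; simp
      map_mul' := fun p q => by ext; simp }
  have hF : Function.Injective F := by
    rw [injective_iff_map_eq_one]
    rintro ⟨p, hp⟩ h1
    have h2 : p ∈ kerEvPerp χ a ⊓ kerEv χ a :=
      ⟨(mem_kerEvPerp χ a).2 fun q hq => DFunLike.congr_fun h1 (⟨q, hq⟩ : kerEv χ a), hp⟩
    rw [h, Subgroup.mem_bot] at h2
    exact Subtype.ext h2
  have hcard := CommGroup.card_monoidHom_of_hasEnoughRootsOfUnity (kerEv χ a) k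
  obtain ⟨⟨p, hp⟩, hν⟩ := (hF.bijective_of_nat_card_le hcard.le).2 ν
  exact ⟨p, hp, fun q => DFunLike.congr_fun hν q⟩

theorem exists_charTwist_inverse [Infinite k] (hχa : χ a ≠ 1) (α : DoubleRankOne χ a →ₐ[k] k) :
    ∃ β : DoubleRankOne χ a →ₐ[k] k, (charTwist β).comp (charTwist α) = AlgHom.id k _ ∧
      (charTwist α).comp (charTwist β) = AlgHom.id k _ := by
  obtain ⟨p, hp, rfl⟩ := exists_eq_doubleChar hχa α
  refine ⟨doubleChar χ a (inv_mem hp), ?_, charTwist_comp_doubleChar_inv χ a hp⟩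
  have := charTwist_comp_doubleChar_inv χ a (inv_mem hp)
  have e : doubleChar χ a (inv_mem (inv_mem hp)) = doubleChar χ a hp := by
    congr 1
    exact inv_inv p
  rwa [e] at this

theorem charTwist_surjective [Infinite k] (hχa : χ a ≠ 1) (α : DoubleRankOne χ a →ₐ[k] k) :
    Function.Surjective (charTwist α) := by
  obtain ⟨β, -, h⟩ := exists_charTwist_inverse hχa α
  exact fun b => ⟨charTwist β b, DFunLike.congr_fun h b⟩

/-- If `K^⊥ ∩ K = 1`, a character of the double is determined by its values on `K`. -/
theorem char_eq_of_eqOn_centralGroupLike [IsAlgClosed k] [CharZero k] (hχa : χ a ≠ 1)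
    (h : kerEvPerp χ a ⊓ kerEv χ a = ⊥) (α β : DoubleRankOne χ a →ₐ[k] k)
    (hαβ : ∀ z ∈ centralGroupLike k (DoubleRankOne χ a), α z = β z) : α = β := by
  obtain ⟨p, hp, rfl⟩ := exists_eq_doubleChar hχa α
  obtain ⟨q, hq, rfl⟩ := exists_eq_doubleChar hχa β
  -- Agreement on the central group-like elements means that the quotient of p by q lies in the
  -- radical of the pairing.
  have hpq : p * q⁻¹ ∈ kerEvPerp χ a ⊓ kerEv χ a := by
    refine ⟨(mem_kerEvPerp χ a).2 fun r hr => ?_,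
      show _ ∈ kerEv χ a from mul_mem hp (inv_mem hq)⟩
    have h1 := hαβ _ (doubleGrp_mem_centralGroupLike χ a hr)
    rw [doubleChar_doubleGrp, doubleChar_doubleGrp] at h1
    have h2 : toChar k G (p * q⁻¹) * toChar k G q = toChar k G p := by
      rw [← map_mul]
      exact congrArg _ (inv_mul_cancel_right p q)
    have h3 := DFunLike.congr_fun h2 r
    rw [Units.ext h1, MonoidHom.mul_apply] at h3
    exact mul_eq_right.1 h3
  rw [h, Subgroup.mem_bot] at hpq
  obtain rfl : p = q := (mul_inv_eq_one (a := p) (b := q)).1 hpq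
  rfl

/-- If `K^⊥ ∩ K = 1`, the central group-like elements act on a simple module through a character of
the double. -/
theorem exists_char_of_isSimpleModule [IsAlgClosed k] [CharZero k] (hχa : χ a ≠ 1)
    (h : kerEvPerp χ a ⊓ kerEv χ a = ⊥) (M : Type*) [AddCommGroup M] [Module k M]
    [Module (DoubleRankOne χ a) M] [IsScalarTower k (DoubleRankOne χ a) M]
    [IsSimpleModule (DoubleRankOne χ a) M] :
    ∃ α : DoubleRankOne χ a →ₐ[k] k, ∀ z ∈ centralGroupLike k (DoubleRankOne χ a),
      ∀ m : M, z • m = α z • m := by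
  have : Nontrivial M := IsSimpleModule.nontrivial (DoubleRankOne χ a) M
  obtain ⟨m, hm⟩ := exists_ne (0 : M)
  -- By Schur's lemma K acts on M by scalars c. They form a character of K, which the nondegenerate
  -- pairing realizes by a character of the double.
  choose c hc using fun p : kerEv χ a => exists_smul_eq_of_mem_center (k := k) (M := M)
    (doubleGrp_mem_centralGroupLike χ a p.2).2
  have hc1 : c 1 = 1 := smul_left_injective k hm (by
    change c 1 • m = (1 : k) • m
    rw [← hc, one_smul]
    have h1 : doubleGrp χ a (1 : kerEv χ a) = 1 := by
      change Double.mk (dualOfHom (charHom χ a 1)) (grp χ a 1) = Double.mk 1 1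
      rw [grp_one, charHom_one]
      rfl
    rw [h1, one_smul])
  have hcm : ∀ p q, c (p * q) = c p * c q := fun p q => smul_left_injective k hm (by
    change c (p * q) • m = (c p * c q) • m
    rw [← hc, mul_smul, ← hc q, ← hc p, ← mul_smul, doubleGrp_mul_doubleGrp χ a _ q.2]
    rfl)
  obtain ⟨p, hp, hpν⟩ := exists_toChar_eq h (MonoidHom.toHomUnits ⟨⟨c, hc1⟩, hcm⟩)
  refine ⟨doubleChar χ a hp, fun z hz m => ?_⟩
  obtain ⟨q, hq, rfl⟩ := exists_eq_doubleGrp hχa hz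
  rw [doubleChar_doubleGrp, hpν ⟨q, hq⟩]
  exact hc ⟨q, hq⟩ m

/-- The map `Φ` is a bijection if and only if `K^⊥ ∩ K = 1`. -/
theorem bijOn_tensorMap_iff {k : Type u} [Field k] [IsAlgClosed k] [CharZero k]
    {G : Type v} [CommGroup G] [Finite G] {χ : G →* kˣ} {a : G} (hχa : χ a ≠ 1) :
    Set.BijOn (tensorMap.{max u v} k (DoubleRankOne χ a))
        (simpleClasses (CentralQuotient k (DoubleRankOne χ a)) ×ˢ
          oneDimClasses (DoubleRankOne χ a) k)
        (simpleClasses (DoubleRankOne χ a)) ↔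
      kerEvPerp χ a ⊓ kerEv χ a = ⊥ := by
  constructor
  · intro hbij
    rw [eq_bot_iff]
    rintro p ⟨hp, hpK⟩
    -- An element of K^⊥ ∩ K is a character of the double that is trivial on all central group-like
    -- elements; injectivity of Φ makes it the counit, which corresponds to the identity of K.
    have h1 := eq_counit_of_injOn.{u, v} hbij.injOn (α := doubleChar χ a hpK) fun z hz => by
      obtain ⟨q, hq, rfl⟩ := exists_eq_doubleGrp hχa hz
      rw [doubleChar_doubleGrp, (mem_kerEvPerp χ a).1 hp q hq, Units.val_one]
    have h2 : doubleChar χ a (one_mem (kerEv χ a)) = Bialgebra.counitAlgHom k _ := by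
      refine AlgHom.ext fun u => ?_
      induction u using Double.induction with
      | zero => rw [map_zero, map_zero]
      | add u v hu hv => rw [map_add, map_add, hu, hv]
      | tmul f b =>
        rw [doubleChar_mk, Bialgebra.counitAlgHom_apply, counit_mk]
        change f.ofConv (grp χ a 1) * charHom χ a 1 b = _
        rw [grp_one, charHom_one]
        rfl
    exact doubleChar_injective χ a hpK (one_mem _) (h1.trans h2.symm)
  · intro h
    exact ⟨mapsTo_tensorMap (charTwist_surjective hχa),
      injOn_tensorMap.{u, v} (charTwist_surjective hχa) (char_eq_of_eqOn_centralGroupLike hχa h),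
      surjOn_tensorMap.{u, v} (exists_charTwist_inverse hχa) fun M hM =>
        exists_char_of_isSimpleModule hχa h M⟩

end Main

end HopfDouble

end

theorem theorem3p6 {k : Type u} [Field k] [IsAlgClosed k] [CharZero k]
    {G : Type v} [CommGroup G] [Finite G] (χ : G →* kˣ) (a : G) (hχa : χ a ≠ 1) :
    Set.MapsTo (HopfDouble.tensorMap.{max u v} k (HopfDouble.DoubleRankOne χ a))
        (HopfDouble.simpleClasses (HopfDouble.CentralQuotient k (HopfDouble.DoubleRankOne χ a)) ×ˢ
          HopfDouble.oneDimClasses (HopfDouble.DoubleRankOne χ a) k)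
        (HopfDouble.simpleClasses (HopfDouble.DoubleRankOne χ a)) ∧
      (Set.BijOn (HopfDouble.tensorMap.{max u v} k (HopfDouble.DoubleRankOne χ a))
          (HopfDouble.simpleClasses (HopfDouble.CentralQuotient k (HopfDouble.DoubleRankOne χ a)) ×ˢ
            HopfDouble.oneDimClasses (HopfDouble.DoubleRankOne χ a) k)
          (HopfDouble.simpleClasses (HopfDouble.DoubleRankOne χ a)) ↔
        Odd (orderOf (χ a)) ∧ orderOf (χ a) = orderOf a ∧ orderOf (χ a) = orderOf χ) ∧
      (Set.BijOn (HopfDouble.tensorMap.{max u v} k (HopfDouble.DoubleRankOne χ a))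
          (HopfDouble.simpleClasses (HopfDouble.CentralQuotient k (HopfDouble.DoubleRankOne χ a)) ×ˢ
            HopfDouble.oneDimClasses (HopfDouble.DoubleRankOne χ a) k)
          (HopfDouble.simpleClasses (HopfDouble.DoubleRankOne χ a)) ↔
        HopfDouble.kerEvPerp χ a ⊓ HopfDouble.kerEv χ a = ⊥) :=
  ⟨HopfDouble.mapsTo_tensorMap (HopfDouble.charTwist_surjective hχa),
    (HopfDouble.bijOn_tensorMap_iff hχa).trans (HopfDouble.kerEvPerp_inf_kerEv_eq_bot_iff χ a),
    HopfDouble.bijOn_tensorMap_iff hχa⟩
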